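/- Let $n,d$ be coprime positive integers with $n\neq d$ and $a\ge 0$ real. Let $CH(n,d,a)$ be the (cyclic-harmonic) plane curve given in polar coordinates by $r=\cos\frac nd\varphi+a$, $\varphi\in[0,2d\pi]$, placed isometrically in a plane of Euclidean 3-space that does not contain the axis $z$. Let $O$ be its pole $r=0$, which is an $n$-fold point of the algebraic curve $CH(n,d,a)$ (the Zariski closure) if $a=0$ and $nd$ is odd, and a $2n$-fold point otherwise. Let $q\in\mathbb R$, $p\in\mathbb C$, $p^2=q$, and $P_{1},P_2=(0,0,\pm p)$ (real and different, coinciding, or imaginary). The congruence $\mathcal C(p)$ consists of the circles through $P_1,P_2$, i.e. the circles which in a plane through $z$, with coordinate $u$ orthogonal to $z$, have an equation $u^2+z^2-q=ku$, $k\in\mathbb R$. The generalized rose surface $\mathcal{CS}=\mathcal{CS}(CH(n,d,a),p)$ is the (Zariski closure, in complex projective space, of the) union of the circles of $\mathcal C(p)$ that meet $CH(n,d,a)$ off the axis $z$. There is a positive integer $\delta$ such that all but finitely many of these circles carry exactly $\delta$ points of $CH(n,d,a)$ off $z$. The surface is counted with this multiplicity: if $F=0$ is its reduced equation, the order and the multiplicities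 below are those of $F^\delta=0$. In Types 1--4 one has $\delta=1$, so they are those of the surface itself. Consider the following positions of the curve. - Type 1: $O=P_1$ or $O=P_2$. - Type 2: $O\in z$, $O\ne P_1,P_2$. - Type 3: another real $j$-fold point $D^j\neq O$ ($j\ge1$) of the algebraic curve is $P_1$ or $P_2$. - Type 4: such a point $D^j$ lies on $z$ and $D^j\neq P_1,P_2$. - Type 5: the algebraic curve has no point on $z$. Case A means that $a=0$ and $nd$ is odd; case B means all other cases. Then $\mathcal{CS}$ has the order, and the absolute conic, the axis $z$, and each of the points $P_1,P_2$ have the multiplicities on it, given by: $$\begin{array}{|c|c|c|c|c|c|}\hline \text{Type}& &\text{order}&\text{absolute conic}&\text{axis }z&P_i\\\hline 1A&d<n&n+d&d&n-d&n\\ 1A&d>n&2d&d&0&d\\ 1B&d<n&2(n+d)&2d&2(n-d)&2n\\ 1B&d>n&4d&2d&0&2d\\\hline 2A&d<n&2n+d&d&2n-d&2n\\ 2A&d>n&n+2d&d&n&n+d\\ 2B&d<n&2(2n+d)&2d&2(2n-d)&4n\\ 2B&d>n&2(n+2d)&2d&2n&2(n+d)\\\hline 3A&d<n&3n+d-2j&n+d-j&n-d&2n-j\\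 3A&d>n&2(n+d)-2j&n+d-j&0&n+d-j\\ 3B&d<n&2(3n+d)-2j&2(n+d)-j&2(n-d)&4n-j\\ 3B&d>n&4(n+d)-2j&2(n+d)-j&0&2(n+d)-j\\\hline 4A&d<n&3n+d-j&n+d-j&n-d+j&2n\\ 4A&d>n&2(n+d)-j&n+d-j&j&n+d\\ 4B&d<n&2(3n+d)-j&2(n+d)-j&2(n-d)+j&4n\\ 4B&d>n&4(n+d)-j&2(n+d)-j&j&2(n+d)\\\hline 5A&d<n&3n+d&n+d&n-d&2n\\ 5A&d>n&2(n+d)&n+d&0&n+d\\ 5B&d<n&2(3n+d)&2(n+d)&2(n-d)&4n\\ 5B&d>n&4(n+d)&2(n+d)&0&2(n+d)\\\hline \end{array}$$ -/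

import Mathlib

open MvPolynomial

noncomputable section

/-- The Euclidean plane. -/
abbrev E2 : Type := EuclideanSpace ℝ (Fin 2)

/-- Euclidean 3-space, with coordinates `x = X 0`, `y = X 1`, `z = X 2`. -/
abbrev E3 : Type := EuclideanSpace ℝ (Fin 3)

/-! ### Orders of vanishing and equations of Zariski closures -/

/-- The order of vanishing of a nonzero polynomial `F` at the point `x`: the least degree of a
nonzero homogeneous component of the translated polynomial `F (X + x)`.  For an affine hypersurface
`F = 0` this is the multiplicity of the point `x`.  For a homogeneous `F` and `x ≠ 0` it is the
multiplicity of the projective hypersurface `F = 0` at the projective point represented by `x`. -/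
def ordAt {σ : Type} (F : MvPolynomial σ ℂ) (x : σ → ℂ) : ℕ :=
  sInf {k : ℕ | homogeneousComponent k (aeval (fun i => X i + C (x i)) F) ≠ 0}

/-- The multiplicity of the projective hypersurface `F = 0` along an irreducible projective variety,
given as the set `V` of all its representing nonzero vectors: the multiplicity at a general point
of the variety, which by semicontinuity is the least multiplicity at a point of it. -/
def multAlong {σ : Type} (F : MvPolynomial σ ℂ) (V : Set (σ → ℂ)) : ℕ :=
  sInf (ordAt F '' V)

/-- A point of the real plane, viewed in the complex plane. -/
def complexify (Q : E2) : Fin 2 → ℂ := fun i => (Q i : ℂ)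

/-- Homogeneous coordinates `(1 : x : y : z)` of a point of real 3-space. -/
def homog (X : E3) : Fin 4 → ℂ := ![1, (X 0 : ℂ), (X 1 : ℂ), (X 2 : ℂ)]

/-- `f` is an equation of the complex plane algebraic curve that is the Zariski closure of the set
`S` of real points (reduced, hence unique up to a constant). -/
def IsCurveEquation (S : Set E2) (f : MvPolynomial (Fin 2) ℂ) : Prop :=
  vanishingIdeal ℂ (complexify '' S) = Ideal.span {f}

/-- The real points of the Zariski closure of `S`. -/
def algCurve (S : Set E2) : Set E2 :=
  {Q | ∀ g ∈ vanishingIdeal ℂ (complexify '' S), aeval (complexify Q) g = 0}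

/-- `Q` is a `j`-fold point of the algebraic curve that is the Zariski closure of `S`. -/
def IsFoldPoint (S : Set E2) (j : ℕ) (Q : E2) : Prop :=
  1 ≤ j ∧ ∃ f : MvPolynomial (Fin 2) ℂ, IsCurveEquation S f ∧ ordAt f (complexify Q) = j

/-- `F` is an equation, in homogeneous coordinates `(x₀ : x₁ : x₂ : x₃) = (1 : x : y : z)`, of the
surface in complex projective 3-space that is the Zariski closure of the set `S` of real points
(reduced, hence unique up to a constant): `F` generates the ideal of the cone over `S`. -/
def IsSurfaceEquation (S : Set E3) (F : MvPolynomial (Fin 4) ℂ) : Prop :=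
  vanishingIdeal ℂ {v : Fin 4 → ℂ | ∃ t : ℂ, ∃ X ∈ S, v = t • homog X} = Ideal.span {F}

/-! ### Cyclic-harmonic curves -/

/-- The cyclic-harmonic curve `CH(n,d,a)`: `r = cos (n φ / d) + a`, `φ ∈ [0, 2dπ]`. -/
def CH (n d : ℕ) (a : ℝ) : Set E2 :=
  {Q | ∃ φ ∈ Set.Icc (0 : ℝ) (2 * d * Real.pi),
    Q = !₂[(Real.cos ((n : ℝ) / d * φ) + a) * Real.cos φ,
           (Real.cos ((n : ℝ) / d * φ) + a) * Real.sin φ]}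

/-! ### The congruence of circles and circular surfaces -/

/-- The axis `z` in real space. -/
def zAxis : Set E3 := {X | X 0 = 0 ∧ X 1 = 0}

/-- In the plane through the axis `z` spanned by the horizontal unit vector `v = (v₀, v₁, 0)`, with
coordinates `(u, z)`, the circle `u² + z² - q = k u`.  It meets the axis `z` exactly in the points
`z² = q` (it touches the axis at the origin if `q = 0`); its centre is `(k/2) v` and the square of
its radius is `k²/4 + q`. -/
def congruenceCircle (q v₀ v₁ k : ℝ) : Set E3 :=
  {X | ∃ u : ℝ, X 0 = u * v₀ ∧ X 1 = u * v₁ ∧ u ^ 2 + (X 2) ^ 2 - q = k * u}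

/-- The congruence of all circles through `P₁, P₂ = (0, 0, ±√q)`. -/
def congruence (q : ℝ) : Set (Set E3) :=
  {c | ∃ v₀ v₁ k : ℝ, v₀ ^ 2 + v₁ ^ 2 = 1 ∧ c = congruenceCircle q v₀ v₁ k}

/-- The circles of the congruence that meet the curve `α` at a point off the axis `z`. -/
def circleSystem (q : ℝ) (α : Set E3) : Set (Set E3) :=
  {c ∈ congruence q | (c ∩ (α \ zAxis)).Nonempty}

/-- The (real points swept out by the circles of the) circular surface `CS(α,p)`, `p² = q`. -/
def circularSurface (q : ℝ) (α : Set E3) : Set E3 := ⋃₀ circleSystem q α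

/-- A general circle of the system carries exactly `δ` points of `α`, that is, all but finitely
many of them do. -/
def IsCircleMultiplicity (q : ℝ) (α : Set E3) (δ : ℕ) : Prop :=
  {c ∈ circleSystem q α | (c ∩ (α \ zAxis)).ncard ≠ δ}.Finite

/-! ### The absolute conic, the axis and the points `P₁, P₂` in complex projective space -/

/-- The absolute conic `x₀ = 0`, `x₁² + x₂² + x₃² = 0`. -/
def absoluteConic : Set (Fin 4 → ℂ) :=
  {v | v ≠ 0 ∧ v 0 = 0 ∧ v 1 ^ 2 + v 2 ^ 2 + v 3 ^ 2 = 0}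

/-- The axis `z`: `x₁ = x₂ = 0`. -/
def projAxis : Set (Fin 4 → ℂ) := {v | v ≠ 0 ∧ v 1 = 0 ∧ v 2 = 0}

/-- The point `(0, 0, w)` of the axis. -/
def axisPoint (w : ℂ) : Fin 4 → ℂ := ![1, 0, 0, w]

/-- The real point `X` is one of the points `P₁ = (0,0,p)`, `P₂ = (0,0,-p)`. -/
def IsDirectingPoint (p : ℂ) (X : E3) : Prop :=
  homog X = axisPoint p ∨ homog X = axisPoint (-p)

/-- The surface `F = 0` has order `order`, and the absolute conic, the axis `z` and each of the
points `P₁`, `P₂` have the multiplicities `conic`, `axis` and `pts` on it. -/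
def HasRow (p : ℂ) (F : MvPolynomial (Fin 4) ℂ) (order conic axis pts : ℤ) : Prop :=
  (F.totalDegree : ℤ) = order ∧
  (multAlong F absoluteConic : ℤ) = conic ∧
  (multAlong F projAxis : ℤ) = axis ∧
  (ordAt F (axisPoint p) : ℤ) = pts ∧
  (ordAt F (axisPoint (-p)) : ℤ) = pts

end

open IntermediateField Module

/-! ### Evaluating forms and clearing denominators -/

/-! At a point off the axis put `κ = x² + y² + z² - q`, `ξ = x`, `η = y`. Two such points lie on one
circle of the congruence exactly when the ratios `(κ : ξ : η)` agree, so the circles are the points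
of a plane, and the circles meeting the curve trace a rational curve in it. Let `G(U, x, y)` be the
irreducible form of that curve, `g` its degree and `e` its degree in `U`. The surface is then `x₀ ^
e * G(Q / x₀, x, y) = 0` with `Q = x² + y² + z² - q x₀²` (`isSurfaceEquation_surfaceForm`). Scaling
arguments read off its invariants: order `g + e`, multiplicity `e` along the absolute conic, `g - e`
along the axis and `g` at `P₁`, `P₂` (`hasRow_surfaceForm`).

It remains to find `g` and `e`. With `t = exp(iφ/d)` the coordinates of the curve become Laurent
polynomials in `t`. Let `N` be the degree of `ℂ(t)` over the field generated by the ratios of `κ, ξ,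
η`. Then `e N` is the degree of the rational function `ξ / η` (`degreeOf_mul_finrank_eq`), and `g N`
is the degree of the triple `(κ, ξ, η)` freed from common factors (`degree_mul_finrank_eq`). The
field of the curve lies between, so `N = δ c`. Here `c` is the degree of the parametrisation, equal
to 2 in case A, where `t` and `-t` give the same point, and to 1 in case B (`finrank_chField`). The
factor `δ` is 1 or 2, because a circle meets the plane of the curve in at most two points off the
axis; it is also the number of points of the curve on a general circle. Passing to `F ^ δ` replaces
`g, e` by `δ g, δ e`, so that only `c` remains in the formulas.

Before cancellation the degrees are `2(n + d)` for the pair `ξ, η` and `2(n + d + max(n - d, 0))`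
for the triple. A `j`-fold point of the curve on the axis contributes a common factor of degree `j
c` to `ξ` and `η`; this factor divides `κ` as well when the point is `P₁` or `P₂`, and no factor is
shared by all three otherwise. At the pole it is `t^(2n) + 2a t^n + 1`. These numbers give every
row.

When the axis meets the plane in `Z`, the two points of a circle lie on a line through `Z` and have
a constant product of oriented distances from it. If `δ` were 2, the curve would therefore be
invariant under an inversion with centre `Z`. This is absurd when `Z` lies on the compact real curve
(`circleInjective_of_mem`), and at the pole it contradicts the zeros of the radius at complex
parameters (`circleInjective_of_origin`). -/

theorem aeval_smul_of_isHomogeneous {σ B : Type*} [Fintype σ] [CommRing B]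
    [Algebra ℂ B] {f : MvPolynomial σ ℂ} {k : ℕ} (hf : f.IsHomogeneous k) (c : B) (v : σ → B) :
    aeval (fun i => c * v i) f = c ^ k * aeval v f := by
  simp only [aeval_def, eval₂_eq', Finset.mul_sum]
  refine Finset.sum_congr rfl fun m hm => ?_
  have hk : ∑ i, m i = k := by
    have := hf.degree_eq_sum_deg_support hm
    rw [this]
    refine (Finset.sum_subset (Finset.subset_univ _) fun i _ hi => ?_).symm
    simpa using hi
  simp only [mul_pow, Finset.prod_mul_distrib, Finset.prod_pow_eq_pow_sum, hk]
  ring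

/-- Clearing denominators in `r (N / M)`, uniformly over all homomorphisms to a field. -/
theorem exists_clear_denominators {τ B : Type} [CommRing B] [Algebra ℂ B]
    (r : MvPolynomial τ ℂ) (N : τ → B) (M : B) :
    ∃ (H : B) (k : ℕ), ∀ (L : Type) [Field L] [Algebra ℂ L] (φ : B →ₐ[ℂ] L), φ M ≠ 0 →
      φ H = φ M ^ k * aeval (fun i => φ (N i) / φ M) r := by
  induction r using MvPolynomial.induction_on with
  | C a =>
    refine ⟨algebraMap ℂ B a, 0, fun L _ _ φ _ => ?_⟩
    simp
  | add p q hp hq =>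
    obtain ⟨H₁, k₁, h₁⟩ := hp
    obtain ⟨H₂, k₂, h₂⟩ := hq
    refine ⟨H₁ * M ^ k₂ + H₂ * M ^ k₁, k₁ + k₂, fun L _ _ φ hφ => ?_⟩
    rw [map_add, map_mul, map_mul, h₁ L φ hφ, h₂ L φ hφ, map_pow, map_pow, map_add]
    ring
  | mul_X p i hp =>
    obtain ⟨H₁, k₁, h₁⟩ := hp
    refine ⟨H₁ * N i, k₁ + 1, fun L _ _ φ hφ => ?_⟩
    rw [map_mul, h₁ L φ hφ, map_mul, aeval_X]
    field_simp
    ring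

/-! ### Computing orders of vanishing along lines -/

section Ord

variable {σ : Type}

theorem eval_translate (F : MvPolynomial σ ℂ) (x v : σ → ℂ) :
    eval v (aeval (fun i => X i + C (x i)) F) = eval (fun i => x i + v i) F := by
  induction F using MvPolynomial.induction_on with
  | C a => simp
  | add p q hp hq => simp only [map_add, hp, hq]
  | mul_X p i hp => simp only [map_mul, hp, aeval_X, map_add, eval_X, eval_C, add_comm]

/-- Along the line `x + ε v` the component of degree `i` of the translated polynomial contributes
exactly the term in `ε ^ i`. Orders of vanishing can therefore be computed by restriction to lines.
-/
theorem coeff_line_eq [Fintype σ] (F : MvPolynomial σ ℂ) (x v : σ → ℂ) (p : Polynomial ℂ)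
    (h : ∀ ε : ℂ, eval (fun i => x i + ε * v i) F = p.eval ε) (k : ℕ) :
    eval v (homogeneousComponent k (aeval (fun i => X i + C (x i)) F)) = p.coeff k := by
  set T : MvPolynomial σ ℂ := aeval (fun i => X i + C (x i)) F with hT
  have key : p = ∑ i ∈ Finset.range (T.totalDegree + 1),
      Polynomial.C (eval v (homogeneousComponent i T)) * Polynomial.X ^ i := by
    refine Polynomial.funext fun ε => ?_
    rw [← h ε, ← eval_translate F x (fun i => ε * v i), ← hT, Polynomial.eval_finsetSum]
    conv_lhs => rw [← sum_homogeneousComponent T, map_sum]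
    refine Finset.sum_congr rfl fun i _ => ?_
    have := aeval_smul_of_isHomogeneous (homogeneousComponent_isHomogeneous i T) ε v
    rw [aeval_eq_eval] at this
    rw [this]
    rw [aeval_eq_eval]
    simp only [Polynomial.eval_mul, Polynomial.eval_C, Polynomial.eval_pow, Polynomial.eval_X]
    ring
  rw [key]
  simp only [Polynomial.finsetSum_coeff, Polynomial.coeff_C_mul, Polynomial.coeff_X_pow]
  rcases lt_or_ge k (T.totalDegree + 1) with hk | hk
  · simp [hk]
  · have : homogeneousComponent k T = 0 := homogeneousComponent_eq_zero k T (by omega)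
    simp [this]

theorem translate_ne_zero {F : MvPolynomial σ ℂ} (hF : F ≠ 0) (x : σ → ℂ) :
    (aeval (fun i => X i + C (x i)) F : MvPolynomial σ ℂ) ≠ 0 := by
  intro h
  refine hF (MvPolynomial.funext fun v => ?_)
  have := eval_translate F x (fun i => v i - x i)
  rw [h] at this
  simpa using this.symm

/-- If `F` vanishes to order at least `k` at `x` along all lines, then `k ≤ ordAt F x`. -/
theorem le_ordAt [Fintype σ] {F : MvPolynomial σ ℂ} (hF : F ≠ 0) {x : σ → ℂ} {k : ℕ}
    (h : ∀ v : σ → ℂ, ∃ p : Polynomial ℂ, ∀ ε : ℂ,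
      eval (fun i => x i + ε * v i) F = ε ^ k * p.eval ε) : k ≤ ordAt F x := by
  refine le_csInf ?_ ?_
  -- The infimum of the empty set of naturals is `0`, so some component must first be shown to be
  -- nonzero.
  · by_contra hne
    rw [Set.not_nonempty_iff_eq_empty] at hne
    refine translate_ne_zero hF x ?_
    rw [← sum_homogeneousComponent (aeval (fun i => X i + C (x i)) F)]
    refine Finset.sum_eq_zero fun i _ => ?_
    by_contra hi
    exact (hne ▸ hi : i ∈ (∅ : Set ℕ))
  · intro l hl
    by_contra hlk
    push Not at hlk
    refine hl (MvPolynomial.funext fun v => ?_)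
    obtain ⟨p, hp⟩ := h v
    rw [coeff_line_eq F x v (Polynomial.X ^ k * p) (by simpa using hp) l,
      Polynomial.coeff_X_pow_mul', if_neg (by omega), map_zero]

/-- If moreover the order is exactly `k` along some line, then `ordAt F x = k`. -/
theorem ordAt_eq [Fintype σ] {F : MvPolynomial σ ℂ} {x : σ → ℂ} {k : ℕ}
    (h : ∀ v : σ → ℂ, ∃ p : Polynomial ℂ, ∀ ε : ℂ,
      eval (fun i => x i + ε * v i) F = ε ^ k * p.eval ε)
    (h' : ∃ (v : σ → ℂ) (p : Polynomial ℂ), p.eval 0 ≠ 0 ∧ ∀ ε : ℂ,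
      eval (fun i => x i + ε * v i) F = ε ^ k * p.eval ε) : ordAt F x = k := by
  obtain ⟨v, p, hp0, hp⟩ := h'
  have hF : F ≠ 0 := by
    rintro rfl
    have : Polynomial.X ^ k * p = 0 := Polynomial.funext fun ε => by simpa using (hp ε).symm
    simp at this
    simp [this] at hp0
  refine le_antisymm (Nat.sInf_le ?_) (le_ordAt hF h)
  intro h0
  have := coeff_line_eq F x v (Polynomial.X ^ k * p) (by simpa using hp) k
  rw [h0, Polynomial.coeff_X_pow_mul', if_pos le_rfl] at this
  simp [Polynomial.coeff_zero_eq_eval_zero] at this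
  exact hp0 this.symm

end Ord

/-! ### The surface of a ternary form

A form `G (U, x, y)` of degree `g` and of degree `e` in `U` gives the form
`F (x₀, x, y, z) = x₀ ^ e * G (Q / x₀, x, y)`, `Q = x ^ 2 + y ^ 2 + z ^ 2 - q * x₀ ^ 2`. -/

/-- `x₀ ^ e * G (U / x₀, x, y)` as a polynomial in `x₀, x, y, U`. -/
noncomputable def coneForm (e : ℕ) (G : MvPolynomial (Fin 3) ℂ) : MvPolynomial (Fin 4) ℂ :=
  ∑ m ∈ G.support, C (coeff m G) * X 0 ^ (e - m 0) * X 1 ^ m 1 * X 2 ^ m 2 * X 3 ^ m 0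

/-- The polynomials `x₀, x, y, x ^ 2 + y ^ 2 + z ^ 2 - q * x₀ ^ 2` in `x₀, x, y, z`. -/
noncomputable def sphereCoords (q : ℂ) : Fin 4 → MvPolynomial (Fin 4) ℂ :=
  ![X 0, X 1, X 2, X 1 ^ 2 + X 2 ^ 2 + X 3 ^ 2 - C q * X 0 ^ 2]

/-- The equation `x₀ ^ e * G (Q / x₀, x, y)` of the surface swept out by the circles of a curve. -/
noncomputable def surfaceForm (q : ℂ) (e : ℕ) (G : MvPolynomial (Fin 3) ℂ) :
    MvPolynomial (Fin 4) ℂ :=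
  aeval (sphereCoords q) (coneForm e G)

/-! ### Behaviour of the cone form under partial scalings -/

section Cone

variable {B : Type*} [CommRing B] [Algebra ℂ B] {e g : ℕ} {G : MvPolynomial (Fin 3) ℂ}

theorem aeval_fin_three (a b c : B) :
    aeval ![a, b, c] G = ∑ m ∈ G.support, algebraMap ℂ B (coeff m G) * a ^ m 0 * b ^ m 1 * c ^ m 2 := by
  rw [aeval_def, eval₂_eq']
  refine Finset.sum_congr rfl fun m _ => ?_
  simp [Fin.prod_univ_three, mul_assoc]

theorem aeval_coneForm (x₀ x y U : B) :
    aeval ![x₀, x, y, U] (coneForm e G) =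
      ∑ m ∈ G.support, algebraMap ℂ B (coeff m G) * x₀ ^ (e - m 0) * x ^ m 1 * y ^ m 2 * U ^ m 0 := by
  simp [coneForm, map_sum]

theorem le_degreeOf_of_mem {m : Fin 3 →₀ ℕ} (hm : m ∈ G.support) : m 0 ≤ degreeOf 0 G :=
  monomial_le_degreeOf 0 hm

theorem sum_eq_of_isHomogeneous (hG : G.IsHomogeneous g) {m : Fin 3 →₀ ℕ} (hm : m ∈ G.support) :
    m 0 + m 1 + m 2 = g := by
  have := hG.degree_eq_sum_deg_support hm
  rw [Finset.sum_subset (Finset.subset_univ _) (fun i _ hi => by simpa using hi)] at this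
  rw [this, Fin.sum_univ_three]

theorem degreeOf_le_of_isHomogeneous (hG : G.IsHomogeneous g) : degreeOf 0 G ≤ g :=
  (degreeOf_le_totalDegree _ _).trans hG.totalDegree_le

theorem coneForm_mul (he : degreeOf 0 G ≤ e) (x₀ x y U : B) :
    aeval ![x₀, x, y, x₀ * U] (coneForm e G) = x₀ ^ e * aeval ![U, x, y] G := by
  rw [aeval_coneForm, aeval_fin_three, Finset.mul_sum]
  refine Finset.sum_congr rfl fun m hm => ?_
  have h := (le_degreeOf_of_mem hm).trans he
  rw [mul_pow]
  conv_rhs => rw [← Nat.sub_add_cancel h, pow_add]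
  ring

/-- At `P₁` and `P₂` the coordinates `x`, `y` and `Q` all vanish; this scaling produces the
multiplicity `g` there. -/
theorem coneForm_smul_right (hG : G.IsHomogeneous g) (ε x₀ x y U : B) :
    aeval ![x₀, ε * x, ε * y, ε * U] (coneForm e G) =
      ε ^ g * aeval ![x₀, x, y, U] (coneForm e G) := by
  rw [aeval_coneForm, aeval_coneForm, Finset.mul_sum]
  refine Finset.sum_congr rfl fun m hm => ?_
  rw [← sum_eq_of_isHomogeneous hG hm]
  ring

/-- On the absolute conic `x₀` and `Q` vanish; this scaling produces the multiplicity `e` there. -/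
theorem coneForm_smul_left (he : degreeOf 0 G ≤ e) (ε x₀ x y U : B) :
    aeval ![ε * x₀, x, y, ε * U] (coneForm e G) =
      ε ^ e * aeval ![x₀, x, y, U] (coneForm e G) := by
  rw [aeval_coneForm, aeval_coneForm, Finset.mul_sum]
  refine Finset.sum_congr rfl fun m hm => ?_
  have h : ε ^ e = ε ^ (e - m 0) * ε ^ m 0 := by
    rw [← pow_add, Nat.sub_add_cancel ((le_degreeOf_of_mem hm).trans he)]
  rw [h]
  ring

/-- On the axis only `x` and `y` vanish, and a monomial has degree `g - m 0 = (g - e) + (e - m 0)`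
in them; the second summand is absorbed by `x₀`. -/
theorem coneForm_smul_mid (hG : G.IsHomogeneous g) (he : degreeOf 0 G ≤ e) (heg : e ≤ g)
    (ε x₀ x y U : B) :
    aeval ![x₀, ε * x, ε * y, U] (coneForm e G) =
      ε ^ (g - e) * aeval ![ε * x₀, x, y, U] (coneForm e G) := by
  rw [aeval_coneForm, aeval_coneForm, Finset.mul_sum]
  refine Finset.sum_congr rfl fun m hm => ?_
  have h := (le_degreeOf_of_mem hm).trans he
  have h' : m 1 + m 2 = (g - e) + (e - m 0) := by
    have := sum_eq_of_isHomogeneous hG hm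
    omega
  calc _ = algebraMap ℂ B (coeff m G) * x₀ ^ (e - m 0) * x ^ m 1 * y ^ m 2 * U ^ m 0 *
        ε ^ (m 1 + m 2) := by ring
    _ = _ := by rw [h']; ring

theorem coneForm_one (x y U : B) : aeval ![1, x, y, U] (coneForm e G) = aeval ![U, x, y] G := by
  rw [aeval_coneForm, aeval_fin_three]
  refine Finset.sum_congr rfl fun m _ => ?_
  simp
  ring

end Cone

/-! ### Order and multiplicities of the surface of a form -/

section Row

variable {e g : ℕ} {G : MvPolynomial (Fin 3) ℂ}

/-- Setting `x₀ = 0` leaves only the monomials of top degree in `U`, and these form a nonzero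
polynomial because the degree is attained. -/
theorem coneForm_zero_left_ne_zero (hG0 : G ≠ 0) :
    ∃ x y : ℂ, aeval ![0, x, y, 1] (coneForm (degreeOf 0 G) G) ≠ 0 := by
  set e := degreeOf 0 G with he
  obtain ⟨m, hm, hme⟩ : ∃ m ∈ G.support, m 0 = e := by
    have hne : G.support.Nonempty := by simpa [Finset.nonempty_iff_ne_empty] using hG0
    obtain ⟨m, hm, h⟩ := Finset.exists_mem_eq_sup G.support hne (fun m => m 0)
    exact ⟨m, hm, by rw [he, degreeOf_eq_sup, h]⟩
  set T : MvPolynomial (Fin 3) ℂ := ∑ m ∈ G.support.filter (fun m => m 0 = e), monomial m (coeff m G)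
    with hT
  have hT0 : T ≠ 0 := by
    intro h
    have hc : coeff m T = coeff m G := by
      rw [hT, coeff_sum]
      simp only [coeff_monomial]
      rw [Finset.sum_ite_eq' ]
      simp [hme]
      intro h; exact h.symm
    rw [h] at hc
    exact (mem_support_iff.1 hm) hc.symm
  obtain ⟨v, hv⟩ : ∃ v : Fin 3 → ℂ, eval v T ≠ 0 := by
    by_contra h
    push Not at h
    exact hT0 (MvPolynomial.funext fun v => by simpa using h v)
  have key : eval v T = aeval ![0, v 1, v 2, v 0] (coneForm e G) := by
    rw [aeval_coneForm, hT, map_sum, Finset.sum_filter]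
    refine Finset.sum_congr rfl fun m' hm' => ?_
    have hle := le_degreeOf_of_mem hm'
    split_ifs with h
    · rw [h, Nat.sub_self, ← h]
      simp [eval_monomial, Finsupp.prod_fintype, Fin.prod_univ_three]
      ring
    · rw [zero_pow (by omega)]
      simp
  refine ⟨v 1, v 2, fun h => hv ?_⟩
  have := coneForm_smul_left (G := G) he.ge (v 0) 0 (v 1) (v 2) (1 : ℂ)
  rw [mul_zero, mul_one, h, mul_zero] at this
  rw [key, this]

theorem eval_surfaceForm (q : ℂ) (v : Fin 4 → ℂ) :
    eval v (surfaceForm q e G) = aeval ![v 0, v 1, v 2, v 1 ^ 2 + v 2 ^ 2 + v 3 ^ 2 - q * v 0 ^ 2]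
      (coneForm e G) := by
  rw [surfaceForm, ← aeval_eq_eval]
  change (aeval v).comp (aeval (sphereCoords q)) (coneForm e G) = _
  rw [comp_aeval]
  congr 2
  ext i
  fin_cases i <;> simp [sphereCoords]

theorem surfaceForm_isHomogeneous (q : ℂ) (hG : G.IsHomogeneous g) (he : degreeOf 0 G ≤ e) :
    (surfaceForm q e G).IsHomogeneous (g + e) := by
  rw [surfaceForm, coneForm, map_sum]
  refine IsHomogeneous.sum _ _ _ fun m hm => ?_
  have h1 := (le_degreeOf_of_mem hm).trans he
  have h2 := sum_eq_of_isHomogeneous hG hm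
  have hQ : (X 1 ^ 2 + X 2 ^ 2 + X 3 ^ 2 - C q * X 0 ^ 2 : MvPolynomial (Fin 4) ℂ).IsHomogeneous 2 :=
    (((isHomogeneous_X_pow _ _).add (isHomogeneous_X_pow _ _)).add (isHomogeneous_X_pow _ _)).sub
      ((isHomogeneous_X_pow _ _).C_mul _)
  have : g + e = 0 + (e - m 0) + m 1 + m 2 + 2 * m 0 := by omega
  rw [this]
  simp only [map_mul, map_pow, aeval_X, algHom_C, sphereCoords, algebraMap_eq]
  exact ((((isHomogeneous_C _ _).mul (isHomogeneous_X_pow _ _)).mul (isHomogeneous_X_pow _ _)).mul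
    (isHomogeneous_X_pow _ _)).mul (hQ.pow _)

theorem exists_eval_ne_zero_of_ne_zero {σ : Type*} {H : MvPolynomial σ ℂ} (hH : H ≠ 0) :
    ∃ v : σ → ℂ, eval v H ≠ 0 := by
  by_contra h
  push Not at h
  exact hH (MvPolynomial.funext fun v => by simpa using h v)

theorem surfaceForm_ne_zero (q : ℂ) (hG0 : G ≠ 0) : surfaceForm q e G ≠ 0 := by
  obtain ⟨v, hv⟩ := exists_eval_ne_zero_of_ne_zero hG0
  -- This `z` makes `Q` equal to `v 0` at `(1, v 1, v 2, z)`, so every value of `G` is a value of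
  -- the surface form.
  obtain ⟨z, hz⟩ := IsAlgClosed.exists_pow_nat_eq (v 0 - v 1 ^ 2 - v 2 ^ 2 + q) (n := 2) two_pos
  intro h
  have := eval_surfaceForm (e := e) (G := G) q ![1, v 1, v 2, z]
  rw [h] at this
  simp only [Matrix.cons_val_zero, Matrix.cons_val_one, Matrix.cons_val, hz, coneForm_one] at this
  apply hv
  rw [map_zero] at this
  rw [this]
  have hv' : v = ![v 0, v 1, v 2] := by ext i; fin_cases i <;> rfl
  conv_lhs => rw [hv']
  rw [← aeval_eq_eval]
  congr 3
  ring

theorem X_zero_dvd_sub (G : MvPolynomial (Fin 3) ℂ) :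
    (X 0 : MvPolynomial (Fin 3) ℂ) ∣ G - aeval ![0, X 1, X 2] G := by
  induction G using MvPolynomial.induction_on with
  | C a => simp
  | add p q hp hq =>
    rw [map_add, add_sub_add_comm]
    exact dvd_add hp hq
  | mul_X p i hp =>
    rw [map_mul, aeval_X]
    have : p * X i - (aeval ![0, X 1, X 2] p) * (![0, X 1, X 2] : Fin 3 → MvPolynomial (Fin 3) ℂ) i =
      (p - aeval ![0, X 1, X 2] p) * X i +
        (aeval ![0, X 1, X 2] p) * (X i - (![0, X 1, X 2] : Fin 3 → MvPolynomial (Fin 3) ℂ) i) := by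
      ring
    rw [this]
    refine dvd_add (hp.mul_right _) (Dvd.dvd.mul_left ?_ _)
    fin_cases i <;> simp

/-- The value at `ε` of a polynomial obtained by substituting polynomials in the cone form. -/
theorem eval_aeval_coneForm (a b c d : Polynomial ℂ) (ε : ℂ) :
    (aeval ![a, b, c, d] (coneForm e G)).eval ε =
      aeval ![a.eval ε, b.eval ε, c.eval ε, d.eval ε] (coneForm e G) := by
  rw [aeval_coneForm, aeval_coneForm, Polynomial.eval_finsetSum]
  simp

/-- In direction `v` the coordinates `x`, `y`, `Q` are `ε` times `v 1`, `v 2` and `2 p v 3 - 2 q v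
0` up to higher order, and the lowest coefficient is the value of `G` there. -/
theorem ordAt_surfaceForm_axisPoint (p q : ℂ) (hp : p ^ 2 = q) (hG : G.IsHomogeneous g)
    (hG0 : G ≠ 0) (hU : ¬ X 0 ∣ G) :
    ordAt (surfaceForm q e G) (axisPoint p) = g := by
  have key : ∀ v : Fin 4 → ℂ, ∀ ε : ℂ,
      eval (fun i => axisPoint p i + ε * v i) (surfaceForm q e G) = ε ^ g *
      (aeval ![1 + Polynomial.X * Polynomial.C (v 0), Polynomial.C (v 1), Polynomial.C (v 2),
        Polynomial.C (2 * p * v 3 - 2 * q * v 0) +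
        Polynomial.X * Polynomial.C (v 1 ^ 2 + v 2 ^ 2 + v 3 ^ 2 - q * v 0 ^ 2)]
        (coneForm e G)).eval ε := by
    intro v ε
    rw [eval_surfaceForm, eval_aeval_coneForm, ← coneForm_smul_right hG]
    congr 2
    ext i
    fin_cases i <;> simp [axisPoint]
    · exact mul_comm _ _
    · rw [← hp]; ring
  refine ordAt_eq (fun v => ⟨_, key v⟩) ?_
  have hval : ∀ v : Fin 4 → ℂ, (aeval ![1 + Polynomial.X * Polynomial.C (v 0), Polynomial.C (v 1),
        Polynomial.C (v 2), Polynomial.C (2 * p * v 3 - 2 * q * v 0) +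
        Polynomial.X * Polynomial.C (v 1 ^ 2 + v 2 ^ 2 + v 3 ^ 2 - q * v 0 ^ 2)]
        (coneForm e G)).eval 0 = eval ![2 * p * v 3 - 2 * q * v 0, v 1, v 2] G := by
    intro v
    rw [eval_aeval_coneForm]
    simp [coneForm_one, aeval_eq_eval]
  -- For `p = 0` also `q = 0`, so `Q` vanishes to second order and only the values `G(0, ·, ·)`
  -- occur; they are not all zero because `X 0` does not divide `G`.
  by_cases h0 : p = 0
  · obtain ⟨v, hv⟩ : ∃ v : Fin 3 → ℂ, v 0 = 0 ∧ eval v G ≠ 0 := by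
      by_contra h
      push Not at h
      have hdvd := X_zero_dvd_sub G
      have h0 : (aeval ![0, X 1, X 2] G : MvPolynomial (Fin 3) ℂ) = 0 := by
        refine MvPolynomial.funext fun v => ?_
        have hc : (aeval v).comp (aeval ![0, X 1, X 2]) G = aeval ![0, v 1, v 2] G := by
          rw [comp_aeval]
          congr 2
          ext i
          fin_cases i <;> simp
        rw [map_zero, ← h ![0, v 1, v 2] rfl]
        exact hc
      rw [h0, sub_zero] at hdvd
      exact hU hdvd
    refine ⟨![0, v 1, v 2, 0], _, ?_, key _⟩
    rw [hval]
    convert hv.2 using 3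
    ext i; fin_cases i <;> simp [hv.1, h0]
  · obtain ⟨v, hv⟩ := exists_eval_ne_zero_of_ne_zero hG0
    refine ⟨![0, v 1, v 2, v 0 / (2 * p)], _, ?_, key _⟩
    rw [hval]
    convert hv using 3
    ext i; fin_cases i <;> simp
    field_simp

theorem multAlong_eq {σ : Type} {F : MvPolynomial σ ℂ} {V : Set (σ → ℂ)} {k : ℕ}
    (h : ∀ x ∈ V, k ≤ ordAt F x) (h' : ∃ x ∈ V, ordAt F x = k) : multAlong F V = k := by
  obtain ⟨x, hx, hk⟩ := h'
  refine le_antisymm (Nat.sInf_le ⟨x, hx, hk⟩) (le_csInf ⟨_, x, hx, rfl⟩ ?_)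
  rintro _ ⟨y, hy, rfl⟩
  exact h y hy

theorem multAlong_surfaceForm_projAxis (q : ℂ) (hG : G.IsHomogeneous g) (hG0 : G ≠ 0)
    (he : degreeOf 0 G = e) : multAlong (surfaceForm q e G) projAxis = g - e := by
  have hle : e ≤ g := he ▸ degreeOf_le_of_isHomogeneous hG
  have key : ∀ x ∈ projAxis, ∀ v : Fin 4 → ℂ, ∀ ε : ℂ,
      eval (fun i => x i + ε * v i) (surfaceForm q e G) = ε ^ (g - e) *
      (aeval ![Polynomial.X * (Polynomial.C (x 0) + Polynomial.X * Polynomial.C (v 0)),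
        Polynomial.C (v 1), Polynomial.C (v 2),
        (Polynomial.X * Polynomial.C (v 1)) ^ 2 + (Polynomial.X * Polynomial.C (v 2)) ^ 2 +
        (Polynomial.C (x 3) + Polynomial.X * Polynomial.C (v 3)) ^ 2 -
        Polynomial.C q * (Polynomial.C (x 0) + Polynomial.X * Polynomial.C (v 0)) ^ 2]
        (coneForm e G)).eval ε := by
    intro x hx v ε
    rw [eval_surfaceForm, eval_aeval_coneForm]
    obtain ⟨-, h1, h2⟩ := hx
    have := coneForm_smul_mid hG he.le hle ε (x 0 + ε * v 0) (v 1) (v 2)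
      ((ε * v 1) ^ 2 + (ε * v 2) ^ 2 + (x 3 + ε * v 3) ^ 2 - q * (x 0 + ε * v 0) ^ 2)
    simp only [h1, h2, zero_add]
    rw [this]
    simp only [Polynomial.eval_mul, Polynomial.eval_add, Polynomial.eval_sub, Polynomial.eval_pow,
      Polynomial.eval_X, Polynomial.eval_C]
  -- The least multiplicity is attained at the point at infinity of the axis, where `x₀ = 0` and `Q
  -- = 1`.
  refine multAlong_eq (fun x hx => le_ordAt (surfaceForm_ne_zero q hG0)
    fun v => ⟨_, key x hx v⟩) ⟨![0, 0, 0, 1], ⟨fun h => by simpa using congrFun h 3, rfl, rfl⟩, ?_⟩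
  have hx : (![0, 0, 0, 1] : Fin 4 → ℂ) ∈ projAxis := ⟨fun h => by simpa using congrFun h 3, rfl, rfl⟩
  refine ordAt_eq (fun v => ⟨_, key _ hx v⟩) ?_
  obtain ⟨x, y, hxy⟩ := coneForm_zero_left_ne_zero hG0
  refine ⟨![0, x, y, 0], _, ?_, key _ hx _⟩
  rw [eval_aeval_coneForm]
  rw [he] at hxy
  simpa using hxy

theorem multAlong_surfaceForm_absoluteConic (q : ℂ) (hG0 : G ≠ 0)
    (he : degreeOf 0 G ≤ e) : multAlong (surfaceForm q e G) absoluteConic = e := by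
  have key : ∀ x ∈ absoluteConic, ∀ v : Fin 4 → ℂ, ∀ ε : ℂ,
      eval (fun i => x i + ε * v i) (surfaceForm q e G) = ε ^ e *
      (aeval ![Polynomial.C (v 0), Polynomial.C (x 1) + Polynomial.X * Polynomial.C (v 1),
        Polynomial.C (x 2) + Polynomial.X * Polynomial.C (v 2),
        Polynomial.C (2 * (x 1 * v 1 + x 2 * v 2 + x 3 * v 3)) +
        Polynomial.X * Polynomial.C (v 1 ^ 2 + v 2 ^ 2 + v 3 ^ 2 - q * v 0 ^ 2)]
        (coneForm e G)).eval ε := by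
    intro x hx v ε
    rw [eval_surfaceForm, eval_aeval_coneForm, ← coneForm_smul_left he]
    obtain ⟨-, h1, h2⟩ := hx
    congr 2
    ext i
    fin_cases i <;> simp [h1]
    · exact mul_comm _ _
    · exact mul_comm _ _
    · linear_combination h2
  refine multAlong_eq (fun x hx => le_ordAt (surfaceForm_ne_zero q hG0)
    fun v => ⟨_, key x hx v⟩) ?_
  -- The factor `X 1` provides `v 1 ≠ 0`. A direction with second entry `v 0 / (2 v 1)` then gives
  -- `Q` the linear coefficient `v 0`.
  obtain ⟨v, hv⟩ := exists_eval_ne_zero_of_ne_zero (mul_ne_zero hG0 (X_ne_zero (R := ℂ) (1 : Fin 3)))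
  rw [map_mul, eval_X, mul_ne_zero_iff] at hv
  obtain ⟨z, hz⟩ := IsAlgClosed.exists_pow_nat_eq (- v 1 ^ 2 - v 2 ^ 2) (n := 2) two_pos
  have hx : (![0, v 1, v 2, z] : Fin 4 → ℂ) ∈ absoluteConic :=
    ⟨fun h => hv.2 (by simpa using congrFun h 1), rfl, by simp [hz]⟩
  refine ⟨_, hx, ordAt_eq (fun v => ⟨_, key _ hx v⟩) ⟨![1, v 0 / (2 * v 1), 0, 0], _, ?_, key _ hx _⟩⟩
  rw [eval_aeval_coneForm]
  have h1 := hv.2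
  have : 2 * (v 1 * (v 0 / (2 * v 1))) = v 0 := by field_simp
  simp [coneForm_one, this]
  have hv' : v = ![v 0, v 1, v 2] := by ext i; fin_cases i <;> rfl
  have := hv.1
  rw [hv', ← aeval_eq_eval] at this
  exact this

/-- The orders and multiplicities of the surface of a ternary form. -/
theorem hasRow_surfaceForm (p q : ℂ) (hp : p ^ 2 = q) (hG : G.IsHomogeneous g)
    (hG0 : G ≠ 0) (hU : ¬ X 0 ∣ G) (he : degreeOf 0 G = e) :
    HasRow p (surfaceForm q e G) (g + e) e (g - e) g := by
  have hle : e ≤ g := he ▸ degreeOf_le_of_isHomogeneous hG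
  refine ⟨?_, ?_, ?_, ?_, ?_⟩
  · rw [(surfaceForm_isHomogeneous q hG he.le).totalDegree (surfaceForm_ne_zero q hG0)]
    push_cast; rfl
  · rw [multAlong_surfaceForm_absoluteConic q hG0 he.le]
  · rw [multAlong_surfaceForm_projAxis q hG hG0 he]
    push_cast [hle]; rfl
  · rw [ordAt_surfaceForm_axisPoint p q hp hG hG0 hU]
  · rw [ordAt_surfaceForm_axisPoint (-p) q (by rw [neg_sq, hp]) hG hG0 hU]

end Row

/-! ### The irreducible form of a rational plane curve -/

/-- `G` is a form of degree `g` that generates the ideal of the forms vanishing at the point `P`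
with coordinates in the field of rational functions. -/
structure IsFormGenerator (P : Fin 3 → RatFunc ℂ) (G : MvPolynomial (Fin 3) ℂ) (g : ℕ) : Prop where
  isHomogeneous : G.IsHomogeneous g
  ne_zero : G ≠ 0
  aeval_eq_zero : aeval P G = 0
  dvd : ∀ (A : MvPolynomial (Fin 3) ℂ) (k : ℕ), A.IsHomogeneous k → aeval P A = 0 → G ∣ A

/-- A nonconstant rational function over `ℂ` is transcendental, so the dehomogenised form has no
coefficient left. -/
theorem eq_zero_of_aeval_binary {u : RatFunc ℂ} (hu : ¬∃ c, u = RatFunc.C c)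
    {a : MvPolynomial (Fin 2) ℂ} {k : ℕ} (ha : a.IsHomogeneous k) (h : aeval ![u, 1] a = 0) :
    a = 0 := by
  have htr := RatFunc.transcendental_of_ne_C u hu
  set q : Polynomial ℂ := aeval ![Polynomial.X, 1] a with hq
  have hq0 : q = 0 := by
    by_contra hne
    refine htr ⟨q, hne, ?_⟩
    have : (Polynomial.aeval u).comp (aeval ![Polynomial.X, 1]) a = aeval ![u, 1] a := by
      rw [comp_aeval]
      congr 2
      ext i
      fin_cases i <;> simp
    rw [← h, ← this]
    rfl
  -- Multiplication by `X 1` disposes of the points with `v 1 = 0`, where the form cannot be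
  -- dehomogenised.
  have hX : a * X 1 = 0 := by
    refine MvPolynomial.funext fun v => ?_
    rw [map_mul, eval_X, map_zero]
    by_cases hv : v 1 = 0
    · rw [hv, mul_zero]
    have h1 := aeval_smul_of_isHomogeneous ha (v 1) ![v 0 / v 1, 1]
    have h2 : (fun i => v 1 * ![v 0 / v 1, 1] i) = v := by
      ext i
      fin_cases i <;> simp
      field_simp
    have h3 : q.eval (v 0 / v 1) = aeval ![v 0 / v 1, 1] a := by
      have : (Polynomial.aeval (v 0 / v 1)).comp (aeval ![Polynomial.X, 1]) a =
          aeval ![v 0 / v 1, 1] a := by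
        rw [comp_aeval]
        congr 2
        ext i
        fin_cases i <;> simp
      rw [← this]
      rfl
    rw [h2, ← h3, hq0, Polynomial.eval_zero, mul_zero, aeval_eq_eval] at h1
    rw [h1, zero_mul]
  exact (mul_eq_zero.1 hX).resolve_right (X_ne_zero _)

theorem eq_zero_of_aeval_binary' {P₁ P₂ : RatFunc ℂ} (hP₂ : P₂ ≠ 0)
    (hu : ¬∃ c, P₁ / P₂ = RatFunc.C c) {a : MvPolynomial (Fin 2) ℂ} {k : ℕ}
    (ha : a.IsHomogeneous k) (h : aeval ![P₁, P₂] a = 0) : a = 0 := by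
  refine eq_zero_of_aeval_binary hu ha ?_
  have h1 := aeval_smul_of_isHomogeneous ha P₂ ![P₁ / P₂, 1]
  have h2 : (fun i => P₂ * ![P₁ / P₂, 1] i) = ![P₁, P₂] := by
    ext i
    fin_cases i <;> simp
    field_simp
  rw [h2, h] at h1
  exact (mul_eq_zero.1 h1.symm).resolve_left (pow_ne_zero _ hP₂)

open IntermediateField in
-- The coefficients of the minimal polynomial are fractions in `P 1 / P 2`. Clearing their
-- denominators and homogenising with `P 2` gives the form, and the degree in the first variable is
-- preserved.
theorem exists_form_of_minpoly {P : Fin 3 → RatFunc ℂ} (hP₂ : P 2 ≠ 0)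
    (halg : IsIntegral ℂ⟮P 1 / P 2⟯ (P 0 / P 2)) :
    ∃ (A : MvPolynomial (Fin 3) ℂ) (k : ℕ), A.IsHomogeneous k ∧ A ≠ 0 ∧ aeval P A = 0 ∧
      degreeOf 0 A ≤ (minpoly ℂ⟮P 1 / P 2⟯ (P 0 / P 2)).natDegree := by
  set u := P 1 / P 2 with hu
  set v := P 0 / P 2 with hv
  set m := minpoly ℂ⟮u⟯ v with hm
  set r := m.natDegree with hr
  have h1 : ∀ i, ∃ rs : Polynomial ℂ × Polynomial ℂ, Polynomial.aeval u rs.2 ≠ 0 ∧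
      (m.coeff i : RatFunc ℂ) * Polynomial.aeval u rs.2 = Polynomial.aeval u rs.1 := by
    intro i
    obtain ⟨a, b, hab⟩ := (mem_adjoin_simple_iff ℂ _).1 (m.coeff i).2
    by_cases hb : Polynomial.aeval u b = 0
    · refine ⟨(0, 1), by simp, ?_⟩
      rw [hab, hb]
      simp
    · exact ⟨(a, b), hb, by rw [hab]; field_simp⟩
  choose rs hrs0 hrs using h1
  set s : Polynomial ℂ := ∏ i ∈ Finset.range (r + 1), (rs i).2 with hs
  set a : ℕ → Polynomial ℂ := fun i => (rs i).1 * ∏ j ∈ (Finset.range (r + 1)).erase i, (rs j).2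
    with ha
  have hs0 : Polynomial.aeval u s ≠ 0 := by
    rw [hs, map_prod]
    exact Finset.prod_ne_zero_iff.2 fun i _ => hrs0 i
  have has : ∀ i ∈ Finset.range (r + 1),
      Polynomial.aeval u (a i) = (m.coeff i : RatFunc ℂ) * Polynomial.aeval u s := by
    intro i hi
    rw [ha, hs, ← Finset.mul_prod_erase _ _ hi, map_mul, map_mul, ← hrs]
    ring
  set N := ∑ i ∈ Finset.range (r + 1), (a i).natDegree with hN
  have hNle : ∀ i ∈ Finset.range (r + 1), (a i).natDegree < N + 1 := fun i hi =>
    Nat.lt_succ_of_le (Finset.single_le_sum (f := fun i => (a i).natDegree) (fun _ _ => Nat.zero_le _) hi)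
  have hsum : ∀ i ∈ Finset.range (r + 1), ∀ x : RatFunc ℂ, Polynomial.aeval x (a i) =
      ∑ k ∈ Finset.range (N + 1), algebraMap ℂ (RatFunc ℂ) ((a i).coeff k) * x ^ k := by
    intro i hi x
    rw [Polynomial.aeval_eq_sum_range' (hNle i hi)]
    simp [Algebra.smul_def]
  set A : MvPolynomial (Fin 3) ℂ := ∑ i ∈ Finset.range (r + 1), ∑ k ∈ Finset.range (N + 1),
    X 0 ^ i * (C ((a i).coeff k) * X 1 ^ k * X 2 ^ (N + r - i - k)) with hA
  have hAP : ∀ (L : Type) [CommRing L] [Algebra ℂ L] (w : Fin 3 → L), aeval w A =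
      ∑ i ∈ Finset.range (r + 1), ∑ k ∈ Finset.range (N + 1),
        w 0 ^ i * (algebraMap ℂ L ((a i).coeff k) * w 1 ^ k * w 2 ^ (N + r - i - k)) := by
    intro L _ _ w
    simp [hA, map_sum]
  refine ⟨A, N + r, ?_, ?_, ?_, ?_⟩
  · refine IsHomogeneous.sum _ _ _ fun i hi => IsHomogeneous.sum _ _ _ fun k hk => ?_
    rw [Finset.mem_range] at hi hk
    have : N + r = i + (0 + k + (N + r - i - k)) := by omega
    rw [this]
    refine (isHomogeneous_X_pow _ _).mul ?_
    have h' : i + (0 + k + (N + r - i - k)) - i - k = N + r - i - k := by omega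
    rw [h']
    exact ((isHomogeneous_C _ _).mul (isHomogeneous_X_pow _ _)).mul (isHomogeneous_X_pow _ _)
  · intro h0
    have h2 := hAP (Polynomial (RatFunc ℂ)) ![Polynomial.X, Polynomial.C u, 1]
    rw [h0, map_zero] at h2
    have h3 : (0 : Polynomial (RatFunc ℂ)) = ∑ i ∈ Finset.range (r + 1),
        Polynomial.C (Polynomial.aeval u (a i)) * Polynomial.X ^ i := by
      rw [h2]
      refine Finset.sum_congr rfl fun i hi => ?_
      rw [hsum i hi, map_sum, Finset.sum_mul]
      refine Finset.sum_congr rfl fun k _ => ?_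
      simp only [Matrix.cons_val_zero, Matrix.cons_val_one, Matrix.cons_val, one_pow, mul_one,
        Polynomial.algebraMap_apply, map_mul, map_pow]
      ring
    have h4 := congrArg (fun f => Polynomial.coeff f r) h3
    simp only [Polynomial.coeff_zero, Polynomial.finsetSum_coeff, Polynomial.coeff_C_mul_X_pow] at h4
    rw [Finset.sum_ite_eq, if_pos (by simp), has r (by simp),
      show m.coeff r = 1 from (minpoly.monic halg).coeff_natDegree] at h4
    exact hs0 (by simpa using h4.symm)
  · rw [hAP]
    have h2 : Polynomial.aeval v m = 0 := minpoly.aeval _ _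
    rw [Polynomial.aeval_eq_sum_range] at h2
    have h3 : (∑ i ∈ Finset.range (r + 1), ∑ k ∈ Finset.range (N + 1),
        P 0 ^ i * (algebraMap ℂ _ ((a i).coeff k) * P 1 ^ k * P 2 ^ (N + r - i - k))) =
        P 2 ^ (N + r) * Polynomial.aeval u s * ∑ i ∈ Finset.range (r + 1), m.coeff i • v ^ i := by
      rw [Finset.mul_sum]
      refine Finset.sum_congr rfl fun i hi => ?_
      have h4 : P 2 ^ (N + r) * Polynomial.aeval u s * m.coeff i • v ^ i =
          P 2 ^ (N + r) * Polynomial.aeval u (a i) * v ^ i := by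
        rw [has i hi, Algebra.smul_def]
        change _ * _ * ((m.coeff i : RatFunc ℂ) * _) = _
        ring
      rw [h4, hsum i hi, Finset.mul_sum, Finset.sum_mul]
      refine Finset.sum_congr rfl fun k hk => ?_
      rw [Finset.mem_range] at hi hk
      have h5 : P 2 ^ (N + r) = P 2 ^ i * P 2 ^ k * P 2 ^ (N + r - i - k) := by
        rw [← pow_add, ← pow_add]
        congr 1
        omega
      rw [h5, hu, hv, div_pow, div_pow]
      field_simp
    rw [h3, h2, mul_zero]
  · refine (degreeOf_sum_le _ _ _).trans (Finset.sup_le fun i hi => ?_)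
    refine (degreeOf_sum_le _ _ _).trans (Finset.sup_le fun k hk => ?_)
    rw [Finset.mem_range] at hi
    refine (degreeOf_mul_le _ _ _).trans ?_
    have h2 : degreeOf 0 (C ((a i).coeff k) * X 1 ^ k * X 2 ^ (N + r - i - k) :
        MvPolynomial (Fin 3) ℂ) = 0 := by
      refine Nat.le_zero.1 ((degreeOf_mul_le _ _ _).trans ?_)
      have h3 := degreeOf_mul_le (0 : Fin 3) (C ((a i).coeff k)) (X 1 ^ k : MvPolynomial (Fin 3) ℂ)
      rw [degreeOf_C, degreeOf_X_pow_of_ne _ (by decide)] at h3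
      rw [degreeOf_X_pow_of_ne _ (by decide)]
      omega
    rw [h2]
    have := degreeOf_X_self_pow (R := ℂ) (0 : Fin 3) i
    omega

theorem aeval_polynomial_C {σ L : Type} [Field L] [Algebra ℂ L] (P : σ → L)
    (B : MvPolynomial σ ℂ) :
    aeval (fun i => Polynomial.C (P i)) B = Polynomial.C (aeval P B) := by
  induction B using MvPolynomial.induction_on with
  | C a => simp [Polynomial.algebraMap_apply]
  | add p q hp hq => simp only [map_add, hp, hq]
  | mul_X p i hp => simp only [map_mul, hp, aeval_X]

theorem eval₂_finSuccEquiv {S : Type} [CommRing S] [Algebra ℂ S]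
    (ψ : MvPolynomial (Fin 2) ℂ →ₐ[ℂ] S) (θ : S) (B : MvPolynomial (Fin 3) ℂ) :
    (finSuccEquiv ℂ 2 B).eval₂ (ψ : MvPolynomial (Fin 2) ℂ →+* S) θ =
      aeval (Fin.cons θ fun i => ψ (X i) : Fin 3 → S) B := by
  have hX : ∀ i : Fin 3, (finSuccEquiv ℂ 2 (X i)).eval₂ (ψ : MvPolynomial (Fin 2) ℂ →+* S) θ =
      (Fin.cons θ fun i => ψ (X i) : Fin 3 → S) i := by
    intro i
    refine Fin.cases ?_ (fun j => ?_) i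
    · rw [finSuccEquiv_X_zero, Polynomial.eval₂_X, Fin.cons_zero]
    · rw [finSuccEquiv_X_succ, Polynomial.eval₂_C, Fin.cons_succ]
      rfl
  induction B using MvPolynomial.induction_on with
  | C a =>
    have : ψ (C a) = algebraMap ℂ S a := ψ.commutes a
    simp [finSuccEquiv_apply, this]
  | add p q hp hq => rw [map_add, Polynomial.eval₂_add, hp, hq, map_add]
  | mul_X p i hp =>
    have h1 : finSuccEquiv ℂ 2 (p * X i) = finSuccEquiv ℂ 2 p * finSuccEquiv ℂ 2 (X i) :=
      map_mul _ _ _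
    rw [h1, Polynomial.eval₂_mul, hp, hX, map_mul, aeval_X]

/-- A relation at the generic multiple of `P` splits by powers of the scaling variable into one
relation at `P` for each degree. -/
theorem aeval_eq_zero_homogeneousComponent {σ L : Type} [Fintype σ] [Field L] [Algebra ℂ L]
    {P : σ → L} {B : MvPolynomial σ ℂ}
    (h : aeval (fun i => Polynomial.X * Polynomial.C (P i)) B = (0 : Polynomial L)) (k : ℕ) :
    aeval P (homogeneousComponent k B) = 0 := by
  have h1 : (aeval (fun i => Polynomial.X * Polynomial.C (P i)) B : Polynomial L) =
      ∑ i ∈ Finset.range (B.totalDegree + 1),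
        Polynomial.C (aeval P (homogeneousComponent i B)) * Polynomial.X ^ i := by
    conv_lhs => rw [← sum_homogeneousComponent B, map_sum]
    refine Finset.sum_congr rfl fun i _ => ?_
    rw [aeval_smul_of_isHomogeneous (homogeneousComponent_isHomogeneous i B), mul_comm]
    congr 1
    exact aeval_polynomial_C P _
  rw [h] at h1
  have h2 := congrArg (fun f => Polynomial.coeff f k) h1
  simp only [Polynomial.coeff_zero, Polynomial.finsetSum_coeff, Polynomial.coeff_C_mul_X_pow] at h2
  rw [Finset.sum_ite_eq] at h2
  split_ifs at h2 with hk
  · exact h2.symm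
  · rw [homogeneousComponent_eq_zero k B (by simpa using hk), map_zero]

/-- A nonzero component has degree at most that of `G`; being a multiple of `G`, it differs from `G`
by a constant. -/
theorem isHomogeneous_of_dvd_homogeneousComponent {σ : Type} [Fintype σ] {G : MvPolynomial σ ℂ}
    (hG : G ≠ 0) (h : ∀ k, G ∣ homogeneousComponent k G) : ∃ g, G.IsHomogeneous g := by
  obtain ⟨g, hg⟩ : ∃ g, homogeneousComponent g G ≠ 0 := by
    by_contra hne
    push Not at hne
    refine hG ?_
    rw [← sum_homogeneousComponent G]
    exact Finset.sum_eq_zero fun i _ => hne i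
  obtain ⟨Q, hQ⟩ := h g
  have hQ0 : Q ≠ 0 := by
    rintro rfl
    exact hg (by rw [hQ, mul_zero])
  have hd : (homogeneousComponent g G).totalDegree = g :=
    (homogeneousComponent_isHomogeneous g G).totalDegree hg
  have hle : g ≤ G.totalDegree := by
    by_contra hlt
    exact hg (homogeneousComponent_eq_zero g G (by omega))
  have hmul := totalDegree_mul_of_isDomain hG hQ0
  rw [← hQ, hd] at hmul
  obtain ⟨c, hc⟩ : ∃ c, Q = C c := ⟨_, totalDegree_eq_zero_iff_eq_C.1 (by omega)⟩
  have hc0 : c ≠ 0 := by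
    rintro rfl
    exact hQ0 (by rw [hc, map_zero])
  refine ⟨g, ?_⟩
  have : G = C c⁻¹ * homogeneousComponent g G := by
    rw [hQ, hc, mul_left_comm, ← C_mul, inv_mul_cancel₀ hc0, C_1, mul_one]
  rw [this]
  exact (homogeneousComponent_isHomogeneous g G).C_mul _

/-- A point of the plane over an extension field that is algebraic, but not rational, over the
coordinate ring of a line has a principal ideal of relations. -/
theorem exists_generator_of_relations {R E : Type} [CommRing R] [IsDomain R]
    [UniqueFactorizationMonoid R] [Field E] (ψ : R →+* E) (hψ : Function.Injective ψ) (θ : E)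
    (hθ : ∃ B : Polynomial R, B ≠ 0 ∧ B.eval₂ ψ θ = 0) :
    ∃ G : Polynomial R, G ≠ 0 ∧ G.eval₂ ψ θ = 0 ∧ ∀ B : Polynomial R, B.eval₂ ψ θ = 0 → G ∣ B := by
  obtain ⟨B₀, hB₀, hB₀θ⟩ := hθ
  set I : Ideal (Polynomial R) := RingHom.ker (Polynomial.eval₂RingHom ψ θ) with hI
  have hIne : I ≠ ⊥ := fun h => hB₀ (by
    have : B₀ ∈ I := hB₀θ
    rwa [h] at this)
  have : I.IsPrime := RingHom.ker_isPrime _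
  -- A nonzero prime ideal of a factorial ring contains a prime element. It turns out to generate
  -- the ideal, because no nonzero constant satisfies the relation.
  obtain ⟨G, hG, hGp⟩ := (UniqueFactorizationMonoid.iff_exists_prime_mem_of_isPrime.1
    (inferInstance : UniqueFactorizationMonoid (Polynomial R))) I hIne inferInstance
  have hGθ : G.eval₂ ψ θ = 0 := hG
  have hdeg : G.natDegree ≠ 0 := by
    intro h
    rw [Polynomial.eq_C_of_natDegree_eq_zero h, Polynomial.eval₂_C] at hGθ
    refine hGp.ne_zero ?_
    rw [Polynomial.eq_C_of_natDegree_eq_zero h, hψ (hGθ.trans (map_zero ψ).symm), map_zero]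
  have hprim := hGp.irreducible.isPrimitive hdeg
  let : Algebra (FractionRing R) E := (IsFractionRing.lift hψ).toAlgebra
  have hmap : ∀ B : Polynomial R, Polynomial.aeval θ (B.map (algebraMap R (FractionRing R))) =
      B.eval₂ ψ θ := by
    intro B
    rw [Polynomial.aeval_def, Polynomial.eval₂_map]
    congr 1
    ext r
    exact IsFractionRing.lift_algebraMap hψ r
  have hirr := (hprim.irreducible_iff_irreducible_map_fraction_map (K := FractionRing R)).1
    hGp.irreducible
  refine ⟨G, hGp.ne_zero, hGθ, fun B hB => ?_⟩
  let : NormalizedGCDMonoid R := Classical.choice inferInstance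
  -- Over the fraction field the irreducible `G` is associated to the minimal polynomial of `θ`;
  -- Gauss's lemma brings the divisibility back to `R`.
  refine hprim.dvd_of_fraction_map_dvd_fraction_map (K := FractionRing R) ?_
  have h1 : minpoly (FractionRing R) θ ∣ B.map (algebraMap R (FractionRing R)) :=
    minpoly.dvd _ _ (by rw [hmap, hB])
  have h2 : minpoly (FractionRing R) θ ∣ G.map (algebraMap R (FractionRing R)) :=
    minpoly.dvd _ _ (by rw [hmap, hGθ])
  exact ((hirr.dvd_iff.1 h2).resolve_left (minpoly.not_isUnit _ _)).dvd.trans h1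

open IntermediateField in
theorem isIntegral_adjoin_of_ne_C {u : RatFunc ℂ} (hu : ¬∃ c, u = RatFunc.C c) (v : RatFunc ℂ) :
    IsIntegral ℂ⟮u⟯ v := by
  have h := RatFunc.isAlgebraic_adjoin_simple_X' u hu
  exact (h.isAlgebraic v).isIntegral

/-- The point `P` is multiplied by a new variable, which makes its ideal of relations homogeneous.
This ideal is principal because `P 1` and `P 2` satisfy no homogeneous relation while `P 0` is
algebraic over them; all components of a generator are again relations, so the generator is a form.
-/
theorem exists_isFormGenerator {P : Fin 3 → RatFunc ℂ} (hP₂ : P 2 ≠ 0)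
    (hu : ¬∃ c, P 1 / P 2 = RatFunc.C c) : ∃ G g, IsFormGenerator P G g := by
  set E := FractionRing (Polynomial (RatFunc ℂ)) with hE
  set ι : Polynomial (RatFunc ℂ) →ₐ[ℂ] E := (IsScalarTower.toAlgHom ℂ (Polynomial (RatFunc ℂ)) E)
    with hι
  have hιinj : Function.Injective ι := IsFractionRing.injective (Polynomial (RatFunc ℂ)) E
  set lam : Fin 3 → Polynomial (RatFunc ℂ) := fun i => Polynomial.X * Polynomial.C (P i) with hlam
  set ψ : MvPolynomial (Fin 2) ℂ →ₐ[ℂ] E :=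
    aeval (fun i : Fin 2 => ι (lam i.succ)) with hψ
  have hψinj : Function.Injective ψ := by
    rw [injective_iff_map_eq_zero]
    intro c hc
    have h1 : (aeval (fun i : Fin 2 => Polynomial.X * Polynomial.C (P i.succ)) c :
        Polynomial (RatFunc ℂ)) = 0 := by
      apply hιinj
      rw [map_zero, ← hc, hψ, ← comp_aeval_apply]
    rw [← sum_homogeneousComponent c]
    refine Finset.sum_eq_zero fun k _ => ?_
    refine eq_zero_of_aeval_binary' hP₂ hu (homogeneousComponent_isHomogeneous k c) ?_
    have h2 := aeval_eq_zero_homogeneousComponent (P := fun i : Fin 2 => P i.succ) h1 k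
    have h3 : (fun i : Fin 2 => P i.succ) = ![P 1, P 2] := by
      ext i
      fin_cases i <;> rfl
    rwa [h3] at h2
  have hrel : ∀ B : MvPolynomial (Fin 3) ℂ,
      (finSuccEquiv ℂ 2 B).eval₂ (ψ : MvPolynomial (Fin 2) ℂ →+* E) (ι (lam 0)) =
        ι (aeval lam B) := by
    intro B
    rw [eval₂_finSuccEquiv]
    have h1 : (Fin.cons (ι (lam 0)) fun i => ψ (X i) : Fin 3 → E) = fun i => ι (lam i) := by
      ext i
      refine Fin.cases ?_ (fun j => ?_) i
      · rw [Fin.cons_zero]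
      · rw [Fin.cons_succ, hψ, aeval_X]
    rw [h1, ← comp_aeval_apply]
  obtain ⟨A, kA, hA, hA0, hAP, -⟩ := exists_form_of_minpoly hP₂ (isIntegral_adjoin_of_ne_C hu _)
  have hform : ∀ (A : MvPolynomial (Fin 3) ℂ) (k : ℕ), A.IsHomogeneous k → aeval P A = 0 →
      (aeval lam A) = 0 := by
    intro A k hA hAP
    rw [hlam, aeval_smul_of_isHomogeneous hA]
    rw [aeval_polynomial_C, hAP, map_zero, mul_zero]
  obtain ⟨G', hG'0, hG'θ, hG'⟩ := exists_generator_of_relations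
    (ψ : MvPolynomial (Fin 2) ℂ →+* E) hψinj (ι (lam 0))
    ⟨finSuccEquiv ℂ 2 A, by simpa using hA0, by rw [hrel, hform A kA hA hAP, map_zero]⟩
  set G := (finSuccEquiv ℂ 2).symm G' with hG
  have hGG' : finSuccEquiv ℂ 2 G = G' := by simp [hG]
  have hG0 : G ≠ 0 := by
    intro h
    rw [h, map_zero] at hGG'
    exact hG'0 hGG'.symm
  have hGlam : aeval lam G = 0 := by
    apply hιinj
    rw [map_zero, ← hrel, hGG', hG'θ]
  have hdvd : ∀ B : MvPolynomial (Fin 3) ℂ, aeval lam B = 0 → G ∣ B := by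
    intro B hB
    have h1 := hG' (finSuccEquiv ℂ 2 B) (by rw [hrel, hB, map_zero])
    rw [← hGG'] at h1
    exact (map_dvd_iff (finSuccEquiv ℂ 2)).1 h1
  have hcomp := aeval_eq_zero_homogeneousComponent hGlam
  obtain ⟨g, hg⟩ := isHomogeneous_of_dvd_homogeneousComponent hG0 fun k =>
    hdvd _ (hform _ k (homogeneousComponent_isHomogeneous k G) (hcomp k))
  refine ⟨G, g, hg, hG0, ?_, fun A k hA hAP => hdvd A (hform A k hA hAP)⟩
  have := hcomp g
  rwa [homogeneousComponent_eq_self hg] at this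

open IntermediateField in
-- `G` divides the form built from the minimal polynomial, which bounds its degree above.
-- Dehomogenised, it is a nonzero polynomial over `ℂ(P 1 / P 2)` with root `P 0 / P 2`, which bounds
-- it below.
theorem degreeOf_eq_natDegree_minpoly {P : Fin 3 → RatFunc ℂ} (hP₂ : P 2 ≠ 0)
    (hu : ¬∃ c, P 1 / P 2 = RatFunc.C c) {G : MvPolynomial (Fin 3) ℂ} {g : ℕ}
    (hG : IsFormGenerator P G g) :
    degreeOf 0 G = (minpoly ℂ⟮P 1 / P 2⟯ (P 0 / P 2)).natDegree := by
  set u := P 1 / P 2 with hudef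
  set v := P 0 / P 2 with hv
  refine le_antisymm ?_ ?_
  · obtain ⟨A, k, hA, hA0, hAP, hdeg⟩ :=
      exists_form_of_minpoly hP₂ (isIntegral_adjoin_of_ne_C hu (P 0 / P 2))
    refine le_trans ?_ hdeg
    obtain ⟨Q, rfl⟩ := hG.dvd A k hA hAP
    rw [degreeOf_mul_eq hG.ne_zero (right_ne_zero_of_mul hA0)]
    omega
  · set ub : ℂ⟮u⟯ := AdjoinSimple.gen ℂ u with hub
    set H : Polynomial ℂ⟮u⟯ := (finSuccEquiv ℂ 2 G).map
      ((aeval ![ub, 1] : MvPolynomial (Fin 2) ℂ →ₐ[ℂ] ℂ⟮u⟯) : MvPolynomial (Fin 2) ℂ →+* ℂ⟮u⟯)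
      with hH
    have hfin0 : finSuccEquiv ℂ 2 G ≠ 0 := by simpa using hG.ne_zero
    have hcoe : ∀ c : MvPolynomial (Fin 2) ℂ,
        ((aeval ![ub, 1] c : ℂ⟮u⟯) : RatFunc ℂ) = aeval ![u, 1] c := by
      intro c
      have : (ℂ⟮u⟯.val).comp (aeval ![ub, 1]) c = aeval ![u, 1] c := by
        rw [comp_aeval]
        congr 2
        ext i
        fin_cases i <;> simp [hub]
      exact this
    have hH0 : H ≠ 0 := by
      intro h0
      have h1 := congrArg (fun f => Polynomial.coeff f (finSuccEquiv ℂ 2 G).natDegree) h0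
      simp only [hH, Polynomial.coeff_map, Polynomial.coeff_zero] at h1
      have h2 : (aeval ![u, 1]) ((finSuccEquiv ℂ 2 G).coeff (finSuccEquiv ℂ 2 G).natDegree) =
          (0 : RatFunc ℂ) := by
        rw [← hcoe]
        exact congrArg Subtype.val h1
      have hle : (finSuccEquiv ℂ 2 G).natDegree ≤ g := by
        rw [natDegree_finSuccEquiv]
        exact degreeOf_le_of_isHomogeneous hG.isHomogeneous
      have h3 := eq_zero_of_aeval_binary hu
        (hG.isHomogeneous.finSuccEquiv_coeff_isHomogeneous _ (g - (finSuccEquiv ℂ 2 G).natDegree)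
          (by omega)) h2
      exact hfin0 (Polynomial.leadingCoeff_eq_zero.1 h3)
    have hroot : Polynomial.aeval v H = 0 := by
      have h1 : Polynomial.aeval v H = aeval ![v, u, 1] G := by
        rw [hH, Polynomial.aeval_def, Polynomial.eval₂_map]
        have h2 := eval₂_finSuccEquiv ((ℂ⟮u⟯.val).comp (aeval ![ub, 1])) v G
        have h3 : (Fin.cons v fun i => ((ℂ⟮u⟯.val).comp (aeval ![ub, 1])) (X i) : Fin 3 → RatFunc ℂ) =
            ![v, u, 1] := by
          ext i
          refine Fin.cases rfl (fun j => ?_) i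
          rw [Fin.cons_succ]
          fin_cases j <;> simp [hub]
        rw [h3] at h2
        exact h2
      rw [h1]
      have h2 := aeval_smul_of_isHomogeneous hG.isHomogeneous (P 2) ![v, u, 1]
      have h3 : (fun i => P 2 * ![v, u, 1] i) = P := by
        ext i
        fin_cases i <;> simp [hv, hudef] <;> field_simp
      rw [h3, hG.aeval_eq_zero] at h2
      exact (mul_eq_zero.1 h2.symm).resolve_left (pow_ne_zero _ hP₂)
    have h1 := Polynomial.natDegree_le_of_dvd (minpoly.dvd _ _ hroot) hH0
    refine h1.trans (Polynomial.natDegree_map_le.trans ?_)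
    rw [natDegree_finSuccEquiv]

/-! ### Degrees of a rational plane curve -/

/-- The field generated by the ratios of the linear forms in the coordinates of a point. -/
noncomputable def ratioField (P : Fin 3 → RatFunc ℂ) : IntermediateField ℂ (RatFunc ℂ) :=
  adjoin ℂ {x | ∃ a b : Fin 3 → ℂ, x = (∑ i, a i • P i) / (∑ i, b i • P i)}

theorem ratioField_le {P P' : Fin 3 → RatFunc ℂ} (c : Fin 3 → Fin 3 → ℂ)
    (h : ∀ i, P' i = ∑ j, c i j • P j) : ratioField P' ≤ ratioField P := by
  refine adjoin.mono _ _ _ ?_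
  rintro x ⟨a, b, rfl⟩
  have h1 : ∀ a : Fin 3 → ℂ, ∑ i, a i • P' i = ∑ j, (∑ i, a i * c i j) • P j := by
    intro a
    simp only [h, Finset.smul_sum, Finset.sum_smul, smul_smul]
    rw [Finset.sum_comm]
  exact ⟨_, _, by rw [h1 a, h1 b]⟩

theorem div_mem_ratioField {P : Fin 3 → RatFunc ℂ} (a b : Fin 3 → ℂ) :
    (∑ i, a i • P i) / (∑ i, b i • P i) ∈ ratioField P :=
  subset_adjoin _ _ ⟨a, b, rfl⟩

theorem div_mem_ratioField' {P : Fin 3 → RatFunc ℂ} (i j : Fin 3) : P i / P j ∈ ratioField P := by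
  have := div_mem_ratioField (P := P) (Pi.single i 1) (Pi.single j 1)
  simpa [Pi.single_apply, ite_smul] using this

theorem ratioField_smul {P : Fin 3 → RatFunc ℂ} {ρ : RatFunc ℂ} (hρ : ρ ≠ 0) :
    ratioField (fun i => ρ * P i) = ratioField P := by
  have h1 : ∀ a : Fin 3 → ℂ, ∑ i, a i • (ρ * P i) = ρ * ∑ i, a i • P i := by
    intro a
    rw [Finset.mul_sum]
    exact Finset.sum_congr rfl fun i _ => by rw [mul_smul_comm]
  simp only [ratioField, h1, mul_div_mul_left _ _ hρ]

theorem ratioField_eq {P : Fin 3 → RatFunc ℂ} (hP : P 2 ≠ 0) :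
    ratioField P = adjoin ℂ {P 1 / P 2, P 0 / P 2} := by
  refine le_antisymm ?_ ?_
  · refine adjoin_le_iff.2 ?_
    rintro x ⟨a, b, rfl⟩
    have h1 : P 1 / P 2 ∈ adjoin ℂ {P 1 / P 2, P 0 / P 2} := subset_adjoin _ _ (by simp)
    have h0 : P 0 / P 2 ∈ adjoin ℂ {P 1 / P 2, P 0 / P 2} := subset_adjoin _ _ (by simp)
    have h2 : ∀ a : Fin 3 → ℂ, (∑ i, a i • P i) / P 2 ∈ adjoin ℂ {P 1 / P 2, P 0 / P 2} := by
      intro a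
      have : (∑ i, a i • P i) / P 2 = a 0 • (P 0 / P 2) + a 1 • (P 1 / P 2) + a 2 • 1 := by
        rw [Fin.sum_univ_three]
        simp only [Algebra.smul_def]
        field_simp
      rw [this]
      exact add_mem (add_mem (IntermediateField.smul_mem _ h0) (IntermediateField.smul_mem _ h1))
        (IntermediateField.smul_mem _ (one_mem _))
    have h3 := div_mem (h2 a) (h2 b)
    rwa [div_div_div_cancel_right₀ hP] at h3
  · refine adjoin_le_iff.2 ?_
    rintro x (rfl | rfl) <;> exact div_mem_ratioField' _ _

/-- Multiplicativity of degrees in the tower from `ℂ(P 1 / P 2)` through the field of all ratios to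
`ℂ(t)`. -/
theorem degreeOf_mul_finrank {P : Fin 3 → RatFunc ℂ} (hP₂ : P 2 ≠ 0)
    (hu : ¬∃ c, P 1 / P 2 = RatFunc.C c) {G : MvPolynomial (Fin 3) ℂ} {g : ℕ}
    (hG : IsFormGenerator P G g) :
    degreeOf 0 G * finrank (ratioField P) (RatFunc ℂ) = finrank ℂ⟮P 1 / P 2⟯ (RatFunc ℂ) := by
  have hint := isIntegral_adjoin_of_ne_C hu (P 0 / P 2)
  rw [degreeOf_eq_natDegree_minpoly hP₂ hu hG, ← adjoin.finrank hint, ratioField_eq hP₂,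
    ← adjoin_simple_adjoin_simple]
  exact finrank_mul_finrank ℂ⟮P 1 / P 2⟯ ℂ⟮P 1 / P 2⟯⟮P 0 / P 2⟯ (RatFunc ℂ)

theorem finrank_adjoin_div {r₁ r₂ : Polynomial ℂ} (hr : IsCoprime r₁ r₂) (h₂ : r₂ ≠ 0) :
    finrank ℂ⟮algebraMap (Polynomial ℂ) (RatFunc ℂ) r₁ / algebraMap (Polynomial ℂ) (RatFunc ℂ) r₂⟯
      (RatFunc ℂ) = max r₁.natDegree r₂.natDegree := by
  rw [RatFunc.finrank_eq_max_natDegree]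
  set x := algebraMap (Polynomial ℂ) (RatFunc ℂ) r₁ / algebraMap (Polynomial ℂ) (RatFunc ℂ) r₂
    with hx
  have hinj := IsFractionRing.injective (Polynomial ℂ) (RatFunc ℂ)
  have h2' : algebraMap (Polynomial ℂ) (RatFunc ℂ) r₂ ≠ 0 := by
    rwa [Ne, map_eq_zero_iff _ hinj]
  have hd' : algebraMap (Polynomial ℂ) (RatFunc ℂ) x.denom ≠ 0 := by
    rw [Ne, map_eq_zero_iff _ hinj]
    exact x.denom_ne_zero
  have key : r₁ * x.denom = x.num * r₂ := by
    apply hinj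
    rw [map_mul, map_mul]
    have := (RatFunc.num_div_denom x).trans hx
    rw [div_eq_div_iff hd' h2'] at this
    rw [this, mul_comm]
  have hnum : Associated x.num r₁ := by
    refine associated_of_dvd_dvd ?_ ?_
    · exact (RatFunc.isCoprime_num_denom x).dvd_of_dvd_mul_right ⟨r₂, key⟩
    · exact hr.dvd_of_dvd_mul_right ⟨x.denom, key.symm⟩
  have hden : Associated x.denom r₂ := by
    refine associated_of_dvd_dvd (RatFunc.denom_div_dvd r₁ r₂) ?_
    exact hr.symm.dvd_of_dvd_mul_left ⟨x.num, by rw [key, mul_comm]⟩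
  rw [Polynomial.natDegree_eq_of_degree_eq (Polynomial.degree_eq_degree_of_associated hnum),
    Polynomial.natDegree_eq_of_degree_eq (Polynomial.degree_eq_degree_of_associated hden)]

/-- The vector of coefficients of degree `D` plays the role of the point of the curve at the
parameter `∞`. -/
theorem coeff_aeval_eq_eval {G : MvPolynomial (Fin 3) ℂ} {g D : ℕ} (hG : G.IsHomogeneous g)
    (p : Fin 3 → Polynomial ℂ) (hD : ∀ i, (p i).natDegree ≤ D) :
    (aeval p G).coeff (g * D) = eval (fun i => (p i).coeff D) G := by
  have hp : p = ![p 0, p 1, p 2] := by ext i : 1; fin_cases i <;> rfl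
  have hc : (fun i => (p i).coeff D) = ![(p 0).coeff D, (p 1).coeff D, (p 2).coeff D] := by
    ext i; fin_cases i <;> rfl
  rw [hc, ← aeval_eq_eval, hp, aeval_fin_three, aeval_fin_three, Polynomial.finsetSum_coeff]
  refine Finset.sum_congr rfl fun m hm => ?_
  have hpow : ∀ i (k : ℕ), (p i ^ k).natDegree ≤ k * D := fun i k =>
    Polynomial.natDegree_pow_le.trans (Nat.mul_le_mul_left k (hD i))
  have hgd : g * D = m 0 * D + m 1 * D + m 2 * D := by
    rw [← sum_eq_of_isHomogeneous hG hm]; ring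
  rw [hgd]
  simp only [Matrix.cons_val_zero, Matrix.cons_val_one, Matrix.cons_val]
  have h0 : (algebraMap ℂ (Polynomial ℂ) (coeff m G) * p 0 ^ m 0).natDegree ≤ m 0 * D :=
    (Polynomial.natDegree_C_mul_le _ _).trans (hpow 0 _)
  have h01 := Polynomial.natDegree_mul_le_of_le h0 (hpow 1 (m 1))
  rw [Polynomial.coeff_mul_add_eq_of_natDegree_le h01 (hpow 2 _),
    Polynomial.coeff_mul_add_eq_of_natDegree_le h0 (hpow 1 _),
    Polynomial.coeff_pow_of_natDegree_le (hD 2), Polynomial.coeff_pow_of_natDegree_le (hD 1)]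
  congr 2
  exact (Polynomial.coeff_C_mul _).trans (by rw [Polynomial.coeff_pow_of_natDegree_le (hD 0)]; rfl)

/-- The polynomial coordinates of a point, as rational functions. -/
noncomputable def toRat (p : Fin 3 → Polynomial ℂ) : Fin 3 → RatFunc ℂ :=
  fun i => algebraMap (Polynomial ℂ) (RatFunc ℂ) (p i)

theorem aeval_toRat (p : Fin 3 → Polynomial ℂ) (A : MvPolynomial (Fin 3) ℂ) :
    aeval (toRat p) A = algebraMap (Polynomial ℂ) (RatFunc ℂ) (aeval p A) := by
  have := comp_aeval_apply (f := p) (IsScalarTower.toAlgHom ℂ (Polynomial ℂ) (RatFunc ℂ)) A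
  exact this.symm

theorem eval_aeval_poly {σ : Type} (p : σ → Polynomial ℂ) (A : MvPolynomial σ ℂ) (t : ℂ) :
    (aeval p A).eval t = eval (fun i => (p i).eval t) A := by
  induction A using MvPolynomial.induction_on with
  | C a => simp
  | add p q hp hq => simp only [map_add, Polynomial.eval_add, hp, hq]
  | mul_X p i hp => simp only [map_mul, Polynomial.eval_mul, hp, aeval_X, eval_X]

theorem div_ne_C_of_linearIndependent {p₁ p₂ : Polynomial ℂ}
    (h : ∀ a b : ℂ, Polynomial.C a * p₁ + Polynomial.C b * p₂ = 0 → a = 0 ∧ b = 0) :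
    ¬∃ c, algebraMap (Polynomial ℂ) (RatFunc ℂ) p₁ / algebraMap (Polynomial ℂ) (RatFunc ℂ) p₂ =
      RatFunc.C c := by
  have hinj := IsFractionRing.injective (Polynomial ℂ) (RatFunc ℂ)
  have h2 : p₂ ≠ 0 := by
    rintro rfl
    exact one_ne_zero (h 0 1 (by simp)).2
  rintro ⟨c, hc⟩
  rw [div_eq_iff (by rwa [Ne, map_eq_zero_iff _ hinj]), ← RatFunc.algebraMap_C, ← map_mul] at hc
  have := hinj hc
  exact one_ne_zero (h 1 (-c) (by rw [this]; simp)).1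

/-- The partial degree of the form of a rational curve. -/
theorem degreeOf_mul_finrank_eq {p : Fin 3 → Polynomial ℂ} {G : MvPolynomial (Fin 3) ℂ} {g : ℕ}
    (hG : IsFormGenerator (toRat p) G g)
    (hlin : ∀ a b : ℂ, Polynomial.C a * p 1 + Polynomial.C b * p 2 = 0 → a = 0 ∧ b = 0)
    {h r₁ r₂ : Polynomial ℂ} (hr : IsCoprime r₁ r₂) (h₁ : p 1 = h * r₁) (h₂ : p 2 = h * r₂) :
    degreeOf 0 G * finrank (ratioField (toRat p)) (RatFunc ℂ) = max r₁.natDegree r₂.natDegree := by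
  have hinj := IsFractionRing.injective (Polynomial ℂ) (RatFunc ℂ)
  have hp2 : p 2 ≠ 0 := by
    intro h0
    exact one_ne_zero (hlin 0 1 (by simp [h0])).2
  have hh : algebraMap (Polynomial ℂ) (RatFunc ℂ) h ≠ 0 := by
    rw [Ne, map_eq_zero_iff _ hinj]
    rintro rfl
    exact hp2 (by rw [h₂, zero_mul])
  rw [degreeOf_mul_finrank (by rwa [toRat, Ne, map_eq_zero_iff _ hinj])
    (div_ne_C_of_linearIndependent hlin) hG]
  have : toRat p 1 / toRat p 2 = algebraMap (Polynomial ℂ) (RatFunc ℂ) r₁ /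
      algebraMap (Polynomial ℂ) (RatFunc ℂ) r₂ := by
    simp only [toRat, h₁, h₂, map_mul]
    rw [mul_div_mul_left _ _ hh]
  rw [this, finrank_adjoin_div hr]
  rintro rfl
  exact hp2 (by rw [h₂, mul_zero])

/-- The degree of the form of a rational curve. -/
theorem degree_mul_finrank_eq {p : Fin 3 → Polynomial ℂ} {G : MvPolynomial (Fin 3) ℂ} {g : ℕ}
    (hG : IsFormGenerator (toRat p) G g)
    (hlin : ∀ c : Fin 3 → ℂ, ∑ i, Polynomial.C (c i) * p i = 0 → c = 0)
    (hroot : ∀ t : ℂ, ∃ i, (p i).eval t ≠ 0) {D : ℕ} (hD : ∀ i, (p i).natDegree ≤ D)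
    (hD' : ∃ i, (p i).coeff D ≠ 0) :
    g * finrank (ratioField (toRat p)) (RatFunc ℂ) = D := by
  obtain ⟨v, hv⟩ := exists_eval_ne_zero_of_ne_zero (mul_ne_zero hG.ne_zero (X_ne_zero (R := ℂ) 0))
  rw [map_mul, eval_X, mul_ne_zero_iff] at hv
  obtain ⟨hvG, hv0⟩ := hv
  -- The point `(1 : a : b)` does not lie on the curve. Projection from it has the full degree of
  -- the curve, so a shear moving it to `(1 : 0 : 0)` turns the degree of the form into its degree
  -- in the first variable.
  set a := v 1 / v 0 with ha
  set b := v 2 / v 0 with hb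
  have hab : eval ![1, a, b] G ≠ 0 := by
    intro h0
    have h1 := aeval_smul_of_isHomogeneous hG.isHomogeneous (v 0) ![1, a, b]
    have h2 : (fun i => v 0 * ![1, a, b] i) = v := by
      ext i
      fin_cases i <;> simp [ha, hb] <;> field_simp
    rw [h2, aeval_eq_eval, aeval_eq_eval, h0, mul_zero] at h1
    exact hvG h1
  have heval : ∀ s : ℂ, s ≠ 0 → eval ![s, a * s, b * s] G ≠ 0 := by
    intro s hs h0
    have h1 := aeval_smul_of_isHomogeneous hG.isHomogeneous s ![1, a, b]
    have h2 : (fun i => s * ![1, a, b] i) = ![s, a * s, b * s] := by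
      ext i
      fin_cases i <;> simp [mul_comm s]
    rw [h2, aeval_eq_eval, aeval_eq_eval, h0] at h1
    exact mul_ne_zero (pow_ne_zero g hs) hab h1.symm
  set p' : Fin 3 → Polynomial ℂ :=
    ![p 0, p 1 - Polynomial.C a * p 0, p 2 - Polynomial.C b * p 0] with hp'
  set G' : MvPolynomial (Fin 3) ℂ := aeval ![X 0, X 1 + C a * X 0, X 2 + C b * X 0] G with hG'
  have hshear : ∀ (L : Type) [CommRing L] [Algebra ℂ L] (w : Fin 3 → L)
      (A : MvPolynomial (Fin 3) ℂ) (c d : ℂ),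
      aeval w (aeval ![X 0, X 1 + C c * X 0, X 2 + C d * X 0] A : MvPolynomial (Fin 3) ℂ) =
      aeval ![w 0, w 1 + algebraMap ℂ L c * w 0, w 2 + algebraMap ℂ L d * w 0] A := by
    intro L _ _ w A c d
    change (aeval w).comp (aeval _) A = _
    rw [comp_aeval]
    congr 2
    ext i
    fin_cases i <;> simp
  have hhom : ∀ (A : MvPolynomial (Fin 3) ℂ) (k : ℕ) (c d : ℂ), A.IsHomogeneous k →
      (aeval ![X 0, X 1 + C c * X 0, X 2 + C d * X 0] A : MvPolynomial (Fin 3) ℂ).IsHomogeneous k := by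
    intro A k c d hA
    have := hA.aeval (n := 1)
      (![X 0, X 1 + C c * X 0, X 2 + C d * X 0] : Fin 3 → MvPolynomial (Fin 3) ℂ) (fun i => by
      fin_cases i
      · exact isHomogeneous_X _ _
      · exact (isHomogeneous_X _ _).add (isHomogeneous_C_mul_X _ _)
      · exact (isHomogeneous_X _ _).add (isHomogeneous_C_mul_X _ _))
    simpa using this
  have hinv : ∀ (A : MvPolynomial (Fin 3) ℂ) (c d : ℂ),
      aeval ![X 0, X 1 + C c * X 0, X 2 + C d * X 0]
        (aeval ![X 0, X 1 + C (-c) * X 0, X 2 + C (-d) * X 0] A : MvPolynomial (Fin 3) ℂ) = A := by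
    intro A c d
    rw [hshear]
    conv_rhs => rw [← aeval_X_left_apply A]
    congr 2
    ext i : 1
    fin_cases i <;> simp [MvPolynomial.algebraMap_eq]
  have hP'P : ![toRat p' 0, toRat p' 1 + algebraMap ℂ _ a * toRat p' 0,
      toRat p' 2 + algebraMap ℂ _ b * toRat p' 0] = toRat p := by
    ext i
    fin_cases i <;> simp [toRat, hp', ← RatFunc.algebraMap_C]
  have hPP' : ![toRat p 0, toRat p 1 + algebraMap ℂ _ (-a) * toRat p 0,
      toRat p 2 + algebraMap ℂ _ (-b) * toRat p 0] = toRat p' := by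
    ext i
    fin_cases i <;> simp [toRat, hp', ← RatFunc.algebraMap_C, sub_eq_add_neg]
  have hgen : IsFormGenerator (toRat p') G' g := by
    refine ⟨hhom G g a b hG.isHomogeneous, ?_, ?_, ?_⟩
    · intro h0
      have h1 := hinv G (-a) (-b)
      rw [neg_neg, neg_neg, ← hG', h0, map_zero] at h1
      exact hG.ne_zero h1.symm
    · rw [hG', hshear, hP'P, hG.aeval_eq_zero]
    · intro A k hA hAP
      have h1 := hG.dvd _ k (hhom A k (-a) (-b) hA) (by rw [hshear, hPP', hAP])
      have h2 := map_dvd (aeval ![X 0, X 1 + C a * X 0, X 2 + C b * X 0] :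
        MvPolynomial (Fin 3) ℂ →ₐ[ℂ] MvPolynomial (Fin 3) ℂ) h1
      rwa [hinv] at h2
  have hdeg : degreeOf 0 G' = g := by
    refine le_antisymm (degreeOf_le_of_isHomogeneous hgen.isHomogeneous) ?_
    have h1 : aeval ![Polynomial.X, 0, 0] G' =
        Polynomial.C (eval ![1, a, b] G) * Polynomial.X ^ g := by
      rw [hG', hshear]
      have h2 := aeval_smul_of_isHomogeneous hG.isHomogeneous (Polynomial.X : Polynomial ℂ)
        (fun i => Polynomial.C (![1, a, b] i))
      rw [aeval_polynomial_C, aeval_eq_eval, mul_comm] at h2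
      rw [← h2]
      congr 2
      ext i : 1
      fin_cases i <;> simp
    have h2 := congrArg Polynomial.natDegree h1
    rw [Polynomial.natDegree_C_mul_X_pow _ _ hab, aeval_fin_three] at h2
    rw [← h2]
    refine Polynomial.natDegree_sum_le_of_forall_le _ _ fun m hm => ?_
    by_cases h12 : m 1 = 0 ∧ m 2 = 0
    · rw [h12.1, h12.2, pow_zero, mul_one, mul_one]
      exact (Polynomial.natDegree_C_mul_X_pow_le _ _).trans (le_degreeOf_of_mem hm)
    · rw [not_and_or] at h12
      rcases h12 with h | h <;> rw [zero_pow h] <;> simp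
  have hfield : ratioField (toRat p') = ratioField (toRat p) := by
    refine le_antisymm (ratioField_le ![![1, 0, 0], ![-a, 1, 0], ![-b, 0, 1]] fun i => ?_)
      (ratioField_le ![![1, 0, 0], ![a, 1, 0], ![b, 0, 1]] fun i => ?_)
    · rw [← hPP', Fin.sum_univ_three]
      fin_cases i <;> simp [Algebra.smul_def] <;> ring
    · rw [← hP'P, Fin.sum_univ_three]
      fin_cases i <;> simp [Algebra.smul_def] <;> ring
  have hpG : ∀ t, eval (fun i => (p i).eval t) G = 0 := by
    intro t
    have := hG.aeval_eq_zero
    rw [aeval_toRat, map_eq_zero_iff _ (IsFractionRing.injective (Polynomial ℂ) (RatFunc ℂ))] at this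
    rw [← eval_aeval_poly, this, Polynomial.eval_zero]
  -- At a common zero the point of the curve would be the centre of projection, which is off the
  -- curve, or the zero vector, excluded by `hroot`.
  have hcop : IsCoprime (p' 1) (p' 2) := by
    rw [Polynomial.isCoprime_iff_aeval_ne_zero_of_isAlgClosed ℂ ℂ]
    intro t
    by_contra hne
    rw [not_or, not_not, not_not] at hne
    simp only [hp', Matrix.cons_val_one, Matrix.cons_val, Polynomial.coe_aeval_eq_eval,
      Polynomial.eval_sub, Polynomial.eval_mul, Polynomial.eval_C, sub_eq_zero] at hne
    have h1 : (fun i => (p i).eval t) = ![(p 0).eval t, a * (p 0).eval t, b * (p 0).eval t] := by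
      ext i
      fin_cases i <;> simp [hne.1, hne.2]
    have h2 := hpG t
    rw [h1] at h2
    by_cases h0 : (p 0).eval t = 0
    · obtain ⟨i, hi⟩ := hroot t
      apply hi
      have := congrFun h1 i
      simp only [this, h0]
      fin_cases i <;> simp
    · exact heval _ h0 h2
  have hDcoeff : eval (fun i => (p i).coeff D) G = 0 := by
    rw [← coeff_aeval_eq_eval hG.isHomogeneous p hD]
    have := hG.aeval_eq_zero
    rw [aeval_toRat, map_eq_zero_iff _ (IsFractionRing.injective (Polynomial ℂ) (RatFunc ℂ))] at this
    rw [this, Polynomial.coeff_zero]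
  -- The same argument at the parameter `∞`, with the coefficients of degree `D` instead of values.
  have hmax : max (p' 1).natDegree (p' 2).natDegree = D := by
    have h1 : ∀ i : Fin 3, ∀ c : ℂ, (p i - Polynomial.C c * p 0).natDegree ≤ D := fun i c =>
      (Polynomial.natDegree_sub_le _ _).trans
        (max_le (hD i) ((Polynomial.natDegree_C_mul_le _ _).trans (hD 0)))
    refine le_antisymm (max_le (h1 1 a) (h1 2 b)) ?_
    by_contra hlt
    rw [not_le, max_lt_iff] at hlt
    have hc1 := Polynomial.coeff_eq_zero_of_natDegree_lt hlt.1
    have hc2 := Polynomial.coeff_eq_zero_of_natDegree_lt hlt.2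
    simp only [hp', Matrix.cons_val_one, Matrix.cons_val, Polynomial.coeff_sub,
      Polynomial.coeff_C_mul, sub_eq_zero] at hc1 hc2
    have h2 : (fun i => (p i).coeff D) =
        ![(p 0).coeff D, a * (p 0).coeff D, b * (p 0).coeff D] := by
      ext i
      fin_cases i <;> simp [hc1, hc2]
    rw [h2] at hDcoeff
    by_cases h0 : (p 0).coeff D = 0
    · obtain ⟨i, hi⟩ := hD'
      apply hi
      have := congrFun h2 i
      simp only [this, h0]
      fin_cases i <;> simp
    · exact heval _ h0 hDcoeff
  have hlin' : ∀ c d : ℂ, Polynomial.C c * p' 1 + Polynomial.C d * p' 2 = 0 → c = 0 ∧ d = 0 := by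
    intro c d hcd
    have := hlin ![-(c * a) - d * b, c, d] (by
      rw [Fin.sum_univ_three, ← hcd]
      simp [hp']
      ring)
    exact ⟨congrFun this 1, congrFun this 2⟩
  have := degreeOf_mul_finrank_eq hgen hlin' hcop (h := 1) (by rw [one_mul]) (by rw [one_mul])
  rw [← hfield, ← hmax, ← this, hdeg]

/-! ### Rational parametrisation of the cyclic-harmonic curves -/

/-- `2 t ^ n r(t)`, where `r = cos (n φ / d) + a` and `t = exp (i φ / d)`. -/
noncomputable def chRadius (n : ℕ) (a : ℝ) : Polynomial ℂ :=
  Polynomial.X ^ (2 * n) + Polynomial.C (2 * a : ℂ) * Polynomial.X ^ n + 1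

/-- `t ^ (n + d) x(t)` on the cyclic-harmonic curve. -/
noncomputable def chX (n d : ℕ) (a : ℝ) : Polynomial ℂ :=
  Polynomial.C (1 / 4) * (Polynomial.X ^ (2 * d) + 1) * chRadius n a

/-- `t ^ (n + d) y(t)` on the cyclic-harmonic curve. -/
noncomputable def chY (n d : ℕ) (a : ℝ) : Polynomial ℂ :=
  Polynomial.C (-Complex.I / 4) * (Polynomial.X ^ (2 * d) - 1) * chRadius n a

/-- The point with parameter `t` of the complexified cyclic-harmonic curve. -/
noncomputable def chPoint (n d : ℕ) (a : ℝ) (t : ℂ) : Fin 2 → ℂ :=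
  ![(chX n d a).eval t / t ^ (n + d), (chY n d a).eval t / t ^ (n + d)]

section Curve

variable {n d : ℕ} {a : ℝ}

theorem chX_add_chY : chX n d a + Polynomial.C Complex.I * chY n d a =
    Polynomial.C (1 / 2) * Polynomial.X ^ (2 * d) * chRadius n a := by
  refine Polynomial.funext fun t => ?_
  simp only [chX, chY, Polynomial.eval_add, Polynomial.eval_mul, Polynomial.eval_sub,
    Polynomial.eval_pow, Polynomial.eval_X, Polynomial.eval_C, Polynomial.eval_one]
  linear_combination (-(t ^ (2 * d) - 1) * (chRadius n a).eval t / 4) * Complex.I_sq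

theorem chX_sub_chY : chX n d a - Polynomial.C Complex.I * chY n d a =
    Polynomial.C (1 / 2) * chRadius n a := by
  refine Polynomial.funext fun t => ?_
  simp only [chX, chY, Polynomial.eval_add, Polynomial.eval_mul, Polynomial.eval_sub,
    Polynomial.eval_pow, Polynomial.eval_X, Polynomial.eval_C, Polynomial.eval_one]
  linear_combination ((t ^ (2 * d) - 1) * (chRadius n a).eval t / 4) * Complex.I_sq

theorem chPoint_exp (hd : 0 < d) (φ : ℝ) :
    chPoint n d a (Complex.exp (φ / d * Complex.I)) =
      complexify !₂[(Real.cos ((n : ℝ) / d * φ) + a) * Real.cos φ,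
        (Real.cos ((n : ℝ) / d * φ) + a) * Real.sin φ] := by
  set t := Complex.exp (φ / d * Complex.I) with ht
  have ht0 : t ≠ 0 := Complex.exp_ne_zero _
  have hd' : (d : ℂ) ≠ 0 := by exact_mod_cast hd.ne'
  have htd : t ^ d = Complex.exp (φ * Complex.I) := by
    rw [ht, ← Complex.exp_nat_mul]
    congr 1
    field_simp
  have htn : t ^ n = Complex.exp ((n / d * φ : ℂ) * Complex.I) := by
    rw [ht, ← Complex.exp_nat_mul]
    congr 1
    field_simp
  have h1 : Complex.cos φ = (t ^ d + (t ^ d)⁻¹) / 2 := by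
    rw [Complex.cos, htd, ← Complex.exp_neg, neg_mul]
  have h2 : Complex.sin φ = ((t ^ d)⁻¹ - t ^ d) * Complex.I / 2 := by
    rw [Complex.sin, htd, ← Complex.exp_neg, neg_mul]
  have h3 : Complex.cos (n / d * φ) = (t ^ n + (t ^ n)⁻¹) / 2 := by
    rw [Complex.cos, htn, ← Complex.exp_neg, neg_mul]
  have hdn : t ^ d ≠ 0 := pow_ne_zero _ ht0
  have hnn : t ^ n ≠ 0 := pow_ne_zero _ ht0
  ext i
  fin_cases i
  · simp [chPoint, complexify, chX, chRadius, h1, h3, pow_add, pow_mul']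
    field_simp
    ring
  · simp [chPoint, complexify, chY, chRadius, h2, h3, pow_add, pow_mul']
    field_simp
    ring

theorem mem_CH_iff (hd : 0 < d) (Q : E2) :
    Q ∈ CH n d a ↔ ∃ t : ℂ, ‖t‖ = 1 ∧ complexify Q = chPoint n d a t := by
  constructor
  · rintro ⟨φ, -, rfl⟩
    refine ⟨_, ?_, (chPoint_exp hd φ).symm⟩
    have : ((φ : ℂ) / d * Complex.I) = ((φ / d : ℝ) : ℂ) * Complex.I := by push_cast; rfl
    rw [this, Complex.norm_exp_ofReal_mul_I]
  · rintro ⟨t, ht, hQ⟩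
    obtain ⟨ψ, hψ, hψt⟩ : ∃ ψ ∈ Set.Icc (0 : ℝ) (2 * Real.pi), t = Complex.exp (ψ * Complex.I) := by
      have h1 : t = Complex.exp (Complex.arg t * Complex.I) := by
        have := Complex.norm_mul_exp_arg_mul_I t
        rw [ht] at this
        simpa using this.symm
      have h2 := Complex.neg_pi_lt_arg t
      have h3 := Complex.arg_le_pi t
      rcases le_or_gt 0 (Complex.arg t) with h | h
      · exact ⟨_, ⟨h, by linarith⟩, h1⟩
      · refine ⟨Complex.arg t + 2 * Real.pi, ⟨by linarith, by linarith⟩, ?_⟩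
        push_cast
        rw [add_mul, Complex.exp_add, Complex.exp_two_pi_mul_I, mul_one]
        exact h1
    have hd' : (0 : ℝ) < d := by exact_mod_cast hd
    refine ⟨d * ψ, ⟨mul_nonneg hd'.le hψ.1, ?_⟩, ?_⟩
    · have := mul_le_mul_of_nonneg_left hψ.2 hd'.le
      linarith
    · have h1 := chPoint_exp (n := n) (a := a) hd (d * ψ)
      have h2 : ((((d : ℝ) * ψ : ℝ) : ℂ) / d * Complex.I) = ψ * Complex.I := by
        have hdc : (d : ℂ) ≠ 0 := by exact_mod_cast hd.ne'
        push_cast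
        field_simp
      rw [h2, ← hψt, ← hQ] at h1
      ext i
      have := congrFun h1 i
      simp only [complexify] at this
      exact_mod_cast this

theorem infinite_unit_circle : {t : ℂ | ‖t‖ = 1}.Infinite := by
  have : {t : ℂ | ‖t‖ = 1} = Metric.sphere (0 : ℂ) 1 := by ext t; simp
  rw [this]
  have hinj : Set.InjOn (fun θ : ℝ => Complex.exp (θ * Complex.I)) (Set.Ioc (-Real.pi) Real.pi) := by
    intro x hx y hy hxy
    have h1 := congrArg Complex.arg hxy
    simp only at h1
    rwa [Complex.arg_exp_mul_I, Complex.arg_exp_mul_I,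
      (toIocMod_eq_self _).2 (by rwa [show -Real.pi + 2 * Real.pi = Real.pi by ring]),
      (toIocMod_eq_self _).2 (by rwa [show -Real.pi + 2 * Real.pi = Real.pi by ring])] at h1
  refine Set.infinite_of_injOn_mapsTo hinj (fun θ _ => by simp) (Set.Ioc_infinite (by linarith [Real.pi_pos]))

theorem chRadius_ne_zero (hn : 0 < n) : chRadius n a ≠ 0 := by
  intro h
  have := congrArg (Polynomial.eval 0) h
  simp [chRadius, hn.ne'] at this

/-- The functions `1, x, y, x ^ 2 + y ^ 2` are linearly independent on the curve. -/
theorem linearIndependent_circles (hn : 0 < n) (hd : 0 < d) (hne : n ≠ d) {α β γ δ : ℂ}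
    (h : Polynomial.C α * (chX n d a ^ 2 + chY n d a ^ 2) +
      Polynomial.C β * chX n d a * Polynomial.X ^ (n + d) +
      Polynomial.C γ * chY n d a * Polynomial.X ^ (n + d) +
      Polynomial.C δ * Polynomial.X ^ (2 * (n + d)) = 0) : α = 0 ∧ β = 0 ∧ γ = 0 ∧ δ = 0 := by
  -- On the curve `β X + γ Y` is `(β' t^(2d) + γ')` times the radius polynomial.
  set β' := (β - Complex.I * γ) / 4 with hβ'
  set γ' := (β + Complex.I * γ) / 4 with hγ'
  have key : Polynomial.C (α / 4) * Polynomial.X ^ (2 * d + 4 * n) +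
      Polynomial.C (α * a) * Polynomial.X ^ (2 * d + 3 * n) +
      Polynomial.C (α / 4 * (2 + 4 * a ^ 2)) * Polynomial.X ^ (2 * d + 2 * n) +
      Polynomial.C (α * a) * Polynomial.X ^ (2 * d + n) +
      Polynomial.C (α / 4) * Polynomial.X ^ (2 * d) +
      Polynomial.C β' * Polynomial.X ^ (3 * d + 3 * n) +
      Polynomial.C (β' * (2 * a)) * Polynomial.X ^ (3 * d + 2 * n) +
      Polynomial.C β' * Polynomial.X ^ (3 * d + n) +
      Polynomial.C γ' * Polynomial.X ^ (d + 3 * n) +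
      Polynomial.C (γ' * (2 * a)) * Polynomial.X ^ (d + 2 * n) +
      Polynomial.C γ' * Polynomial.X ^ (d + n) +
      Polynomial.C δ * Polynomial.X ^ (2 * d + 2 * n) = (0 : Polynomial ℂ) := by
    rw [← h]
    refine Polynomial.funext fun t => ?_
    simp only [chX, chY, chRadius, hβ', hγ', Polynomial.eval_add, Polynomial.eval_mul,
      Polynomial.eval_sub, Polynomial.eval_pow, Polynomial.eval_X, Polynomial.eval_C,
      Polynomial.eval_one]
    ring_nf
    simp only [Complex.I_sq]
    ring
  have hc : ∀ k, Polynomial.coeff (0 : Polynomial ℂ) k = 0 := fun k => Polynomial.coeff_zero k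
  rw [← key] at hc
  simp only [Polynomial.coeff_add, Polynomial.coeff_C_mul_X_pow] at hc
  -- Since `n ≠ d`, the exponents `3d + 3n` and `d + n` avoid the extreme exponents `2d + 4n` and
  -- `2d` of the quadratic part. They isolate `β'` and `γ'`; then `2d + 4n` isolates `α`, and `δ`
  -- remains.
  have h1 : β' = 0 := by
    have := hc (3 * d + 3 * n)
    simpa [show 3 * d + 3 * n ≠ 2 * d + 4 * n by omega, show 3 * d + 3 * n ≠ 2 * d + 3 * n by omega,
      show 3 * d + 3 * n ≠ 2 * d + 2 * n by omega, show 3 * d + 3 * n ≠ 2 * d + n by omega,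
      show 3 * d + 3 * n ≠ 2 * d by omega, show 3 * n ≠ 2 * n by omega,
      show 3 * n ≠ n by omega, show 3 * d ≠ d by omega,
      show 3 * d + 3 * n ≠ d + 2 * n by omega, show 3 * d + 3 * n ≠ d + n by omega, hn.ne', hd.ne']
      using this
  have h2 : γ' = 0 := by
    have := hc (d + n)
    simpa [h1, show d + n ≠ 2 * d + 4 * n by omega, show d + n ≠ 2 * d + 3 * n by omega,
      show d + n ≠ 2 * d + 2 * n by omega, show d ≠ 2 * d by omega,
      show d + n ≠ 2 * d by omega, show n ≠ 3 * n by omega, show n ≠ 2 * n by omega] using this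
  have h3 : α = 0 := by
    have := hc (2 * d + 4 * n)
    simpa [h1, h2, show 4 * n ≠ 2 * n by omega, show 4 * n ≠ 3 * n by omega, hn.ne',
      show 4 * n ≠ n by omega] using this
  have h4 : δ = 0 := by
    have := hc (2 * d + 2 * n)
    simpa [h1, h2, h3] using this
  have hI := Complex.I_ne_zero
  refine ⟨h3, ?_, ?_, h4⟩
  · linear_combination 2 * h1 + 2 * h2 - 2 * hβ' - 2 * hγ'
  · have : Complex.I * γ = 0 := by linear_combination 2 * h2 - 2 * h1 + 2 * hβ' - 2 * hγ'
    exact (mul_eq_zero.1 this).resolve_left hI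
end Curve

/-! ### Relations on the curve and the points of its Zariski closure -/

section Curve

variable {n d : ℕ} {a : ℝ}

/-- The coordinates of the curve as rational functions of the parameter. -/
noncomputable def chRat (n d : ℕ) (a : ℝ) : Fin 2 → RatFunc ℂ :=
  ![algebraMap (Polynomial ℂ) (RatFunc ℂ) (chX n d a) / algebraMap (Polynomial ℂ) (RatFunc ℂ) (Polynomial.X ^ (n + d)),
    algebraMap (Polynomial ℂ) (RatFunc ℂ) (chY n d a) / algebraMap (Polynomial ℂ) (RatFunc ℂ) (Polynomial.X ^ (n + d))]

theorem finite_unit_circle_roots {p : Polynomial ℂ} (hp : p ≠ 0) :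
    {t : ℂ | ‖t‖ = 1 ∧ p.eval t = 0}.Finite :=
  (Polynomial.finite_setOfPred_isRoot hp).subset fun _ ht => ht.2

theorem algebraMap_ratFunc_ne_zero {p : Polynomial ℂ} (hp : p ≠ 0) :
    algebraMap (Polynomial ℂ) (RatFunc ℂ) p ≠ 0 := by
  rwa [Ne, map_eq_zero_iff _ (IsFractionRing.injective (Polynomial ℂ) (RatFunc ℂ))]

/-- Relations between rational functions with denominator `M`, and their values. -/
theorem aeval_div_eq_zero_iff {τ : Type} (N : τ → Polynomial ℂ) {M : Polynomial ℂ} (hM : M ≠ 0)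
    (r : MvPolynomial τ ℂ) :
    ∃ H : Polynomial ℂ,
      (aeval (fun i => algebraMap (Polynomial ℂ) (RatFunc ℂ) (N i) / algebraMap _ _ M) r = 0 ↔
        H = 0) ∧
      ∀ t, M.eval t ≠ 0 → (H.eval t = 0 ↔ eval (fun i => (N i).eval t / M.eval t) r = 0) := by
  obtain ⟨H, k, hH⟩ := exists_clear_denominators r N M
  have hinj := IsFractionRing.injective (Polynomial ℂ) (RatFunc ℂ)
  refine ⟨H, ?_, fun t ht => ?_⟩
  · have h1 := hH (RatFunc ℂ) (IsScalarTower.toAlgHom ℂ (Polynomial ℂ) (RatFunc ℂ))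
      (algebraMap_ratFunc_ne_zero hM)
    simp only [IsScalarTower.coe_toAlgHom'] at h1
    rw [← map_eq_zero_iff _ hinj, h1, mul_eq_zero, or_iff_right]
    exact pow_ne_zero _ (algebraMap_ratFunc_ne_zero hM)
  · have h1 := hH ℂ (Polynomial.aeval t) (by simpa using ht)
    simp only [Polynomial.coe_aeval_eq_eval, aeval_eq_eval] at h1
    rw [h1, mul_eq_zero, or_iff_right]
    exact pow_ne_zero _ ht

theorem chRat_eq : chRat n d a = fun i => algebraMap (Polynomial ℂ) (RatFunc ℂ)
    (![chX n d a, chY n d a] i) / algebraMap (Polynomial ℂ) (RatFunc ℂ) (Polynomial.X ^ (n + d)) := by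
  ext i; fin_cases i <;> rfl

theorem chPoint_eq (t : ℂ) : chPoint n d a t = fun i =>
    (![chX n d a, chY n d a] i).eval t / (Polynomial.X ^ (n + d) : Polynomial ℂ).eval t := by
  ext i; fin_cases i <;> simp [chPoint]

theorem exists_real_chPoint (hd : 0 < d) {t : ℂ} (ht : ‖t‖ = 1) :
    ∃ Q ∈ CH n d a, complexify Q = chPoint n d a t := by
  have hψ : t = Complex.exp (((d * Complex.arg t : ℝ) : ℂ) / d * Complex.I) := by
    have := Complex.norm_mul_exp_arg_mul_I t
    rw [ht] at this
    have hd' : (d : ℂ) ≠ 0 := by exact_mod_cast hd.ne'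
    push_cast
    rw [mul_div_cancel_left₀ _ hd']
    simpa using this.symm
  obtain ⟨Q, hQ⟩ : ∃ Q : E2, complexify Q = chPoint n d a t :=
    ⟨_, by conv_rhs => rw [hψ, chPoint_exp hd]⟩
  exact ⟨Q, (mem_CH_iff hd Q).2 ⟨t, ht, hQ⟩, hQ⟩

/-- The real curve is the image of the infinite unit circle, and a rational function vanishing there
is zero; so its ideal consists of the relations of the generic point. -/
theorem mem_vanishingIdeal_CH_iff (hd : 0 < d) (f : MvPolynomial (Fin 2) ℂ) :
    f ∈ vanishingIdeal ℂ (complexify '' CH n d a) ↔ aeval (chRat n d a) f = 0 := by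
  obtain ⟨H, h1, h2⟩ := aeval_div_eq_zero_iff ![chX n d a, chY n d a]
    (M := Polynomial.X ^ (n + d)) (pow_ne_zero _ Polynomial.X_ne_zero) f
  rw [chRat_eq, h1, mem_vanishingIdeal_iff]
  constructor
  · intro h
    by_contra hH
    refine infinite_unit_circle ((finite_unit_circle_roots hH).subset fun t ht => ⟨ht, ?_⟩)
    have ht0 : t ≠ 0 := by
      rintro rfl
      simp at ht
    rw [h2 t (by simp [ht0]), ← chPoint_eq]
    obtain ⟨Q, hQC, hQ⟩ := exists_real_chPoint (n := n) (a := a) hd ht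
    rw [← hQ]
    exact h _ ⟨Q, hQC, rfl⟩
  · rintro rfl x ⟨Q, hQ, rfl⟩
    obtain ⟨t, ht, hQt⟩ := (mem_CH_iff hd Q).1 hQ
    have ht0 : t ≠ 0 := by
      rintro rfl
      simp at ht
    have := (h2 t (by simp [ht0])).1 (by simp)
    rw [← chPoint_eq, ← hQt] at this
    exact this

theorem eval_chPoint_eq_zero (hd : 0 < d) {f : MvPolynomial (Fin 2) ℂ}
    (hf : f ∈ vanishingIdeal ℂ (complexify '' CH n d a)) {t : ℂ} (ht : t ≠ 0) :
    eval (chPoint n d a t) f = 0 := by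
  rw [mem_vanishingIdeal_CH_iff hd] at hf
  obtain ⟨H, h1, h2⟩ := aeval_div_eq_zero_iff ![chX n d a, chY n d a]
    (M := Polynomial.X ^ (n + d)) (pow_ne_zero _ Polynomial.X_ne_zero) f
  rw [chRat_eq, h1] at hf
  rw [chPoint_eq, ← h2 t (by simp [ht]), hf, Polynomial.eval_zero]

/-- On the curve, `x + i y = t ^ (2 d) (x - i y)`, and `x - i y` is half of `2 t ^ n r` over
`t ^ (n + d)`. -/
theorem chPoint_isotropic {t : ℂ} (ht : t ≠ 0) :
    chPoint n d a t 0 + Complex.I * chPoint n d a t 1 =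
      t ^ (2 * d) * ((chRadius n a).eval t / (2 * t ^ (n + d))) ∧
    chPoint n d a t 0 - Complex.I * chPoint n d a t 1 =
      (chRadius n a).eval t / (2 * t ^ (n + d)) := by
  have h1 := congrArg (Polynomial.eval t) (chX_add_chY (n := n) (d := d) (a := a))
  have h2 := congrArg (Polynomial.eval t) (chX_sub_chY (n := n) (d := d) (a := a))
  simp only [Polynomial.eval_add, Polynomial.eval_sub, Polynomial.eval_mul, Polynomial.eval_C,
    Polynomial.eval_pow, Polynomial.eval_X] at h1 h2
  simp only [chPoint, Matrix.cons_val_zero, Matrix.cons_val_one]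
  constructor
  · field_simp
    linear_combination 2 * h1
  · field_simp
    linear_combination 2 * h2

/-- A real point of the complexified curve, other than the pole, belongs to the curve. -/
theorem norm_eq_one_of_real (hd : 0 < d) {t : ℂ} (ht : t ≠ 0) {Q : E2} (hQ : Q ≠ 0)
    (h : complexify Q = chPoint n d a t) : ‖t‖ = 1 := by
  obtain ⟨h1, h2⟩ := chPoint_isotropic (n := n) (d := d) (a := a) ht
  rw [← h] at h1 h2
  rw [← h2] at h1
  simp only [complexify] at h1
  have hnorm : ‖((Q 0 : ℝ) : ℂ) + Complex.I * (Q 1 : ℝ)‖ = ‖((Q 0 : ℝ) : ℂ) - Complex.I * (Q 1 : ℝ)‖ := by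
    rw [← Complex.norm_conj]
    simp [sub_eq_add_neg]
  have h0 : ((Q 0 : ℝ) : ℂ) - Complex.I * (Q 1 : ℝ) ≠ 0 := by
    intro h0
    apply hQ
    have hre := congrArg Complex.re h0
    have him := congrArg Complex.im h0
    simp at hre him
    ext i
    fin_cases i <;> simp [hre, him]
  have h3 := congrArg norm h1
  rw [norm_mul, hnorm, norm_pow] at h3
  have h4 : ‖t‖ ^ (2 * d) = 1 := by
    have := norm_ne_zero_iff.2 h0
    field_simp at h3
    exact h3.symm
  exact (pow_eq_one_iff_of_nonneg (norm_nonneg t) (by omega)).1 h4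

/-- A point of the Zariski closure off the isotropic lines through the pole has a parameter. -/
theorem exists_parameter (hn : 0 < n) (hd : 0 < d) {Q : Fin 2 → ℂ}
    (hQ : ∀ f ∈ vanishingIdeal ℂ (complexify '' CH n d a), eval Q f = 0)
    (hw : Q 0 + Complex.I * Q 1 ≠ 0) (hwb : Q 0 - Complex.I * Q 1 ≠ 0) :
    ∃ t, t ≠ 0 ∧ chPoint n d a t = Q := by
  set w : MvPolynomial (Fin 2) ℂ := X 0 + C Complex.I * X 1 with hwdef
  set wb : MvPolynomial (Fin 2) ℂ := X 0 - C Complex.I * X 1 with hwbdef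
  -- The parameter is eliminated by a resultant. With `w = x + i y` and `wb = x - i y`, the
  -- parameter of a point of the curve is a common root of `wb s^(2d) - w` and of the cleared
  -- equation `2 w s^n = s^d (s^(2n) + 2a s^n + 1)`.
  set A : Polynomial (MvPolynomial (Fin 2) ℂ) :=
    Polynomial.C wb * Polynomial.X ^ (2 * d) - Polynomial.C w with hA
  set B : Polynomial (MvPolynomial (Fin 2) ℂ) := Polynomial.X ^ (2 * n + d) +
    (Polynomial.C (C (2 * a : ℂ)) * Polynomial.X ^ (n + d) + Polynomial.X ^ d
      - Polynomial.C (2 * w) * Polynomial.X ^ n) with hB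
  set Res := Polynomial.resultant A B (2 * d) (2 * n + d) with hRes
  have hspec : ∀ v : Fin 2 → ℂ, v 0 - Complex.I * v 1 ≠ 0 →
      ∃ A' B' : Polynomial ℂ, eval v Res = Polynomial.resultant A' B' ∧ A' ≠ 0 ∧
        (∀ s, A'.eval s = (v 0 - Complex.I * v 1) * s ^ (2 * d) - (v 0 + Complex.I * v 1)) ∧
        (∀ s, B'.eval s = s ^ (2 * n + d) + (2 * a * s ^ (n + d) + s ^ d
          - 2 * (v 0 + Complex.I * v 1) * s ^ n)) := by
    intro v hv
    have hAv : A.map (eval v) = Polynomial.C (v 0 - Complex.I * v 1) * Polynomial.X ^ (2 * d) -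
        Polynomial.C (v 0 + Complex.I * v 1) := by
      simp [hA, hwdef, hwbdef]
    have hBv : B.map (eval v) = Polynomial.X ^ (2 * n + d) +
        (Polynomial.C (2 * a : ℂ) * Polynomial.X ^ (n + d) + Polynomial.X ^ d
        - Polynomial.C (2 * (v 0 + Complex.I * v 1)) * Polynomial.X ^ n) := by
      simp [hB, hwdef]
    have hAdeg : (A.map (eval v)).natDegree = 2 * d := by
      rw [hAv, Polynomial.natDegree_sub_C, Polynomial.natDegree_C_mul_X_pow _ _ hv]
    have hBdeg : (B.map (eval v)).natDegree = 2 * n + d := by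
      rw [hBv, Polynomial.natDegree_add_eq_left_of_natDegree_lt]
      · simp
      · rw [Polynomial.natDegree_X_pow]
        refine lt_of_le_of_lt (Polynomial.natDegree_sub_le_of_le
          (Polynomial.natDegree_add_le_of_le (Polynomial.natDegree_C_mul_X_pow_le _ _)
            (Polynomial.natDegree_X_pow (R := ℂ) d).le)
            (Polynomial.natDegree_C_mul_X_pow_le _ _)) ?_
        simp only [max_lt_iff]
        omega
    refine ⟨A.map (eval v), B.map (eval v), ?_, ?_, ?_, ?_⟩
    · rw [hAdeg, hBdeg, Polynomial.resultant_map_map]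
    · intro h
      rw [h] at hAdeg
      simp at hAdeg
      omega
    · intro s
      rw [hAv]
      simp
    · intro s
      rw [hBv]
      simp
  -- The factor `wb` covers the points where the leading coefficient of `A` vanishes and the
  -- resultant of fixed degrees says nothing.
  have hmem : wb * Res ∈ vanishingIdeal ℂ (complexify '' CH n d a) := by
    rw [mem_vanishingIdeal_iff]
    rintro _ ⟨P, hP, rfl⟩
    obtain ⟨t, ht, hPt⟩ := (mem_CH_iff hd P).1 hP
    have ht0 : t ≠ 0 := by
      rintro rfl
      simp at ht
    rw [hPt, aeval_eq_eval, map_mul]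
    by_cases h0 : chPoint n d a t 0 - Complex.I * chPoint n d a t 1 = 0
    · have : eval (chPoint n d a t) wb = 0 := by simpa [hwbdef] using h0
      rw [this, zero_mul]
    · obtain ⟨A', B', hR, hA0, hA', hB'⟩ := hspec _ h0
      obtain ⟨h1, h2⟩ := chPoint_isotropic (n := n) (d := d) (a := a) ht0
      rw [hR, Polynomial.resultant_eq_zero_iff.2 ⟨Or.inl hA0, ?_⟩, mul_zero]
      rw [Polynomial.isCoprime_iff_aeval_ne_zero_of_isAlgClosed ℂ ℂ]
      push Not
      refine ⟨t, ?_, ?_⟩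
      · rw [Polynomial.coe_aeval_eq_eval, hA', h1, h2]
        ring
      · rw [Polynomial.coe_aeval_eq_eval, hB', h1]
        simp only [chRadius, Polynomial.eval_add, Polynomial.eval_mul, Polynomial.eval_C,
          Polynomial.eval_pow, Polynomial.eval_X, Polynomial.eval_one]
        field_simp
        ring
  have h0 := hQ _ hmem
  have hwbe : eval Q wb = Q 0 - Complex.I * Q 1 := by simp [hwbdef]
  rw [map_mul, hwbe, mul_eq_zero, or_iff_right hwb] at h0
  obtain ⟨A', B', hR, hA0, hA', hB'⟩ := hspec Q hwb
  rw [hR, Polynomial.resultant_eq_zero_iff,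
    Polynomial.isCoprime_iff_aeval_ne_zero_of_isAlgClosed ℂ ℂ] at h0
  obtain ⟨-, h0⟩ := h0
  push Not at h0
  obtain ⟨t, htA, htB⟩ := h0
  rw [Polynomial.coe_aeval_eq_eval, hA'] at htA
  rw [Polynomial.coe_aeval_eq_eval, hB'] at htB
  have ht0 : t ≠ 0 := by
    rintro rfl
    rw [zero_pow (by omega), mul_zero, zero_sub, neg_eq_zero] at htA
    exact hw htA
  refine ⟨t, ht0, ?_⟩
  obtain ⟨h1, h2⟩ := chPoint_isotropic (n := n) (d := d) (a := a) ht0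
  have hR : (chRadius n a).eval t = t ^ (2 * n) + 2 * a * t ^ n + 1 := by simp [chRadius]
  have htB' : (Q 0 + Complex.I * Q 1) * (2 * t ^ n) = t ^ d * (chRadius n a).eval t := by
    rw [hR]
    linear_combination -htB
  have e1 : chPoint n d a t 0 + Complex.I * chPoint n d a t 1 = Q 0 + Complex.I * Q 1 := by
    rw [h1]
    field_simp
    linear_combination -(t ^ d) * htB'
  have e2 : chPoint n d a t 0 - Complex.I * chPoint n d a t 1 = Q 0 - Complex.I * Q 1 := by
    rw [h2] at *
    rw [h1] at e1
    have h3 : t ^ (2 * d) * ((chRadius n a).eval t / (2 * t ^ (n + d))) =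
        t ^ (2 * d) * (Q 0 - Complex.I * Q 1) := by
      rw [e1]
      linear_combination -htA
    exact mul_left_cancel₀ (pow_ne_zero _ ht0) h3
  ext i
  fin_cases i
  · change chPoint n d a t 0 = Q 0
    linear_combination (e1 + e2) / 2
  · change chPoint n d a t 1 = Q 1
    have : Complex.I * chPoint n d a t 1 = Complex.I * Q 1 := by linear_combination (e1 - e2) / 2
    exact mul_left_cancel₀ Complex.I_ne_zero this

/-- A nonzero real point is off the isotropic lines through the pole, so it has a parameter, and
reality forces the parameter onto the unit circle. The pole is a genuine exception: for `a > 1` it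
belongs to the closure only. -/
theorem mem_CH_of_mem_algCurve (hn : 0 < n) (hd : 0 < d) {Q : E2} (hQ : Q ∈ algCurve (CH n d a))
    (hQ0 : Q ≠ 0) : Q ∈ CH n d a := by
  have hne : ∀ s : ℂ, s = Complex.I ∨ s = -Complex.I → complexify Q 0 + s * complexify Q 1 ≠ 0 := by
    intro s hs h0
    apply hQ0
    simp only [complexify] at h0
    have hre := congrArg Complex.re h0
    have him := congrArg Complex.im h0
    rcases hs with rfl | rfl <;> simp at hre him <;> ext i <;> fin_cases i <;> simp [hre, him]
  obtain ⟨t, ht, htQ⟩ := exists_parameter hn hd (Q := complexify Q) hQ (hne _ (Or.inl rfl))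
    (by simpa [sub_eq_add_neg] using hne _ (Or.inr rfl))
  exact (mem_CH_iff hd Q).2 ⟨t, norm_eq_one_of_real hd ht hQ0 htQ.symm, htQ.symm⟩

end Curve

/-! ### The function field of the curve and the degree of its parametrisation -/

section CurveField

variable {n d : ℕ} {a : ℝ}

/-- Homogeneous coordinates of the cyclic-harmonic curve. -/
noncomputable def chTriple (n d : ℕ) (a : ℝ) : Fin 3 → Polynomial ℂ :=
  ![Polynomial.X ^ (n + d), chX n d a, chY n d a]

/-- The function field of the cyclic-harmonic curve. -/
noncomputable def chField (n d : ℕ) (a : ℝ) : IntermediateField ℂ (RatFunc ℂ) :=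
  ratioField (toRat (chTriple n d a))

theorem algebraMap_X_eq : algebraMap (Polynomial ℂ) (RatFunc ℂ) Polynomial.X = RatFunc.X :=
  RatFunc.algebraMap_X

theorem algebraMap_C_smul (c : ℂ) (p : Polynomial ℂ) :
    c • algebraMap (Polynomial ℂ) (RatFunc ℂ) p =
      algebraMap (Polynomial ℂ) (RatFunc ℂ) (Polynomial.C c * p) := by
  rw [← Polynomial.smul_eq_C_mul, ← algebraMap_smul (Polynomial ℂ) c p, smul_eq_mul, map_mul,
    Algebra.smul_def, ← IsScalarTower.algebraMap_apply]

theorem sum_smul_toRat (p : Fin 3 → Polynomial ℂ) (c : Fin 3 → ℂ) :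
    ∑ i, c i • toRat p i = algebraMap (Polynomial ℂ) (RatFunc ℂ) (∑ i, Polynomial.C (c i) * p i) := by
  rw [map_sum]
  exact Finset.sum_congr rfl fun i _ => algebraMap_C_smul _ _

/-- This function is `(x + i y) / (x - i y)`. -/
theorem X_pow_mem_chField (hn : 0 < n) : RatFunc.X ^ (2 * d) ∈ chField n d a := by
  have h := div_mem_ratioField (P := toRat (chTriple n d a)) ![0, 1, Complex.I]
    ![0, 1, -Complex.I]
  rw [sum_smul_toRat, sum_smul_toRat] at h
  have h1 : ∑ i, Polynomial.C ((![0, 1, Complex.I] : Fin 3 → ℂ) i) * chTriple n d a i =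
      Polynomial.X ^ (2 * d) * (Polynomial.C (1 / 2) * chRadius n a) := by
    have := chX_add_chY (n := n) (d := d) (a := a)
    simp only [Fin.sum_univ_three, chTriple, Matrix.cons_val_zero, Matrix.cons_val_one,
      Matrix.cons_val, map_zero, map_one]
    linear_combination this
  have h2 : ∑ i, Polynomial.C ((![0, 1, -Complex.I] : Fin 3 → ℂ) i) * chTriple n d a i =
      Polynomial.C (1 / 2) * chRadius n a := by
    have := chX_sub_chY (n := n) (d := d) (a := a)
    simp only [Fin.sum_univ_three, chTriple, Matrix.cons_val_zero, Matrix.cons_val_one,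
      Matrix.cons_val, map_zero, map_one, map_neg]
    linear_combination this
  have h3 : algebraMap (Polynomial ℂ) (RatFunc ℂ) (Polynomial.C (1 / 2) * chRadius n a) ≠ 0 :=
    algebraMap_ratFunc_ne_zero (mul_ne_zero (by simp) (chRadius_ne_zero hn))
  rw [h1, h2, map_mul, mul_div_cancel_right₀ _ h3, map_pow, algebraMap_X_eq] at h
  exact h

/-- This function is `2 (x + i y)`. -/
theorem X_pow_mul_chRadius_div_mem_chField :
    algebraMap (Polynomial ℂ) (RatFunc ℂ) (Polynomial.X ^ d * chRadius n a) /
      RatFunc.X ^ n ∈ chField n d a := by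
  have h := div_mem_ratioField (P := toRat (chTriple n d a)) ![0, 2, 2 * Complex.I]
    ![1, 0, 0]
  rw [sum_smul_toRat, sum_smul_toRat] at h
  have h1 : ∑ i, Polynomial.C ((![0, 2, 2 * Complex.I] : Fin 3 → ℂ) i) * chTriple n d a i =
      Polynomial.X ^ d * (Polynomial.X ^ d * chRadius n a) := by
    have := chX_add_chY (n := n) (d := d) (a := a)
    have h2 : (Polynomial.C 2 * Polynomial.C (1 / 2) : Polynomial ℂ) = 1 := by
      rw [← Polynomial.C_mul]; norm_num
    simp only [Fin.sum_univ_three, chTriple, Matrix.cons_val_zero, Matrix.cons_val_one,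
      Matrix.cons_val, map_zero, map_mul]
    linear_combination Polynomial.C 2 * this + Polynomial.X ^ (2 * d) * chRadius n a * h2
  have h2 : ∑ i, Polynomial.C ((![1, 0, 0] : Fin 3 → ℂ) i) * chTriple n d a i =
      Polynomial.X ^ d * Polynomial.X ^ n := by
    simp [Fin.sum_univ_three, chTriple, pow_add, mul_comm]
  rw [h1, h2, map_mul, map_mul (algebraMap (Polynomial ℂ) (RatFunc ℂ)) (Polynomial.X ^ d)
    (Polynomial.X ^ n), mul_div_mul_left _ _ (algebraMap_ratFunc_ne_zero
      (pow_ne_zero _ Polynomial.X_ne_zero)), map_pow _ _ n, algebraMap_X_eq] at h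
  exact h

/-- The substitution `t ↦ ζ t` must preserve `x + i y`. Comparing coefficients gives `ζ^(n+d) = 1`
and `ζ^d = ζ^n`, whence `ζ² = 1` by coprimality; `ζ = -1` needs `n + d` even, so both are odd, and
the middle coefficient then forces `a = 0`. -/
theorem param_eq_of_root (hn : 0 < n) (hnd : n.Coprime d) {ζ : ℂ}
    (hζ0 : ζ ≠ 0) (h : Polynomial.C (ζ ^ (2 * n + d)) * Polynomial.X ^ (2 * n + d) +
      Polynomial.C (2 * a * ζ ^ (n + d)) * Polynomial.X ^ (n + d) +
      Polynomial.C (ζ ^ d) * Polynomial.X ^ d =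
      Polynomial.C (ζ ^ n) * (Polynomial.X ^ d * chRadius n a)) :
    ζ = 1 ∨ (ζ = -1 ∧ a = 0 ∧ Odd (n * d)) := by
  have hc : ∀ k, _ = _ := fun k => congrArg (Polynomial.coeff · k) h
  have e : Polynomial.C (ζ ^ n) * (Polynomial.X ^ d * chRadius n a) =
      Polynomial.C (ζ ^ n) * Polynomial.X ^ (2 * n + d) +
      Polynomial.C (ζ ^ n * (2 * a)) * Polynomial.X ^ (n + d) +
      Polynomial.C (ζ ^ n) * Polynomial.X ^ d := by
    rw [chRadius]
    simp only [Polynomial.C_mul]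
    ring
  rw [e] at hc
  simp only [Polynomial.coeff_add, Polynomial.coeff_C_mul_X_pow] at hc
  have h1 : ζ ^ (2 * n + d) = ζ ^ n := by
    simpa [show 2 * n + d ≠ n + d by omega, show 2 * n ≠ n by omega, hn.ne'] using hc (2 * n + d)
  have h2 : 2 * a * ζ ^ (n + d) = ζ ^ n * (2 * a) := by
    simpa [show n + d ≠ 2 * n + d by omega, show n ≠ 2 * n by omega, hn.ne'] using hc (n + d)
  have h3 : ζ ^ d = ζ ^ n := by
    simpa [show d ≠ 2 * n + d by omega, show d ≠ n + d by omega, hn.ne'] using hc d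
  have hn0 : ζ ^ n ≠ 0 := pow_ne_zero _ hζ0
  have h4 : ζ ^ (n + d) = 1 := by
    rw [show 2 * n + d = (n + d) + n by ring, pow_add] at h1
    exact (mul_eq_right₀ hn0).1 h1
  have h5 : ζ ^ (2 * n) = 1 := by rw [two_mul, pow_add, ← h4, pow_add, h3]
  have h6 : ζ ^ (2 * d) = 1 := by rw [two_mul, pow_add, ← h4, pow_add, h3]
  have h7 : ζ ^ 2 = 1 := by
    have := Nat.dvd_gcd (orderOf_dvd_of_pow_eq_one h5) (orderOf_dvd_of_pow_eq_one h6)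
    rw [Nat.gcd_mul_left, hnd.gcd_eq_one, mul_one] at this
    exact orderOf_dvd_iff_pow_eq_one.1 this
  rcases (sq_eq_one_iff.1 h7) with h | h
  · exact Or.inl h
  · refine Or.inr ⟨h, ?_, ?_⟩
    all_goals
      have hpar : Even (n + d) := by
        rw [h] at h4
        exact (neg_one_pow_eq_one_iff_even (by norm_num)).1 h4
      have hno : Odd n := by
        by_contra hne
        rw [Nat.not_odd_iff_even] at hne
        have hde : Even d := (Nat.even_add.1 hpar).1 hne
        have := Nat.dvd_gcd hne.two_dvd hde.two_dvd
        rw [hnd.gcd_eq_one] at this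
        omega
    · rw [h4, h, hno.neg_one_pow] at h2
      have : (a : ℂ) = 0 := by linear_combination h2 / 4
      exact_mod_cast this
    · refine hno.mul ?_
      by_contra hne
      rw [Nat.not_odd_iff_even] at hne
      exact (Nat.not_even_iff_odd.2 hno) ((Nat.even_add.1 hpar).2 hne)

theorem isIntegral_X_chField (hn : 0 < n) (hd : 0 < d) :
    IsIntegral (chField n d a) (RatFunc.X : RatFunc ℂ) := by
  refine ⟨Polynomial.X ^ (2 * d) - Polynomial.C ⟨_, X_pow_mem_chField hn⟩,
    Polynomial.monic_X_pow_sub_C _ (by omega), ?_⟩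
  simp [IntermediateField.algebraMap_apply]

theorem finrank_chField_eq_natDegree (hn : 0 < n) (hd : 0 < d) :
    finrank (chField n d a) (RatFunc ℂ) =
      (minpoly (chField n d a) (RatFunc.X : RatFunc ℂ)).natDegree := by
  rw [← adjoin.finrank (isIntegral_X_chField hn hd), RatFunc.IntermediateField.adjoin_X,
    IntermediateField.finrank_top']

/-- A conjugate of `t` over the field of the curve has the same `2d`-th power, so it is `ζ t` with a
root of unity `ζ`; the second known element of the field then restricts `ζ`. -/
theorem mem_pair_of_root (hn : 0 < n) (hd : 0 < d) (hnd : n.Coprime d) {ρ : RatFunc ℂ}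
    (hρ : Polynomial.aeval ρ (minpoly (chField n d a) (RatFunc.X : RatFunc ℂ)) = 0) :
    ρ = RatFunc.X ∨ (ρ = -RatFunc.X ∧ a = 0 ∧ Odd (n * d)) := by
  have hX : (RatFunc.X : RatFunc ℂ) ≠ 0 := RatFunc.X_ne_zero
  have hroot : ∀ P : Polynomial (chField n d a), Polynomial.aeval (RatFunc.X : RatFunc ℂ) P = 0 →
      Polynomial.aeval ρ P = 0 := by
    intro P hP
    obtain ⟨Q, rfl⟩ := minpoly.dvd _ _ hP
    rw [map_mul, hρ, zero_mul]
  have h1 : ρ ^ (2 * d) = RatFunc.X ^ (2 * d) := by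
    have := hroot (Polynomial.X ^ (2 * d) - Polynomial.C ⟨_, X_pow_mem_chField hn⟩)
      (by simp [IntermediateField.algebraMap_apply])
    simpa [IntermediateField.algebraMap_apply, sub_eq_zero] using this
  have hinj : Function.Injective (algebraMap ℂ (RatFunc ℂ)) := (algebraMap ℂ (RatFunc ℂ)).injective
  have hprim := (Complex.isPrimitiveRoot_exp (2 * d) (by omega)).map_of_injective hinj
  have : NeZero (2 * d) := ⟨by omega⟩
  obtain ⟨i, -, hi⟩ := hprim.eq_pow_of_pow_eq_one (ξ := ρ / RatFunc.X)
    (by rw [div_pow, h1, div_self (pow_ne_zero _ hX)])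
  set ζ := Complex.exp (2 * Real.pi * Complex.I / (2 * d : ℕ)) ^ i with hζ
  have hζ0 : ζ ≠ 0 := pow_ne_zero _ (Complex.exp_ne_zero _)
  have hρζ : ρ = algebraMap (Polynomial ℂ) (RatFunc ℂ) (Polynomial.C ζ * Polynomial.X) := by
    rw [map_mul, algebraMap_X_eq, ← Polynomial.algebraMap_eq, ← IsScalarTower.algebraMap_apply, hζ,
      map_pow, hi, div_mul_cancel₀ _ hX]
  have h2 := hroot (Polynomial.X ^ (2 * n + d) +
      Polynomial.C (algebraMap ℂ _ (2 * a)) * Polynomial.X ^ (n + d) + Polynomial.X ^ d -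
      Polynomial.C ⟨_, X_pow_mul_chRadius_div_mem_chField⟩ * Polynomial.X ^ n) ?_
  · have h3 : Polynomial.C (ζ ^ (2 * n + d)) * Polynomial.X ^ (2 * n + d) +
      Polynomial.C (2 * a * ζ ^ (n + d)) * Polynomial.X ^ (n + d) +
      Polynomial.C (ζ ^ d) * Polynomial.X ^ d =
      Polynomial.C (ζ ^ n) * (Polynomial.X ^ d * chRadius n a) := by
      apply IsFractionRing.injective (Polynomial ℂ) (RatFunc ℂ)
      simp only [map_add, map_sub, map_mul, map_pow, Polynomial.aeval_X, Polynomial.aeval_C,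
        IntermediateField.algebraMap_apply, ← IsScalarTower.algebraMap_apply] at h2
      rw [hρζ, IsScalarTower.algebraMap_apply ℂ (Polynomial ℂ) (RatFunc ℂ), ← algebraMap_X_eq,
        Polynomial.algebraMap_eq, ← map_pow _ Polynomial.X n] at h2
      have hXn : algebraMap (Polynomial ℂ) (RatFunc ℂ) (Polynomial.X ^ n) ≠ 0 :=
        algebraMap_ratFunc_ne_zero (pow_ne_zero _ Polynomial.X_ne_zero)
      simp only [map_mul _ (Polynomial.C ζ) Polynomial.X, mul_pow] at h2
      simp only [map_mul, map_add, map_pow] at h2 hXn ⊢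
      field_simp at h2
      linear_combination h2
    rcases param_eq_of_root hn hnd hζ0 h3 with h | ⟨h, h'⟩
    · left
      rw [hρζ, h, Polynomial.C_1, one_mul, algebraMap_X_eq]
    · right
      refine ⟨?_, h'⟩
      rw [hρζ, h, Polynomial.C_neg, Polynomial.C_1, neg_one_mul, map_neg, algebraMap_X_eq]
  · simp only [map_add, map_sub, map_mul, map_pow, Polynomial.aeval_X, Polynomial.aeval_C,
        IntermediateField.algebraMap_apply, ← IsScalarTower.algebraMap_apply]
    have hC : ∀ c : ℂ, algebraMap ℂ (RatFunc ℂ) c =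
        algebraMap (Polynomial ℂ) (RatFunc ℂ) (Polynomial.C c) := fun c =>
      IsScalarTower.algebraMap_apply ℂ (Polynomial ℂ) (RatFunc ℂ) c
    simp only [hC]
    rw [div_mul_cancel₀ _ (pow_ne_zero _ hX), sub_eq_zero, ← algebraMap_X_eq, chRadius]
    simp only [map_mul, map_add, map_pow, map_one]
    ring

/-- The degree is the number of conjugates of `t`, because the minimal polynomial is separable and
splits in `ℂ(t)`. -/
theorem finrank_chField_le (hn : 0 < n) (hd : 0 < d) (hnd : n.Coprime d) :
    finrank (chField n d a) (RatFunc ℂ) ≤ if a = 0 ∧ Odd (n * d) then 2 else 1 := by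
  classical
  have hint := isIntegral_X_chField (a := a) hn hd
  rw [finrank_chField_eq_natDegree hn hd,
    ← Polynomial.card_rootSet_eq_natDegree (K := RatFunc ℂ) (minpoly.irreducible hint).separable]
  · rw [← Nat.card_eq_fintype_card, Nat.card_coe_set_eq]
    split_ifs with h
    · refine (Set.ncard_le_ncard (t := {RatFunc.X, -RatFunc.X}) ?_).trans (Set.ncard_insert_le _ _ |>.trans (by simp))
      intro ρ hρ
      rcases mem_pair_of_root hn hd hnd (Polynomial.mem_rootSet.1 hρ).2 with h | h
      · exact Or.inl h
      · exact Or.inr h.1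
    · refine (Set.ncard_le_ncard (t := {RatFunc.X}) ?_).trans (Set.ncard_singleton _).le
      intro ρ hρ
      rcases mem_pair_of_root hn hd hnd (Polynomial.mem_rootSet.1 hρ).2 with h' | h'
      · exact h'
      · exact absurd h'.2 h
  -- The minimal polynomial divides `Y^(2d) - t^(2d)`, which splits since `ℂ` contains the roots of
  -- unity.
  · have hinj : Function.Injective (algebraMap ℂ (RatFunc ℂ)) := (algebraMap ℂ (RatFunc ℂ)).injective
    have hprim := (Complex.isPrimitiveRoot_exp (2 * d) (by omega)).map_of_injective hinj
    have hs := X_pow_sub_C_splits_of_isPrimitiveRoot hprim (α := RatFunc.X) rfl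
    refine hs.of_dvd (Polynomial.X_pow_sub_C_ne_zero (by omega) _) ?_
    have := minpoly.dvd (chField n d a) (RatFunc.X : RatFunc ℂ)
      (p := Polynomial.X ^ (2 * d) - Polynomial.C ⟨_, X_pow_mem_chField hn⟩)
      (by simp [IntermediateField.algebraMap_apply])
    have := Polynomial.map_dvd (algebraMap (chField n d a) (RatFunc ℂ)) this
    simpa [IntermediateField.algebraMap_apply] using this

/-- For `a = 0` and `n`, `d` odd all three homogeneous coordinates are even in `t`. -/
theorem chField_le_of_odd (hodd : Odd (n * d)) :
    chField n d 0 ≤ ℂ⟮(RatFunc.X : RatFunc ℂ) ^ 2⟯ := by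
  obtain ⟨hno, hdo⟩ := Nat.odd_mul.1 hodd
  set F := ℂ⟮(RatFunc.X : RatFunc ℂ) ^ 2⟯ with hF
  have hX : ∀ k, Even k → algebraMap (Polynomial ℂ) (RatFunc ℂ) (Polynomial.X ^ k) ∈ F := by
    rintro k ⟨m, rfl⟩
    rw [← two_mul, pow_mul, map_pow, map_pow, algebraMap_X_eq]
    exact pow_mem (mem_adjoin_simple_self _ _) _
  have hC : ∀ c : ℂ, algebraMap (Polynomial ℂ) (RatFunc ℂ) (Polynomial.C c) ∈ F := by
    intro c
    rw [← Polynomial.algebraMap_eq, ← IsScalarTower.algebraMap_apply]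
    exact F.algebraMap_mem c
  have hR : algebraMap (Polynomial ℂ) (RatFunc ℂ) (chRadius n 0) ∈ F := by
    have : chRadius n 0 = Polynomial.X ^ (2 * n) + Polynomial.C 1 := by simp [chRadius]
    rw [this, map_add]
    exact add_mem (hX _ (even_two_mul n)) (hC 1)
  have hP : ∀ i, toRat (chTriple n d 0) i ∈ F := by
    intro i
    fin_cases i
    · exact hX _ (hno.add_odd hdo)
    · change algebraMap (Polynomial ℂ) (RatFunc ℂ) (chX n d 0) ∈ F
      rw [chX, map_mul, map_mul, map_add]
      exact mul_mem (mul_mem (hC _) (add_mem (hX _ (even_two_mul d)) (by simp))) hR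
    · change algebraMap (Polynomial ℂ) (RatFunc ℂ) (chY n d 0) ∈ F
      rw [chY, map_mul, map_mul, map_sub]
      exact mul_mem (mul_mem (hC _) (sub_mem (hX _ (even_two_mul d)) (by simp))) hR
  refine adjoin_le_iff.2 ?_
  rintro x ⟨b, c, rfl⟩
  exact div_mem (sum_mem fun i _ => F.smul_mem (hP i)) (sum_mem fun i _ => F.smul_mem (hP i))

theorem finrank_chField (hn : 0 < n) (hd : 0 < d) (hnd : n.Coprime d) :
    finrank (chField n d a) (RatFunc ℂ) = if a = 0 ∧ Odd (n * d) then 2 else 1 := by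
  have hle := finrank_chField_le (a := a) hn hd hnd
  have hpos : 0 < finrank (chField n d a) (RatFunc ℂ) := by
    rw [finrank_chField_eq_natDegree hn hd]
    exact minpoly.natDegree_pos (isIntegral_X_chField hn hd)
  refine le_antisymm hle ?_
  split_ifs with h
  · obtain ⟨rfl, hodd⟩ := h
    have h1 := relfinrank_mul_finrank_top (chField_le_of_odd hodd)
    have h2 : finrank ℂ⟮(RatFunc.X : RatFunc ℂ) ^ 2⟯ (RatFunc ℂ) = 2 := by
      have := finrank_adjoin_div (r₁ := Polynomial.X ^ 2) (r₂ := 1) isCoprime_one_right one_ne_zero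
      rw [map_one, div_one, map_pow, algebraMap_X_eq] at this
      simpa using this
    rw [h2] at h1
    omega
  · exact hpos

end CurveField

/-! ### The equation of a circular surface -/

section ConeSubst

variable {G : MvPolynomial (Fin 3) ℂ} {e g : ℕ}

/-- The substitution `U = x₀ U'` in polynomials in `x₀, x, y, U`. -/
noncomputable def coneSubst : MvPolynomial (Fin 4) ℂ →ₐ[ℂ] Polynomial (MvPolynomial (Fin 3) ℂ) :=
  aeval ![Polynomial.X, Polynomial.C (X 1), Polynomial.C (X 2), Polynomial.X * Polynomial.C (X 0)]

theorem aeval_C_X (G : MvPolynomial (Fin 3) ℂ) :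
    aeval ![Polynomial.C (X 0), Polynomial.C (X 1), Polynomial.C (X 2)] G =
      (Polynomial.C G : Polynomial (MvPolynomial (Fin 3) ℂ)) := by
  induction G using MvPolynomial.induction_on with
  | C a => simp
  | add p q hp hq => simp only [map_add, hp, hq]
  | mul_X p i hp =>
    rw [map_mul, hp, aeval_X, Polynomial.C_mul]
    fin_cases i <;> rfl

theorem coneSubst_coneForm (he : degreeOf 0 G ≤ e) :
    coneSubst (coneForm e G) = Polynomial.X ^ e * Polynomial.C G := by
  rw [coneSubst, coneForm_mul he, aeval_C_X]

theorem eval_coneSubst (c : MvPolynomial (Fin 4) ℂ) (τ : ℂ) (v : Fin 3 → ℂ) :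
    ((coneSubst c).map (eval v)).eval τ = eval ![τ, v 1, v 2, τ * v 0] c := by
  induction c using MvPolynomial.induction_on with
  | C a => simp [coneSubst, Polynomial.algebraMap_apply]
  | add p q hp hq => simp only [map_add, Polynomial.map_add, Polynomial.eval_add, hp, hq]
  | mul_X p i hp =>
    rw [map_mul, Polynomial.map_mul, Polynomial.eval_mul, hp, map_mul]
    congr 1
    fin_cases i
    · simp [coneSubst]
    · simp [coneSubst]
    · simp [coneSubst]
    · simp [coneSubst, -Polynomial.X_mul_C]

theorem coneSubst_injective : Function.Injective coneSubst := by
  rw [injective_iff_map_eq_zero]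
  intro c hc
  have h : X 0 * c = 0 := by
    refine MvPolynomial.funext fun v => ?_
    rw [map_mul, eval_X, map_zero, mul_eq_zero, or_iff_not_imp_left]
    intro hv
    have := eval_coneSubst c (v 0) ![v 3 / v 0, v 1, v 2]
    rw [hc] at this
    simp only [Polynomial.map_zero, Polynomial.eval_zero, Matrix.cons_val_one,
      Matrix.cons_val_zero, Matrix.cons_val, mul_div_cancel₀ _ hv] at this
    rw [this]
    congr 2
    ext i
    fin_cases i <;> simp
  exact (mul_eq_zero.1 h).resolve_left (X_ne_zero _)

/-- The substitution becomes surjective after inverting `x₀`, since `X 0` is the image of `U / x₀`.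
-/
theorem exists_coneSubst_eq (H : Polynomial (MvPolynomial (Fin 3) ℂ)) :
    ∃ m A, coneSubst A = Polynomial.X ^ m * H := by
  have hadd : ∀ H H' : Polynomial (MvPolynomial (Fin 3) ℂ),
      (∃ m A, coneSubst A = Polynomial.X ^ m * H) → (∃ m A, coneSubst A = Polynomial.X ^ m * H') →
      ∃ m A, coneSubst A = Polynomial.X ^ m * (H + H') := by
    rintro H H' ⟨m, A, hA⟩ ⟨m', A', hA'⟩
    refine ⟨m + m', X 0 ^ m' * A + X 0 ^ m * A', ?_⟩
    have : coneSubst (X 0) = Polynomial.X := by simp [coneSubst]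
    rw [map_add, map_mul, map_mul, map_pow, map_pow, this, hA, hA']
    ring
  have hmul : ∀ H H' : Polynomial (MvPolynomial (Fin 3) ℂ),
      (∃ m A, coneSubst A = Polynomial.X ^ m * H) → (∃ m A, coneSubst A = Polynomial.X ^ m * H') →
      ∃ m A, coneSubst A = Polynomial.X ^ m * (H * H') := by
    rintro H H' ⟨m, A, hA⟩ ⟨m', A', hA'⟩
    refine ⟨m + m', A * A', ?_⟩
    rw [map_mul, hA, hA']
    ring
  have hC : ∀ B : MvPolynomial (Fin 3) ℂ, ∃ m A, coneSubst A = Polynomial.X ^ m * Polynomial.C B := by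
    intro B
    induction B using MvPolynomial.induction_on with
    | C a => exact ⟨0, C a, by simp [coneSubst]⟩
    | add p q hp hq => rw [Polynomial.C_add]; exact hadd _ _ hp hq
    | mul_X p i hp =>
      rw [Polynomial.C_mul]
      refine hmul _ _ hp ?_
      fin_cases i
      · exact ⟨1, X 3, by simp [coneSubst]⟩
      · exact ⟨0, X 1, by simp [coneSubst]⟩
      · exact ⟨0, X 2, by simp [coneSubst]⟩
  induction H using Polynomial.induction_on' with
  | add p q hp hq => exact hadd _ _ hp hq
  | monomial k B =>
    rw [← Polynomial.C_mul_X_pow_eq_monomial]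
    exact hmul _ _ (hC B) ⟨0, X 0 ^ k, by simp [coneSubst]⟩

/-- Divisibility holds up to a power of `x₀`, and that power cancels because `x₀` is prime and does
not divide the cone form. -/
theorem coneForm_dvd_of_C_dvd (hG0 : G ≠ 0) (he : degreeOf 0 G = e) {c : MvPolynomial (Fin 4) ℂ}
    (h : Polynomial.C G ∣ coneSubst c) : coneForm e G ∣ c := by
  obtain ⟨H, hH⟩ := h
  obtain ⟨m, A, hA⟩ := exists_coneSubst_eq H
  have h1 : X 0 ^ (m + e) * c = coneForm e G * A := by
    apply coneSubst_injective
    have : coneSubst (X 0) = Polynomial.X := by simp [coneSubst]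
    rw [map_mul, map_mul, map_pow, this, hH, hA, coneSubst_coneForm he.le]
    ring
  have hprime : Prime (X 0 : MvPolynomial (Fin 4) ℂ) := X_prime
  have hnd : ¬ (X 0 : MvPolynomial (Fin 4) ℂ) ∣ coneForm e G := by
    rintro ⟨B, hB⟩
    obtain ⟨x, y, hxy⟩ := coneForm_zero_left_ne_zero hG0
    rw [he, hB] at hxy
    simp at hxy
  obtain ⟨B, hB⟩ := hprime.pow_dvd_of_dvd_mul_left _ hnd (Dvd.intro _ h1)
  refine ⟨B, ?_⟩
  rw [hB] at h1
  refine mul_left_cancel₀ (pow_ne_zero (m + e) (X_ne_zero (R := ℂ) (0 : Fin 4))) ?_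
  rw [h1]
  ring

theorem coneForm_pow (he : degreeOf 0 G ≤ e) (k : ℕ) :
    coneForm (e * k) (G ^ k) = coneForm e G ^ k := by
  apply coneSubst_injective
  rw [coneSubst_coneForm (e := e * k), map_pow coneSubst, coneSubst_coneForm he, mul_pow, ← pow_mul, Polynomial.C_pow]
  exact (degreeOf_pow_le _ _ _).trans (by rw [mul_comm]; exact Nat.mul_le_mul_right _ he)

/-- Counting the surface `k` times multiplies both `g` and `e` by `k`. -/
theorem surfaceForm_pow (q : ℂ) (he : degreeOf 0 G ≤ e) (k : ℕ) :
    surfaceForm q (e * k) (G ^ k) = surfaceForm q e G ^ k := by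
  rw [surfaceForm, coneForm_pow he, map_pow, surfaceForm]

end ConeSubst

/-- Modulo the definition of `Q`, the square `z²` is a polynomial in `x₀, x, y, Q`, so `1` and `z`
suffice as generators. -/
theorem exists_aeval_sphereCoords (q : ℂ) (F : MvPolynomial (Fin 4) ℂ) :
    ∃ a b : MvPolynomial (Fin 4) ℂ,
      F = aeval (sphereCoords q) a + X 3 * aeval (sphereCoords q) b := by
  induction F using MvPolynomial.induction_on with
  | C r => exact ⟨C r, 0, by simp⟩
  | add p r hp hr =>
    obtain ⟨a, b, h⟩ := hp
    obtain ⟨a', b', h'⟩ := hr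
    refine ⟨a + a', b + b', ?_⟩
    rw [map_add, map_add, h, h']
    ring
  | mul_X p i hp =>
    obtain ⟨a, b, h⟩ := hp
    have hlow : ∀ i : Fin 4, i ≠ 3 → aeval (sphereCoords q) (X i : MvPolynomial (Fin 4) ℂ) = X i := by
      intro i hi
      rw [aeval_X]
      fin_cases i <;> simp_all [sphereCoords]
    by_cases hi : i = 3
    · subst hi
      -- Here `z (a + z b) = z² b + z a`, and `X 3` stands for `Q`, so `z²` is `X 3 - X 1 ^ 2 - X 2
      -- ^ 2 + C q * X 0 ^ 2`.
      refine ⟨b * (X 3 - X 1 ^ 2 - X 2 ^ 2 + C q * X 0 ^ 2), a, ?_⟩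
      rw [map_mul]
      simp only [map_add, map_sub, map_mul, map_pow, hlow 0 (by decide), hlow 1 (by decide),
        hlow 2 (by decide), aeval_C]
      rw [aeval_X]
      rw [show sphereCoords q 3 = X 1 ^ 2 + X 2 ^ 2 + X 3 ^ 2 - C q * X 0 ^ 2 from rfl, h]
      simp only [algebraMap_eq]
      ring
    · refine ⟨a * X i, b * X i, ?_⟩
      rw [map_mul, map_mul, hlow i hi, h]
      ring

/-- Points of one circle have proportional `(κ, ξ, η)`, and `s` is the quotient of their coordinates
`u`. In this form the unit direction and the parameter `k` of the circle have disappeared. -/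
theorem mem_circularSurface_iff {q : ℝ} {α : Set E3} {Z : E3} :
    Z ∈ circularSurface q α ↔ ∃ Y ∈ α, Y ∉ zAxis ∧ ∃ s : ℝ, Z 0 = s * Y 0 ∧ Z 1 = s * Y 1 ∧
      s ^ 2 * (Y 0 ^ 2 + Y 1 ^ 2) + Z 2 ^ 2 - q = s * (Y 0 ^ 2 + Y 1 ^ 2 + Y 2 ^ 2 - q) := by
  constructor
  · rintro ⟨c, ⟨⟨v₀, v₁, k, hv, rfl⟩, Y, ⟨u, h0, h1, h2⟩, hY, hYz⟩, u', h0', h1', h2'⟩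
    have hu : u ≠ 0 := by
      rintro rfl
      exact hYz ⟨by simpa using h0, by simpa using h1⟩
    refine ⟨Y, hY, hYz, u' / u, ?_, ?_, ?_⟩
    · rw [h0', h0]; field_simp
    · rw [h1', h1]; field_simp
    · rw [h0, h1]
      field_simp
      linear_combination u * h2' - u' * h2 + (u'^2*u - u' * u ^ 2) * hv
  · rintro ⟨Y, hY, hYz, s, h0, h1, h2⟩
    set W := Y 0 ^ 2 + Y 1 ^ 2 with hW
    have hWpos : 0 < W := by
      refine lt_of_le_of_ne (by positivity) fun h => hYz ?_
      constructor <;> nlinarith [sq_nonneg (Y 0), sq_nonneg (Y 1)]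
    have hu := Real.sqrt_pos.2 hWpos
    have hu2 := Real.sq_sqrt hWpos.le
    set u := Real.sqrt W
    refine ⟨congruenceCircle q (Y 0 / u) (Y 1 / u) ((Y 0 ^ 2 + Y 1 ^ 2 + Y 2 ^ 2 - q) / u),
      ⟨⟨_, _, _, ?_, rfl⟩, Y, ⟨u, ?_, ?_, ?_⟩, hY, hYz⟩, s * u, ?_, ?_, ?_⟩
    · rw [div_pow, div_pow, ← add_div, ← hW, hu2, div_self hWpos.ne']
    · field_simp
    · field_simp
    · field_simp
      linear_combination hu2
    · rw [h0]; field_simp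
    · rw [h1]; field_simp
    · field_simp
      linear_combination h2 + s ^ 2 * hu2

/-- The coefficients `(κ : ξ : η)` of the circle of the congruence through the point `Y`. -/
noncomputable def circleCoords (q : ℝ) (Y : E3) : Fin 3 → ℂ :=
  ![((Y 0 ^ 2 + Y 1 ^ 2 + Y 2 ^ 2 - q : ℝ) : ℂ), (Y 0 : ℂ), (Y 1 : ℂ)]

/-- Vanishing for all `τ` kills each coefficient of the substituted polynomial at `σ p(t)`, and
vanishing for all `σ` kills its homogeneous components at `p(t)`. These components are thus forms
vanishing on the curve, so `G` divides them. -/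
theorem C_dvd_coneSubst {p : Fin 3 → Polynomial ℂ} {G : MvPolynomial (Fin 3) ℂ} {g : ℕ}
    (hG : IsFormGenerator (toRat p) G g) {c : MvPolynomial (Fin 4) ℂ} {T : Set ℂ} (hT : T.Infinite)
    (hc : ∀ t ∈ T, ∀ τ σ : ℂ, eval ![τ, σ * (p 1).eval t, σ * (p 2).eval t,
      τ * (σ * (p 0).eval t)] c = 0) :
    Polynomial.C G ∣ coneSubst c := by
  rw [Polynomial.C_dvd_iff_dvd_coeff]
  intro k
  rw [← sum_homogeneousComponent ((coneSubst c).coeff k)]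
  refine Finset.dvd_sum fun i _ => ?_
  refine hG.dvd _ i (homogeneousComponent_isHomogeneous _ _) ?_
  rw [aeval_toRat, map_eq_zero_iff _ (IsFractionRing.injective (Polynomial ℂ) (RatFunc ℂ))]
  refine Polynomial.eq_zero_of_infinite_isRoot _ (hT.mono fun t ht => ?_)
  rw [Set.mem_ofPred_eq, Polynomial.IsRoot, eval_aeval_poly, ← aeval_eq_eval]
  refine aeval_eq_zero_homogeneousComponent (L := ℂ) (Polynomial.funext fun σ => ?_) i
  rw [eval_aeval_poly, Polynomial.eval_zero]
  simp only [Polynomial.eval_mul, Polynomial.eval_X, Polynomial.eval_C]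
  have h0 : (coneSubst c).map (eval fun i => σ * (p i).eval t) = 0 := by
    refine Polynomial.funext fun τ => ?_
    rw [eval_coneSubst, hc t ht, Polynomial.eval_zero]
  rw [← Polynomial.coeff_map, h0, Polynomial.coeff_zero]

/-- A quadratic with positive leading coefficient and discriminant is negative on an interval
starting at its vertex. Real points of the circle with `z ≠ 0` therefore exist in infinite number.
-/
theorem exists_infinite_chord_parameters {W κ q : ℝ} (hW : 0 < W) (h : 0 < κ ^ 2 + 4 * q * W) :
    {s : ℝ | s ^ 2 * W - s * κ - q < 0}.Infinite := by
  have hr : 0 < min 1 ((κ ^ 2 + 4 * q * W) / (4 * W ^ 2)) := lt_min one_pos (by positivity)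
  refine ((Set.Ioo_infinite hr).image (f := fun r => κ / (2 * W) + r)
    (fun x _ y _ h => by simpa using h)).mono ?_
  rintro _ ⟨r, ⟨hr0, hr1⟩, rfl⟩
  rw [lt_min_iff, lt_div_iff₀ (by positivity)] at hr1
  have h1 : (κ / (2 * W) + r) ^ 2 * W - (κ / (2 * W) + r) * κ - q =
      (r ^ 2 * (4 * W ^ 2) - (κ ^ 2 + 4 * q * W)) / (4 * W) := by
    field_simp
    ring
  rw [Set.mem_ofPred_eq, h1]
  refine div_neg_of_neg_of_pos ?_ (by positivity)
  have : r ^ 2 ≤ r := by nlinarith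
  nlinarith [mul_le_mul_of_nonneg_right this (by positivity : (0 : ℝ) ≤ 4 * W ^ 2)]

/-- A polynomial vanishing on the surface is written as `a + z b`. The circles are symmetric under
`z ↦ -z`, so `a` and `b` vanish separately, first at real points of the circles and then, by
polynomial continuation, on whole cones, which makes them multiples of the cone form. -/
theorem isSurfaceEquation_surfaceForm {q : ℝ} {α : Set E3} {p : Fin 3 → Polynomial ℂ}
    {G : MvPolynomial (Fin 3) ℂ} {g e : ℕ} (hG : IsFormGenerator (toRat p) G g)
    (he : degreeOf 0 G = e)
    (h1 : ∀ Y ∈ α, ∃ t ρ : ℂ, ρ ≠ 0 ∧ ∀ i, (p i).eval t = ρ * circleCoords q Y i)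
    {T : Set ℂ} (hT : T.Infinite)
    (h2 : ∀ t ∈ T, ∃ Y ∈ α, Y ∉ zAxis ∧ Y 0 ^ 2 + Y 1 ^ 2 + Y 2 ^ 2 - q ≠ -2 * q ∧
      ∃ ρ : ℂ, ρ ≠ 0 ∧ ∀ i, (p i).eval t = ρ * circleCoords q Y i) :
    IsSurfaceEquation (circularSurface q α) (surfaceForm q e G) := by
  have hGt : ∀ t, eval (fun i => (p i).eval t) G = 0 := by
    intro t
    have := hG.aeval_eq_zero
    rw [aeval_toRat, map_eq_zero_iff _ (IsFractionRing.injective (Polynomial ℂ) (RatFunc ℂ))] at this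
    rw [← eval_aeval_poly, this, Polynomial.eval_zero]
  refine le_antisymm ?_ ?_
  · intro F hF
    rw [mem_vanishingIdeal_iff] at hF
    obtain ⟨a, b, rfl⟩ := exists_aeval_sphereCoords (q : ℂ) F
    have key : ∀ t ∈ T, ∀ τ σ : ℂ, eval ![τ, σ * (p 1).eval t, σ * (p 2).eval t,
        τ * (σ * (p 0).eval t)] a = 0 ∧ eval ![τ, σ * (p 1).eval t, σ * (p 2).eval t,
        τ * (σ * (p 0).eval t)] b = 0 := by
      intro t ht
      obtain ⟨Y, hY, hYz, hYq, ρ, hρ, hp⟩ := h2 t ht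
      set W := Y 0 ^ 2 + Y 1 ^ 2 with hW
      have hWpos : 0 < W := by
        refine lt_of_le_of_ne (by positivity) fun h => hYz ?_
        constructor <;> nlinarith [sq_nonneg (Y 0), sq_nonneg (Y 1)]
      set κ := W + Y 2 ^ 2 - q with hκ
      -- The discriminant is a sum of two nonnegative terms. It vanishes only for a circle of radius
      -- zero, where `κ = -2 q`, and `hYq` excludes this.
      have hdisc : 0 < κ ^ 2 + 4 * q * W := by
        have h3 : κ ^ 2 + 4 * q * W = (κ - 2 * W) ^ 2 + 4 * W * Y 2 ^ 2 := by
          rw [hκ]; ring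
        rw [h3]
        refine lt_of_le_of_ne (by positivity) fun h4 => hYq ?_
        have h5 : κ - 2 * W = 0 := by nlinarith [sq_nonneg (κ - 2 * W), mul_nonneg hWpos.le (sq_nonneg (Y 2))]
        have h6 : Y 2 ^ 2 = 0 := by
          rw [h5] at h4
          have : W * Y 2 ^ 2 = 0 := by linarith
          exact (mul_eq_zero.1 this).resolve_left hWpos.ne'
        linarith
      have hinf := exists_infinite_chord_parameters hWpos hdisc
      -- the values of `a` and `b` at points of the circle
      have hval : ∀ τ : ℂ, τ ≠ 0 → ∀ s ∈ {s : ℝ | s ^ 2 * W - s * κ - q < 0},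
          eval ![τ, τ * s * Y 0, τ * s * Y 1, τ * (τ * s * κ)] a = 0 ∧
          eval ![τ, τ * s * Y 0, τ * s * Y 1, τ * (τ * s * κ)] b = 0 := by
        intro τ hτ s hs
        rw [Set.mem_ofPred_eq] at hs
        set z := Real.sqrt (q + s * κ - s ^ 2 * W) with hz
        have hzpos : 0 < z := Real.sqrt_pos.2 (by linarith)
        have hz2 : z ^ 2 = q + s * κ - s ^ 2 * W := Real.sq_sqrt (by linarith)
        have hpt : ∀ z' : ℝ, z' ^ 2 = z ^ 2 →
            eval ![τ, τ * s * Y 0, τ * s * Y 1, τ * (τ * s * κ)] a + τ * z' *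
              eval ![τ, τ * s * Y 0, τ * s * Y 1, τ * (τ * s * κ)] b = 0 := by
          intro z' hz'
          have hmem := hF (τ • homog !₂[s * Y 0, s * Y 1, z']) ⟨τ, _, mem_circularSurface_iff.2
            ⟨Y, hY, hYz, s, by simp, by simp, by
              simp only [Matrix.cons_val]
              rw [hz', hz2]
              ring⟩, rfl⟩
          have hcoord : ∀ c : MvPolynomial (Fin 4) ℂ,
              eval (τ • homog !₂[s * Y 0, s * Y 1, z']) (aeval (sphereCoords q) c) =
              eval ![τ, τ * s * Y 0, τ * s * Y 1, τ * (τ * s * κ)] c := by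
            intro c
            rw [← aeval_eq_eval, comp_aeval_apply, ← aeval_eq_eval]
            congr 2
            have hz2' : (z' : ℂ) ^ 2 = q + s * κ - s ^ 2 * W := by
              rw [← hz'] at hz2
              exact_mod_cast hz2
            ext i
            fin_cases i
            · simp [sphereCoords, homog]
            · simp [sphereCoords, homog, mul_assoc]
            · simp [sphereCoords, homog, mul_assoc]
            · simp [sphereCoords, homog, mul_assoc]
              simp [hW] at hz2'
              linear_combination τ ^ 2 * hz2'
          rw [aeval_eq_eval, map_add, map_mul, hcoord, hcoord, eval_X] at hmem
          simpa [homog] using hmem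
        -- The points with heights `z` and `-z` are both on the surface; half the sum and half the
        -- difference separate `a` from `b`.
        have h3 := hpt z rfl
        have h4 := hpt (-z) (by ring)
        push_cast at h4
        refine ⟨by linear_combination (h3 + h4) / 2, ?_⟩
        have h5 : (τ * z) * eval ![τ, τ * s * Y 0, τ * s * Y 1, τ * (τ * s * κ)] b = 0 := by
          linear_combination (h3 - h4) / 2
        refine (mul_eq_zero.1 h5).resolve_left (mul_ne_zero hτ ?_)
        exact_mod_cast hzpos.ne'
      -- extension to all parameters
      have hall : ∀ c : MvPolynomial (Fin 4) ℂ, (∀ τ : ℂ, τ ≠ 0 →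
          ∀ s ∈ {s : ℝ | s ^ 2 * W - s * κ - q < 0},
          eval ![τ, τ * s * Y 0, τ * s * Y 1, τ * (τ * s * κ)] c = 0) →
          ∀ τ σ : ℂ, eval ![τ, σ * (p 1).eval t, σ * (p 2).eval t, τ * (σ * (p 0).eval t)] c = 0 := by
        intro c hc τ σ
        have h6 : ∀ τ : ℂ, τ ≠ 0 → ∀ σ : ℂ, eval ![τ, σ * (p 1).eval t, σ * (p 2).eval t,
            τ * (σ * (p 0).eval t)] c = 0 := by
          intro τ hτ σ
          set P : Polynomial ℂ := aeval ![Polynomial.C τ, Polynomial.X * Polynomial.C (τ * Y 0),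
            Polynomial.X * Polynomial.C (τ * Y 1), Polynomial.X * Polynomial.C (τ * (τ * κ))] c
            with hP
          have hPe : ∀ s : ℂ, P.eval s =
              eval ![τ, τ * s * Y 0, τ * s * Y 1, τ * (τ * s * κ)] c := by
            intro s
            rw [hP, eval_aeval_poly]
            congr 2
            ext i
            fin_cases i <;> simp <;> ring
          have hP0 : P = 0 := by
            refine Polynomial.eq_zero_of_infinite_isRoot _
              ((hinf.image (f := fun s : ℝ => (s : ℂ)) (Complex.ofReal_injective.injOn)).mono ?_)
            rintro _ ⟨s, hs, rfl⟩
            rw [Set.mem_ofPred_eq, Polynomial.IsRoot, hPe]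
            exact hc τ hτ s hs
          -- This complex value of `s` turns `τ s (κ, ξ, η)` into `σ p(t)`.
          have h7 := hPe (σ * ρ / τ)
          rw [hP0, Polynomial.eval_zero] at h7
          rw [h7, hp 0, hp 1, hp 2]
          congr 2
          have hκ' : circleCoords q Y 0 = κ := rfl
          have h1' : circleCoords q Y 1 = Y 0 := rfl
          have h2' : circleCoords q Y 2 = Y 1 := rfl
          rw [hκ', h1', h2']
          ext i
          fin_cases i <;> simp [hτ] <;> field_simp
        -- The excluded value `τ = 0` is recovered by continuation in `τ`.
        set P : Polynomial ℂ := aeval ![Polynomial.X, Polynomial.C (σ * (p 1).eval t),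
            Polynomial.C (σ * (p 2).eval t), Polynomial.X * Polynomial.C (σ * (p 0).eval t)] c with hP
        have hPe : ∀ τ : ℂ, P.eval τ = eval ![τ, σ * (p 1).eval t, σ * (p 2).eval t,
            τ * (σ * (p 0).eval t)] c := by
          intro s
          rw [hP, eval_aeval_poly]
          congr 2
          ext i
          fin_cases i <;> simp
        rw [← hPe]
        have hP0 : P = 0 := by
          refine Polynomial.eq_zero_of_infinite_isRoot _
            ((Set.finite_singleton (0 : ℂ)).infinite_compl.mono fun τ hτ => ?_)
          rw [Set.mem_ofPred_eq, Polynomial.IsRoot, hPe]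
          exact h6 τ hτ σ
        rw [hP0, Polynomial.eval_zero]
      exact fun τ σ => ⟨hall a (fun τ hτ s hs => (hval τ hτ s hs).1) τ σ,
        hall b (fun τ hτ s hs => (hval τ hτ s hs).2) τ σ⟩
    have hdvd : ∀ c : MvPolynomial (Fin 4) ℂ, (∀ t ∈ T, ∀ τ σ : ℂ, eval ![τ, σ * (p 1).eval t,
        σ * (p 2).eval t, τ * (σ * (p 0).eval t)] c = 0) →
        surfaceForm q e G ∣ aeval (sphereCoords q) c := fun c hc =>
      map_dvd (aeval (sphereCoords q)) (coneForm_dvd_of_C_dvd hG.ne_zero he (C_dvd_coneSubst hG hT hc))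
    rw [Ideal.mem_span_singleton]
    exact dvd_add (hdvd a fun t ht τ σ => (key t ht τ σ).1)
      (Dvd.dvd.mul_left (hdvd b fun t ht τ σ => (key t ht τ σ).2) _)
  · rw [Ideal.span_singleton_le_iff_mem, mem_vanishingIdeal_iff]
    rintro _ ⟨τ, Z, hZ, rfl⟩
    obtain ⟨Y, hY, hYz, s, hs0, hs1, hs2⟩ := mem_circularSurface_iff.1 hZ
    obtain ⟨t, ρ, hρ, hp⟩ := h1 Y hY
    have hGY : aeval ![circleCoords q Y 0, circleCoords q Y 1, circleCoords q Y 2] G = 0 := by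
      have h3 := hGt t
      simp only [hp] at h3
      rw [← aeval_eq_eval, aeval_smul_of_isHomogeneous hG.isHomogeneous] at h3
      have h4 := (mul_eq_zero.1 h3).resolve_left (pow_ne_zero _ hρ)
      rw [← h4]
      congr 2
    rw [aeval_eq_eval, eval_surfaceForm]
    have h5 : aeval ![τ, τ * s * circleCoords q Y 1, τ * s * circleCoords q Y 2,
        τ * (τ * s * circleCoords q Y 0)] (coneForm e G) = 0 := by
      rw [coneForm_mul he.le]
      have h6 := aeval_smul_of_isHomogeneous hG.isHomogeneous (τ * s)
        ![circleCoords q Y 0, circleCoords q Y 1, circleCoords q Y 2]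
      rw [hGY, mul_zero] at h6
      have h7 : (fun i => τ * s * ![circleCoords q Y 0, circleCoords q Y 1, circleCoords q Y 2] i) =
          ![τ * s * circleCoords q Y 0, τ * s * circleCoords q Y 1, τ * s * circleCoords q Y 2] := by
        ext i; fin_cases i <;> rfl
      rw [h7] at h6
      rw [h6, mul_zero]
    rw [← h5]
    congr 2
    have hs2' : (s : ℂ) ^ 2 * (Y 0 ^ 2 + Y 1 ^ 2) + Z 2 ^ 2 - q =
      s * (Y 0 ^ 2 + Y 1 ^ 2 + Y 2 ^ 2 - q) := by exact_mod_cast hs2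
    ext i
    fin_cases i
    · simp [homog]
    · simp [homog, circleCoords, hs0, mul_assoc]
    · simp [homog, circleCoords, hs1, mul_assoc]
    · simp [homog, circleCoords, hs0, hs1]
      linear_combination τ ^ 2 * hs2'

/-! ### Coordinates of the circles in the plane of a curve -/

/-- Affine functions `ξ, η` and a function `κ` whose quadratic part is `x ^ 2 + y ^ 2` on the
Euclidean plane: the homogeneous coordinates `(κ : ξ : η)` of the circle of the congruence through
a point of a plane that does not contain the axis. -/
structure CirclePlane where
  (a₀ a₁ a₂ b₀ b₁ b₂ c₀ c₁ c₂ : ℝ)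
  nonconstant : ¬ (a₀ = 0 ∧ a₁ = 0 ∧ b₀ = 0 ∧ b₁ = 0)
  det_ne_zero : ∀ x y : ℝ, a₀ * x + a₁ * y + a₂ = 0 → b₀ * x + b₁ * y + b₂ = 0 →
    a₀ * b₁ - a₁ * b₀ ≠ 0

namespace CirclePlane

variable (S : CirclePlane) {B : Type*} [CommRing B] [Algebra ℂ B]

/-- The form `ξ` in homogeneous coordinates `(w : x : y)`. -/
noncomputable def xi (w x y : B) : B :=
  algebraMap ℂ B S.a₀ * x + algebraMap ℂ B S.a₁ * y + algebraMap ℂ B S.a₂ * w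

/-- The form `η` in homogeneous coordinates `(w : x : y)`. -/
noncomputable def eta (w x y : B) : B :=
  algebraMap ℂ B S.b₀ * x + algebraMap ℂ B S.b₁ * y + algebraMap ℂ B S.b₂ * w

/-- The quadratic form `κ` in homogeneous coordinates `(w : x : y)`. -/
noncomputable def kappa (w x y : B) : B :=
  x ^ 2 + y ^ 2 + w * (algebraMap ℂ B S.c₀ * x + algebraMap ℂ B S.c₁ * y + algebraMap ℂ B S.c₂ * w)

/-- The triple `(κ, ξ, η)` in affine coordinates. -/
noncomputable def triple (x y : B) : Fin 3 → B := ![S.kappa 1 x y, S.xi 1 x y, S.eta 1 x y]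

/-- The imaginary parts of a common zero solve a real homogeneous system with nonzero determinant.
-/
theorem exists_real_zero {x y : ℂ} (hx : S.xi 1 x y = 0) (hy : S.eta 1 x y = 0) :
    ∃ x' y' : ℝ, x = x' ∧ y = y' ∧ S.a₀ * x' + S.a₁ * y' + S.a₂ = 0 ∧
      S.b₀ * x' + S.b₁ * y' + S.b₂ = 0 ∧ S.a₀ * S.b₁ - S.a₁ * S.b₀ ≠ 0 := by
  simp only [xi, eta, mul_one] at hx hy
  have h1 := congrArg Complex.re hx
  have h2 := congrArg Complex.im hx
  have h3 := congrArg Complex.re hy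
  have h4 := congrArg Complex.im hy
  simp at h1 h2 h3 h4
  have hΔ := S.det_ne_zero _ _ h1 h3
  have hx0 : x.im = 0 := by
    have : (S.a₀ * S.b₁ - S.a₁ * S.b₀) * x.im = 0 := by linear_combination S.b₁ * h2 - S.a₁ * h4
    exact (mul_eq_zero.1 this).resolve_left hΔ
  have hy0 : y.im = 0 := by
    have : (S.a₀ * S.b₁ - S.a₁ * S.b₀) * y.im = 0 := by linear_combination S.a₀ * h4 - S.b₀ * h2
    exact (mul_eq_zero.1 this).resolve_left hΔ
  exact ⟨x.re, y.re, Complex.ext rfl (by simpa using hx0), Complex.ext rfl (by simpa using hy0),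
    h1, h3, hΔ⟩

/-- If `ξ` and `η` were proportional, a zero of the nonconstant one would be a common zero with
vanishing determinant. -/
theorem real_independent {b c : ℝ} (h0 : b * S.a₀ + c * S.b₀ = 0) (h1 : b * S.a₁ + c * S.b₁ = 0)
    (h2 : b * S.a₂ + c * S.b₂ = 0) : b = 0 ∧ c = 0 := by
  by_contra hbc
  have hΔ : S.a₀ * S.b₁ - S.a₁ * S.b₀ = 0 := by
    have hb : b * (S.a₀ * S.b₁ - S.a₁ * S.b₀) = 0 := by linear_combination S.b₁ * h0 - S.b₀ * h1
    have hc : c * (S.a₀ * S.b₁ - S.a₁ * S.b₀) = 0 := by linear_combination S.a₀ * h1 - S.a₁ * h0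
    by_contra hne
    exact hbc ⟨(mul_eq_zero.1 hb).resolve_right hne, (mul_eq_zero.1 hc).resolve_right hne⟩
  have key : ∀ u v w u' v' w' k : ℝ, u' = k * u → v' = k * v → w' = k * w → ¬ (u = 0 ∧ v = 0) →
      ∃ x y : ℝ, u * x + v * y + w = 0 ∧ u' * x + v' * y + w' = 0 := by
    intro u v w u' v' w' k hu hv hw huv
    rw [hu, hv, hw]
    by_cases h : u = 0
    · have hv0 : v ≠ 0 := fun h' => huv ⟨h, h'⟩
      exact ⟨0, -w / v, by field_simp; ring, by field_simp; ring⟩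
    · exact ⟨-w / u, 0, by field_simp; ring, by field_simp; ring⟩
  by_cases hc : c = 0
  · have hb : b ≠ 0 := fun h => hbc ⟨h, hc⟩
    obtain ⟨x, y, h3, h4⟩ := key S.b₀ S.b₁ S.b₂ S.a₀ S.a₁ S.a₂ (-c / b)
      (by field_simp; linear_combination h0) (by field_simp; linear_combination h1)
      (by field_simp; linear_combination h2) (by
        rintro ⟨hu, hv⟩
        rw [hu] at h0; rw [hv] at h1
        refine S.nonconstant ⟨?_, ?_, hu, hv⟩
        · simpa [hb] using h0
        · simpa [hb] using h1)
    exact S.det_ne_zero x y h4 h3 hΔ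
  · obtain ⟨x, y, h3, h4⟩ := key S.a₀ S.a₁ S.a₂ S.b₀ S.b₁ S.b₂ (-b / c)
      (by field_simp; linear_combination h0) (by field_simp; linear_combination h1)
      (by field_simp; linear_combination h2) (by
        rintro ⟨hu, hv⟩
        rw [hu] at h0; rw [hv] at h1
        refine S.nonconstant ⟨hu, hv, ?_, ?_⟩
        · simpa [hc] using h0
        · simpa [hc] using h1)
    exact S.det_ne_zero x y h3 h4 hΔ

theorem independent {b c : ℂ} (h0 : b * S.a₀ + c * S.b₀ = 0) (h1 : b * S.a₁ + c * S.b₁ = 0)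
    (h2 : b * S.a₂ + c * S.b₂ = 0) : b = 0 ∧ c = 0 := by
  have hre := S.real_independent (b := b.re) (c := c.re) (by simpa using congrArg Complex.re h0)
    (by simpa using congrArg Complex.re h1) (by simpa using congrArg Complex.re h2)
  have him := S.real_independent (b := b.im) (c := c.im) (by simpa using congrArg Complex.im h0)
    (by simpa using congrArg Complex.im h1) (by simpa using congrArg Complex.im h2)
  exact ⟨Complex.ext hre.1 him.1, Complex.ext hre.2 him.2⟩

end CirclePlane

/-- The hypothesis on the plane enters through the determinant: if `ξ` and `η` had a common zero and
dependent linear parts, the plane would contain a vertical direction through a point of the axis,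
hence the axis. -/
theorem exists_circlePlane (q : ℝ) (ι : E2 →ᵃⁱ[ℝ] E3) (hι : ¬ zAxis ⊆ Set.range ι) :
    ∃ S : CirclePlane, ∀ Q : E2, circleCoords q (ι Q) = S.triple (Q 0 : ℂ) (Q 1) := by
  set L := ι.linearIsometry with hL
  set u := L !₂[1, 0] with hu
  set v := L !₂[0, 1] with hv
  have hLQ : ∀ (Q : E2) (i : Fin 3), L Q i = u i * Q 0 + v i * Q 1 := by
    intro Q i
    have hQ : Q = Q 0 • (!₂[1, 0] : E2) + Q 1 • (!₂[0, 1] : E2) := by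
      ext i; fin_cases i <;> simp
    conv_lhs => rw [hQ]
    rw [map_add, map_smul, map_smul]
    simp [hu, hv, mul_comm]
  have hιQ : ∀ (Q : E2) (i : Fin 3), ι Q i = u i * Q 0 + v i * Q 1 + ι 0 i := by
    intro Q i
    have : ι Q = L Q + ι 0 := by
      have := ι.map_vadd 0 Q
      simpa using this
    rw [this, PiLp.add_apply, hLQ]
  have hnorm : ∀ Q : E2, L Q 0 ^ 2 + L Q 1 ^ 2 + L Q 2 ^ 2 = Q 0 ^ 2 + Q 1 ^ 2 := by
    intro Q
    have h1 := EuclideanSpace.real_norm_sq_eq (L Q)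
    have h2 := EuclideanSpace.real_norm_sq_eq Q
    rw [L.norm_map, h2, Fin.sum_univ_three, Fin.sum_univ_two] at h1
    exact h1.symm
  have hzero : ∀ x y : ℝ, u 0 * x + v 0 * y = 0 → u 1 * x + v 1 * y = 0 → u 2 * x + v 2 * y = 0 →
      x = 0 ∧ y = 0 := by
    intro x y h0 h1 h2
    have := hnorm !₂[x, y]
    simp only [hLQ, Matrix.cons_val_zero, Matrix.cons_val_one, h0, h1, h2] at this
    constructor <;> nlinarith [sq_nonneg x, sq_nonneg y]
  refine ⟨⟨u 0, v 0, ι 0 0, u 1, v 1, ι 0 1, 2 * (u 0 * ι 0 0 + u 1 * ι 0 1 + u 2 * ι 0 2),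
    2 * (v 0 * ι 0 0 + v 1 * ι 0 1 + v 2 * ι 0 2), ι 0 0 ^ 2 + ι 0 1 ^ 2 + ι 0 2 ^ 2 - q, ?_, ?_⟩, ?_⟩
  · rintro ⟨h1, h2, h3, h4⟩
    -- If `ξ` and `η` were constant, `u` and `v` would both be vertical, so `-v 2 • u + u 2 • v = 0`
    -- against their independence.
    obtain ⟨h5, h6⟩ := hzero (-v 2) (u 2) (by simp [h1, h2]) (by simp [h3, h4]) (by ring)
    have := hzero 1 0 (by simp [h1]) (by simp [h3]) (by simp [h6])
    simp at this
  · intro x y hx hy hΔ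
    obtain ⟨w, hw0, hw⟩ := Matrix.exists_mulVec_eq_zero_iff.2
      (show (!![u 0, v 0; u 1, v 1] : Matrix (Fin 2) (Fin 2) ℝ).det = 0 by
        rw [Matrix.det_fin_two_of]; exact hΔ)
    have hw1 : u 0 * w 0 + v 0 * w 1 = 0 := by
      simpa [Matrix.mulVec, dotProduct, Fin.sum_univ_two] using congrFun hw 0
    have hw2 : u 1 * w 0 + v 1 * w 1 = 0 := by
      simpa [Matrix.mulVec, dotProduct, Fin.sum_univ_two] using congrFun hw 1
    have hw3 : u 2 * w 0 + v 2 * w 1 ≠ 0 := by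
      intro h
      obtain ⟨h1, h2⟩ := hzero _ _ hw1 hw2 h
      exact hw0 (by ext i; fin_cases i <;> assumption)
    apply hι
    rintro X ⟨hX0, hX1⟩
    set s := (X 2 - (u 2 * x + v 2 * y + ι 0 2)) / (u 2 * w 0 + v 2 * w 1) with hs
    have hs' : s * (u 2 * w 0 + v 2 * w 1) = X 2 - (u 2 * x + v 2 * y + ι 0 2) :=
      div_mul_cancel₀ _ hw3
    refine ⟨!₂[x + s * w 0, y + s * w 1], ?_⟩
    ext i
    rw [hιQ]
    fin_cases i
    · simp [hX0]
      linear_combination hx + s * hw1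
    · simp [hX1]
      linear_combination hy + s * hw2
    · simp
      linear_combination hs'
  · intro Q
    have h0 := hnorm Q
    rw [hLQ Q 0, hLQ Q 1, hLQ Q 2] at h0
    have e0 := hιQ Q 0
    have e1 := hιQ Q 1
    have e2 := hιQ Q 2
    ext i
    fin_cases i
    · simp only [circleCoords, CirclePlane.triple, CirclePlane.kappa, e0, e1, e2, Fin.zero_eta,
        Matrix.cons_val_zero, Algebra.algebraMap_self, RingHom.id_apply, one_mul, mul_one]
      norm_cast
      linear_combination h0
    · simp [circleCoords, CirclePlane.triple, CirclePlane.xi, e0]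
    · simp [circleCoords, CirclePlane.triple, CirclePlane.eta, e1]

/-! ### The second point of a circle in the plane of the curve -/

namespace CirclePlane

variable (S : CirclePlane)

section Ring

variable {B B' : Type*} [CommRing B] [Algebra ℂ B] [CommRing B'] [Algebra ℂ B']

/-- The first coordinate of `η α - ξ β`, the direction normal to the line of the points of the plane
with given `ξ : η`. -/
noncomputable def normalX (x y : B) : B :=
  algebraMap ℂ B S.a₀ * S.eta 1 x y - algebraMap ℂ B S.b₀ * S.xi 1 x y

/-- The second coordinate of `η α - ξ β`. -/
noncomputable def normalY (x y : B) : B :=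
  algebraMap ℂ B S.a₁ * S.eta 1 x y - algebraMap ℂ B S.b₁ * S.xi 1 x y

/-- The square of the length of `η α - ξ β`. -/
noncomputable def normalSq (x y : B) : B := S.normalX x y ^ 2 + S.normalY x y ^ 2

/-- The numerator of the displacement between the two points of a circle in the plane. -/
noncomputable def chord (x y : B) : B :=
  2 * (y * S.normalX x y - x * S.normalY x y) +
    (algebraMap ℂ B S.c₁ * S.normalX x y - algebraMap ℂ B S.c₀ * S.normalY x y) +
    algebraMap ℂ B (S.a₁ * S.b₀ - S.a₀ * S.b₁) * S.kappa 1 x y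

/-- `normalSq` times the first coordinate of the second point of a circle in the plane. -/
noncomputable def conjX (x y : B) : B := x * S.normalSq x y + S.chord x y * S.normalY x y

/-- `normalSq` times the second coordinate of the second point of a circle in the plane. -/
noncomputable def conjY (x y : B) : B := y * S.normalSq x y - S.chord x y * S.normalX x y

theorem map_xi (φ : B →ₐ[ℂ] B') (w x y : B) : φ (S.xi w x y) = S.xi (φ w) (φ x) (φ y) := by
  simp [xi]

theorem map_eta (φ : B →ₐ[ℂ] B') (w x y : B) : φ (S.eta w x y) = S.eta (φ w) (φ x) (φ y) := by
  simp [eta]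

theorem map_kappa (φ : B →ₐ[ℂ] B') (w x y : B) : φ (S.kappa w x y) = S.kappa (φ w) (φ x) (φ y) := by
  simp [kappa]

theorem map_normalX (φ : B →ₐ[ℂ] B') (x y : B) : φ (S.normalX x y) = S.normalX (φ x) (φ y) := by
  simp [normalX, map_xi, map_eta]

theorem map_normalY (φ : B →ₐ[ℂ] B') (x y : B) : φ (S.normalY x y) = S.normalY (φ x) (φ y) := by
  simp [normalY, map_xi, map_eta]

theorem map_normalSq (φ : B →ₐ[ℂ] B') (x y : B) : φ (S.normalSq x y) = S.normalSq (φ x) (φ y) := by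
  simp [normalSq, map_normalX, map_normalY]

theorem map_chord (φ : B →ₐ[ℂ] B') (x y : B) : φ (S.chord x y) = S.chord (φ x) (φ y) := by
  simp [chord, map_normalX, map_normalY, map_kappa, map_ofNat φ 2]

theorem map_conjX (φ : B →ₐ[ℂ] B') (x y : B) : φ (S.conjX x y) = S.conjX (φ x) (φ y) := by
  simp [conjX, map_normalSq, map_normalY, map_chord]

theorem map_conjY (φ : B →ₐ[ℂ] B') (x y : B) : φ (S.conjY x y) = S.conjY (φ x) (φ y) := by
  simp [conjY, map_normalSq, map_normalX, map_chord]

end Ring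

section Field

variable {B : Type*} [Field B] [Algebra ℂ B]

/-- The points with the given `ξ : η` form a line perpendicular to the normal. Along it, requiring
`κ` to stay proportional is a quadratic condition on the displacement with roots `0` and `chord /
normalSq`. -/
theorem triple_conj {x y : B} (h : S.normalSq x y ≠ 0) :
    S.triple (S.conjX x y / S.normalSq x y) (S.conjY x y / S.normalSq x y) =
      (1 + S.chord x y / S.normalSq x y * algebraMap ℂ B (S.a₁ * S.b₀ - S.a₀ * S.b₁)) •
        S.triple x y := by
  have hx : S.conjX x y / S.normalSq x y = x + S.chord x y / S.normalSq x y * S.normalY x y := by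
    rw [conjX]; field_simp
  have hy : S.conjY x y / S.normalSq x y = y - S.chord x y / S.normalSq x y * S.normalX x y := by
    rw [conjY]; field_simp
  rw [hx, hy]
  have hs : S.chord x y / S.normalSq x y * S.normalSq x y = S.chord x y := div_mul_cancel₀ _ h
  generalize S.chord x y / S.normalSq x y = s at hs
  ext i
  fin_cases i
  · simp only [triple, Fin.zero_eta, Matrix.cons_val_zero, Pi.smul_apply, smul_eq_mul]
    have e : S.kappa 1 (x + s * S.normalY x y) (y - s * S.normalX x y) - (1 + s * algebraMap ℂ B
        (S.a₁ * S.b₀ - S.a₀ * S.b₁)) * S.kappa 1 x y = s * (s * S.normalSq x y - S.chord x y) := by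
      simp only [chord, normalSq, kappa]
      ring
    rw [hs, sub_self, mul_zero, sub_eq_zero] at e
    exact e
  · simp only [triple, Fin.mk_one, Matrix.cons_val_one, Matrix.cons_val_zero, Pi.smul_apply,
      smul_eq_mul, normalX, normalY, xi, eta, map_sub, map_mul]
    ring
  · simp only [triple, Fin.reduceFinMk, Matrix.cons_val, Pi.smul_apply,
      smul_eq_mul, normalX, normalY, xi, eta, map_sub, map_mul]
    ring

/-- A circle meets the plane in at most two points off the axis. -/
theorem eq_or_eq_conj {x y x' y' l : B} (h : S.normalSq x y ≠ 0)
    (h' : S.triple x' y' = l • S.triple x y) :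
    (x' = x ∧ y' = y) ∨
      (x' = S.conjX x y / S.normalSq x y ∧ y' = S.conjY x y / S.normalSq x y) := by
  have hκ : S.kappa 1 x' y' = l * S.kappa 1 x y := congrFun h' 0
  have hξ : S.xi 1 x' y' = l * S.xi 1 x y := congrFun h' 1
  have hη : S.eta 1 x' y' = l * S.eta 1 x y := congrFun h' 2
  -- Equal ratios `ξ : η` mean that the displacement is perpendicular to `η α - ξ β`.
  have horth : S.normalX x y * (x' - x) + S.normalY x y * (y' - y) = 0 := by
    have e1 : S.normalX x y * (x' - x) + S.normalY x y * (y' - y) =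
        S.eta 1 x y * (S.xi 1 x' y' - S.xi 1 x y) - S.xi 1 x y * (S.eta 1 x' y' - S.eta 1 x y) := by
      simp only [normalX, normalY, xi, eta]
      ring
    rw [e1, hξ, hη]
    ring
  set s := (S.normalY x y * (x' - x) - S.normalX x y * (y' - y)) / S.normalSq x y with hs
  have hs' : s * S.normalSq x y = S.normalY x y * (x' - x) - S.normalX x y * (y' - y) :=
    div_mul_cancel₀ _ h
  have hx : x' = x + s * S.normalY x y := by
    have : S.normalSq x y * (x' - x - s * S.normalY x y) = 0 := by
      rw [normalSq] at hs' ⊢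
      linear_combination S.normalX x y * horth - S.normalY x y * hs'
    linear_combination (mul_eq_zero.1 this).resolve_left h
  have hy : y' = y - s * S.normalX x y := by
    have : S.normalSq x y * (y' - y + s * S.normalX x y) = 0 := by
      rw [normalSq] at hs' ⊢
      linear_combination S.normalY x y * horth + S.normalX x y * hs'
    linear_combination (mul_eq_zero.1 this).resolve_left h
  have hl : l = 1 + s * algebraMap ℂ B (S.a₁ * S.b₀ - S.a₀ * S.b₁) := by
    have e1 : S.xi 1 x y * (l - (1 + s * algebraMap ℂ B (S.a₁ * S.b₀ - S.a₀ * S.b₁))) = 0 := by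
      have : S.xi 1 (x + s * S.normalY x y) (y - s * S.normalX x y) =
          S.xi 1 x y * (1 + s * algebraMap ℂ B (S.a₁ * S.b₀ - S.a₀ * S.b₁)) := by
        simp only [normalX, normalY, xi, eta, map_sub, map_mul]
        ring
      rw [← hx, ← hy, hξ] at this
      linear_combination this
    have e2 : S.eta 1 x y * (l - (1 + s * algebraMap ℂ B (S.a₁ * S.b₀ - S.a₀ * S.b₁))) = 0 := by
      have : S.eta 1 (x + s * S.normalY x y) (y - s * S.normalX x y) =
          S.eta 1 x y * (1 + s * algebraMap ℂ B (S.a₁ * S.b₀ - S.a₀ * S.b₁)) := by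
        simp only [normalX, normalY, xi, eta, map_sub, map_mul]
        ring
      rw [← hx, ← hy, hη] at this
      linear_combination this
    by_contra hne
    have hne' := sub_ne_zero.2 hne
    apply h
    rw [normalSq, normalX, normalY, (mul_eq_zero.1 e1).resolve_right hne',
      (mul_eq_zero.1 e2).resolve_right hne']
    ring
  have hfin : s * (s * S.normalSq x y - S.chord x y) = 0 := by
    have : S.kappa 1 (x + s * S.normalY x y) (y - s * S.normalX x y) - (1 + s * algebraMap ℂ B
        (S.a₁ * S.b₀ - S.a₀ * S.b₁)) * S.kappa 1 x y = s * (s * S.normalSq x y - S.chord x y) := by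
      simp only [chord, normalSq, kappa]
      ring
    rw [← hx, ← hy, ← hl, hκ, sub_self] at this
    exact this.symm
  rcases mul_eq_zero.1 hfin with h0 | h0
  · left
    rw [hx, hy, h0]
    simp
  · right
    have : s = S.chord x y / S.normalSq x y := by
      field_simp
      linear_combination h0
    constructor
    · rw [hx, this, conjX]; field_simp
    · rw [hy, this, conjY]; field_simp

end Field

theorem conj_real (x y : ℝ) : ∃ x' y' : ℝ, S.conjX (x : ℂ) y / S.normalSq (x : ℂ) y = x' ∧
    S.conjY (x : ℂ) y / S.normalSq (x : ℂ) y = y' := by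
  have h1 : (starRingEnd ℂ) (S.conjX (x : ℂ) y / S.normalSq (x : ℂ) y) =
      S.conjX (x : ℂ) y / S.normalSq (x : ℂ) y := by
    simp [conjX, normalSq, chord, normalX, normalY, xi, eta, kappa, map_ofNat (starRingEnd ℂ) 2]
  have h2 : (starRingEnd ℂ) (S.conjY (x : ℂ) y / S.normalSq (x : ℂ) y) =
      S.conjY (x : ℂ) y / S.normalSq (x : ℂ) y := by
    simp [conjY, normalSq, chord, normalX, normalY, xi, eta, kappa, map_ofNat (starRingEnd ℂ) 2]
  obtain ⟨x', hx'⟩ := Complex.conj_eq_iff_real.1 h1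
  obtain ⟨y', hy'⟩ := Complex.conj_eq_iff_real.1 h2
  exact ⟨x', y', hx', hy'⟩

end CirclePlane

/-! ### Quadratic extensions -/

section Quadratic

variable {K : Type} [Field K] [Algebra ℂ K] {E : IntermediateField ℂ K} {θ : K}

theorem minpoly_of_quadratic {b c : E} (h : θ ^ 2 + b * θ + c = 0) (hθ : θ ∉ E) :
    minpoly E θ = Polynomial.X ^ 2 + Polynomial.C b * Polynomial.X + Polynomial.C c := by
  set P : Polynomial E :=
    Polynomial.X ^ 2 + Polynomial.C b * Polynomial.X + Polynomial.C c with hP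
  have hdeg : P.natDegree = 2 := by
    have := Polynomial.natDegree_quadratic (a := (1 : E)) (b := b) (c := c) one_ne_zero
    rwa [Polynomial.C_1, one_mul] at this
  have hmonic : P.Monic := by
    rw [Polynomial.Monic, Polynomial.leadingCoeff, hdeg]
    simp [hP]
  have hroot : Polynomial.aeval θ P = 0 := by
    simpa [hP, IntermediateField.algebraMap_apply] using h
  have hint : IsIntegral E θ := ⟨P, hmonic, hroot⟩
  refine (Polynomial.eq_of_monic_of_dvd_of_natDegree_le (minpoly.monic hint) hmonic
    (minpoly.dvd _ _ hroot) ?_).symm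
  rw [hdeg, minpoly.two_le_natDegree_iff hint]
  rintro ⟨x, rfl⟩
  exact hθ x.2

theorem finrank_adjoin_of_quadratic {b c : E} (h : θ ^ 2 + b * θ + c = 0) (hθ : θ ∉ E) :
    finrank E E⟮θ⟯ = 2 := by
  have hm := minpoly_of_quadratic h hθ
  have hdeg : (Polynomial.X ^ 2 + Polynomial.C b * Polynomial.X + Polynomial.C c).natDegree = 2 := by
    simpa using Polynomial.natDegree_quadratic (a := (1 : E)) (b := b) (c := c) one_ne_zero
  have hint : IsIntegral E θ := by
    by_contra hint
    rw [minpoly.eq_zero hint] at hm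
    rw [← hm] at hdeg
    simp at hdeg
  rw [adjoin.finrank hint, hm, hdeg]

/-- The other root `-b - θ` is a conjugate of `θ`: a polynomial over `E` vanishing at `θ` is
divisible by the minimal polynomial and so vanishes at both roots. -/
theorem aeval_conj_eq_zero {b c : E} (h : θ ^ 2 + b * θ + c = 0) (hθ : θ ∉ E) (u v : Fin 2 → E)
    {f : MvPolynomial (Fin 2) ℂ} (hf : aeval (fun i => (u i : K) + θ * v i) f = 0) :
    aeval (fun i => (u i : K) + (-b - θ) * v i) f = 0 := by
  set F : Polynomial E := aeval (fun i => Polynomial.C (u i) + Polynomial.X * Polynomial.C (v i)) f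
    with hF
  have hFe : ∀ ψ : K, Polynomial.aeval ψ F = aeval (fun i => (u i : K) + ψ * v i) f := by
    intro ψ
    rw [hF]
    have := comp_aeval_apply (f := fun i => Polynomial.C (u i) + Polynomial.X * Polynomial.C (v i))
      ((Polynomial.aeval ψ : Polynomial E →ₐ[E] K).restrictScalars ℂ) f
    simp only [AlgHom.restrictScalars_apply] at this
    rw [this]
    simp [IntermediateField.algebraMap_apply, -Polynomial.X_mul_C]
  obtain ⟨F', hF'⟩ := minpoly.dvd E θ ((hFe θ).trans hf)
  rw [← hFe, hF', map_mul, minpoly_of_quadratic h hθ]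
  have : Polynomial.aeval (-b - θ : K)
      (Polynomial.X ^ 2 + Polynomial.C b * Polynomial.X + Polynomial.C c) = 0 := by
    simp [IntermediateField.algebraMap_apply]
    linear_combination h
  rw [this, zero_mul]

end Quadratic

namespace CirclePlane

variable (S : CirclePlane)

/-- The generic point of a curve satisfies a quadratic equation over the field of the coordinates of
its circle; the second root gives the second point of the circle. -/
theorem exists_quadratic {K : Type} [Field K] [Algebra ℂ K] {E : IntermediateField ℂ K} {x y : K}
    (hη : S.eta 1 x y ≠ 0) (hN : S.normalSq x y ≠ 0) (hξE : S.xi 1 x y / S.eta 1 x y ∈ E)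
    (hκE : S.kappa 1 x y / S.eta 1 x y ∈ E) :
    ∃ (θ : K) (u v : Fin 2 → E) (b c : E), x = u 0 + θ * v 0 ∧ y = u 1 + θ * v 1 ∧ v ≠ 0 ∧
      θ ^ 2 + b * θ + c = 0 ∧
      S.conjX x y / S.normalSq x y = u 0 + (-b - θ) * v 0 ∧
      S.conjY x y / S.normalSq x y = u 1 + (-b - θ) * v 1 ∧
      S.chord x y / S.normalSq x y * S.eta 1 x y = b + 2 * θ := by
  set ρ : E := ⟨_, hξE⟩ with hρ
  set k : E := ⟨_, hκE⟩ with hk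
  set e := S.eta 1 x y with he
  have hξ : S.xi 1 x y = ρ * e := (div_mul_cancel₀ _ hη).symm
  have hκ : S.kappa 1 x y = k * e := (div_mul_cancel₀ _ hη).symm
  set A : ℝ → E := fun r => algebraMap ℂ E r with hA
  have hAc : ∀ r : ℝ, ((A r : E) : K) = algebraMap ℂ K r := fun r => rfl
  set M₀ : E := A S.a₀ - ρ * A S.b₀ with hM₀
  set M₁ : E := A S.a₁ - ρ * A S.b₁ with hM₁
  set N : E := M₀ ^ 2 + M₁ ^ 2 with hNdef
  set h : E := ρ * A S.b₂ - A S.a₂ with hh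
  have eM₀ : (M₀ : K) = algebraMap ℂ K S.a₀ - ρ * algebraMap ℂ K S.b₀ := rfl
  have eM₁ : (M₁ : K) = algebraMap ℂ K S.a₁ - ρ * algebraMap ℂ K S.b₁ := rfl
  have eN : (N : K) = M₀ ^ 2 + M₁ ^ 2 := rfl
  have eh : (h : K) = ρ * algebraMap ℂ K S.b₂ - algebraMap ℂ K S.a₂ := rfl
  have hnX : S.normalX x y = e * M₀ := by rw [normalX, ← he, hξ, eM₀]; ring
  have hnY : S.normalY x y = e * M₁ := by rw [normalY, ← he, hξ, eM₁]; ring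
  have hnS : S.normalSq x y = e ^ 2 * N := by rw [normalSq, hnX, hnY, eN]; ring
  have hNK : (N : K) ≠ 0 := by
    intro h0
    rw [hnS, h0, mul_zero] at hN
    exact hN rfl
  have hNE : N ≠ 0 := fun h0 => hNK (by rw [h0]; rfl)
  have hlin : x * M₀ + y * M₁ = h := by
    have h1 := hξ
    rw [he] at h1
    simp only [xi, eta, mul_one] at h1
    rw [eM₀, eM₁, eh]
    linear_combination h1
  -- On the line `M₀ x + M₁ y = h` of points with ratio `ρ`, `u` is the foot of the perpendicular
  -- from the origin and `θ` the coordinate along the direction `(-M₁, M₀)`. Substituting into `κ =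
  -- k η` and dividing by `N` gives the quadratic.
  set θ : K := (y * M₀ - x * M₁) / N with hθ
  have hθN : θ * N = y * M₀ - x * M₁ := div_mul_cancel₀ _ hNK
  set u : Fin 2 → E := ![h * M₀ / N, h * M₁ / N] with hu
  have eu0 : ((u 0 : E) : K) * N = h * M₀ := by
    change (((h * M₀ / N : E) : K)) * N = h * M₀
    push_cast
    exact div_mul_cancel₀ _ hNK
  have eu1 : ((u 1 : E) : K) * N = h * M₁ := by
    change (((h * M₁ / N : E) : K)) * N = h * M₁
    push_cast
    exact div_mul_cancel₀ _ hNK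
  set b : E := (A S.c₁ * M₀ - A S.c₀ * M₁ + (A S.a₁ * A S.b₀ - A S.a₀ * A S.b₁) * k) / N with hb
  have eb : (b : K) * N = algebraMap ℂ K S.c₁ * M₀ - algebraMap ℂ K S.c₀ * M₁ +
      (algebraMap ℂ K S.a₁ * algebraMap ℂ K S.b₀ - algebraMap ℂ K S.a₀ * algebraMap ℂ K S.b₁) * k :=
    div_mul_cancel₀ _ hNK
  set c : E := (u 0 ^ 2 + u 1 ^ 2 + A S.c₀ * u 0 + A S.c₁ * u 1 + A S.c₂ -
    k * (A S.b₀ * u 0 + A S.b₁ * u 1 + A S.b₂)) / N with hc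
  have ec : (c : K) * N = (u 0 : K) ^ 2 + (u 1 : K) ^ 2 + algebraMap ℂ K S.c₀ * u 0 +
      algebraMap ℂ K S.c₁ * u 1 + algebraMap ℂ K S.c₂ -
      k * (algebraMap ℂ K S.b₀ * u 0 + algebraMap ℂ K S.b₁ * u 1 + algebraMap ℂ K S.b₂) :=
    div_mul_cancel₀ _ hNK
  have hx : x = u 0 + θ * (-M₁ : K) := by
    apply mul_right_cancel₀ hNK
    rw [eN] at *
    linear_combination -eu0 + M₁ * hθN + M₀ * hlin
  have hy : y = u 1 + θ * (M₀ : K) := by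
    apply mul_right_cancel₀ hNK
    rw [eN] at *
    linear_combination -eu1 - M₀ * hθN + M₁ * hlin
  have horth : (u 0 : K) * M₁ = u 1 * M₀ := by
    apply mul_right_cancel₀ hNK
    linear_combination M₁ * eu0 - M₀ * eu1
  have hquad : θ ^ 2 + b * θ + c = 0 := by
    have h1 := hκ
    rw [he] at h1
    simp only [kappa, eta, mul_one, one_mul] at h1
    apply (mul_eq_zero.1 (?_ : (θ ^ 2 + b * θ + c) * (N : K) = 0)).resolve_right hNK
    rw [hx, hy] at h1
    rw [eM₀, eM₁] at *
    rw [eM₀, eM₁] at eN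
    linear_combination θ ^ 2 * eN + θ * eb + ec + h1 + 2 * θ * horth
  have hchord : S.chord x y / S.normalSq x y * e = b + 2 * θ := by
    have h1 : S.chord x y = e * N * (b + 2 * θ) := by
      rw [chord, hnX, hnY, hκ]
      simp only [map_sub, map_mul]
      linear_combination -e * eb - 2 * e * hθN
    rw [hnS, h1]
    field_simp
  refine ⟨θ, u, ![-M₁, M₀], b, c, hx, hy, ?_, hquad, ?_, ?_, hchord⟩
  · intro h0
    have h1 : -M₁ = 0 := congrFun h0 0
    have h2 : M₀ = 0 := congrFun h0 1
    apply hNE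
    rw [hNdef, h2, neg_eq_zero.1 h1]
    ring
  · have h1 : S.conjX x y / S.normalSq x y = x + S.chord x y / S.normalSq x y * e * M₁ := by
      rw [conjX, hnY]
      field_simp
    rw [h1, hchord]
    change _ = (u 0 : K) + (-b - θ) * (-M₁ : K)
    linear_combination hx
  · have h1 : S.conjY x y / S.normalSq x y = y - S.chord x y / S.normalSq x y * e * M₀ := by
      rw [conjY, hnX]
      field_simp
    rw [h1, hchord]
    change _ = (u 1 : K) + (-b - θ) * (M₀ : K)
    linear_combination hy

end CirclePlane

/-! ### The generic point of the curve and the field of its circle -/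

section Generic

variable {n d : ℕ} {a : ℝ}

theorem chRat_independent (hn : 0 < n) (hd : 0 < d) (hne : n ≠ d) {α β γ δ : ℂ}
    (h : algebraMap ℂ (RatFunc ℂ) α * (chRat n d a 0 ^ 2 + chRat n d a 1 ^ 2) +
      algebraMap ℂ (RatFunc ℂ) β * chRat n d a 0 + algebraMap ℂ (RatFunc ℂ) γ * chRat n d a 1 +
      algebraMap ℂ (RatFunc ℂ) δ = 0) : α = 0 ∧ β = 0 ∧ γ = 0 ∧ δ = 0 := by
  refine linearIndependent_circles (a := a) hn hd hne
    (IsFractionRing.injective (Polynomial ℂ) (RatFunc ℂ) ?_)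
  have hX : algebraMap (Polynomial ℂ) (RatFunc ℂ) (Polynomial.X ^ (n + d)) ≠ 0 :=
    algebraMap_ratFunc_ne_zero (pow_ne_zero _ Polynomial.X_ne_zero)
  have hC : ∀ c : ℂ, algebraMap ℂ (RatFunc ℂ) c =
      algebraMap (Polynomial ℂ) (RatFunc ℂ) (Polynomial.C c) := fun c =>
    IsScalarTower.algebraMap_apply ℂ (Polynomial ℂ) (RatFunc ℂ) c
  have h0 : chRat n d a 0 * algebraMap (Polynomial ℂ) (RatFunc ℂ) (Polynomial.X ^ (n + d)) =
    algebraMap (Polynomial ℂ) (RatFunc ℂ) (chX n d a) := div_mul_cancel₀ _ hX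
  have h1 : chRat n d a 1 * algebraMap (Polynomial ℂ) (RatFunc ℂ) (Polynomial.X ^ (n + d)) =
    algebraMap (Polynomial ℂ) (RatFunc ℂ) (chY n d a) := div_mul_cancel₀ _ hX
  have h2 : (Polynomial.X ^ (2 * (n + d)) : Polynomial ℂ) =
    Polynomial.X ^ (n + d) * Polynomial.X ^ (n + d) := by ring
  simp only [hC] at h
  rw [h2]
  simp only [map_add, map_mul, ← h0, ← h1, map_zero, map_pow _ (chX n d a), map_pow _ (chY n d a)]
  linear_combination (algebraMap (Polynomial ℂ) (RatFunc ℂ) (Polynomial.X ^ (n + d))) ^ 2 * h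

theorem finite_chPoint_zeros {h : MvPolynomial (Fin 2) ℂ} (hh : aeval (chRat n d a) h ≠ 0) :
    {t | t ≠ 0 ∧ eval (chPoint n d a t) h = 0}.Finite := by
  obtain ⟨H, h1, h2⟩ := aeval_div_eq_zero_iff ![chX n d a, chY n d a]
    (M := Polynomial.X ^ (n + d)) (pow_ne_zero _ Polynomial.X_ne_zero) h
  rw [chRat_eq, Ne, h1] at hh
  refine (Polynomial.finite_setOfPred_isRoot hh).subset ?_
  rintro t ⟨ht, hth⟩
  rw [chPoint_eq] at hth
  exact (h2 t (by simp [ht])).2 hth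

variable (S : CirclePlane)

theorem affine_chRat_ne_zero (hn : 0 < n) (hd : 0 < d) (hne : n ≠ d) {u v w : ℂ}
    (h : ¬ (u = 0 ∧ v = 0 ∧ w = 0)) : algebraMap ℂ (RatFunc ℂ) u * chRat n d a 0 +
      algebraMap ℂ (RatFunc ℂ) v * chRat n d a 1 + algebraMap ℂ (RatFunc ℂ) w ≠ 0 := by
  intro h0
  exact h (chRat_independent (a := a) hn hd hne (α := 0) (by simpa using h0)).2

theorem xi_eta_chRat_ne_zero (hn : 0 < n) (hd : 0 < d) (hne : n ≠ d) {b c : ℂ}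
    (hbc : ¬ (b = 0 ∧ c = 0)) :
    algebraMap ℂ (RatFunc ℂ) b * S.xi 1 (chRat n d a 0) (chRat n d a 1) +
      algebraMap ℂ (RatFunc ℂ) c * S.eta 1 (chRat n d a 0) (chRat n d a 1) ≠ 0 := by
  have h := affine_chRat_ne_zero (a := a) hn hd hne (u := b * S.a₀ + c * S.b₀)
    (v := b * S.a₁ + c * S.b₁) (w := b * S.a₂ + c * S.b₂)
    (fun h => hbc (S.independent h.1 h.2.1 h.2.2))
  intro h0
  apply h
  rw [← h0]
  simp only [CirclePlane.xi, CirclePlane.eta, map_add, map_mul]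
  ring

theorem eta_chRat_ne_zero (hn : 0 < n) (hd : 0 < d) (hne : n ≠ d) :
    S.eta 1 (chRat n d a 0) (chRat n d a 1) ≠ 0 := by
  simpa using xi_eta_chRat_ne_zero (a := a) S hn hd hne (b := 0) (c := 1) (by simp)

/-- Over `ℂ` the sum of two squares splits into two isotropic factors. Each is a combination of `ξ`
and `η`, nontrivial because these are real and not both constant. -/
theorem normalSq_chRat_ne_zero (hn : 0 < n) (hd : 0 < d) (hne : n ≠ d) :
    S.normalSq (chRat n d a 0) (chRat n d a 1) ≠ 0 := by
  have key : ∀ s : ℂ, s = Complex.I ∨ s = -Complex.I →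
      ¬ (-((S.b₀ : ℂ) + s * S.b₁) = 0 ∧ (S.a₀ : ℂ) + s * S.a₁ = 0) := by
    rintro s hs ⟨h1, h2⟩
    have r1 := congrArg Complex.re h1
    have i1 := congrArg Complex.im h1
    have r2 := congrArg Complex.re h2
    have i2 := congrArg Complex.im h2
    rcases hs with rfl | rfl <;> simp at r1 i1 r2 i2 <;>
      exact S.nonconstant ⟨r2, i2, r1, i1⟩
  have h1 := xi_eta_chRat_ne_zero (a := a) S hn hd hne (key _ (Or.inl rfl))
  have h2 := xi_eta_chRat_ne_zero (a := a) S hn hd hne (key _ (Or.inr rfl))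
  have hI : algebraMap ℂ (RatFunc ℂ) Complex.I ^ 2 = -1 := by
    rw [← map_pow, Complex.I_sq, map_neg, map_one]
  intro h0
  apply mul_ne_zero h1 h2
  rw [← h0]
  simp only [CirclePlane.normalSq, CirclePlane.normalX, CirclePlane.normalY, map_neg, map_add,
    map_mul]
  generalize algebraMap ℂ (RatFunc ℂ) Complex.I = I at hI
  linear_combination (-(algebraMap ℂ (RatFunc ℂ) S.a₁ * S.eta 1 (chRat n d a 0) (chRat n d a 1) -
    algebraMap ℂ (RatFunc ℂ) S.b₁ * S.xi 1 (chRat n d a 0) (chRat n d a 1)) ^ 2) * hI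

/-- The field generated by the ratios of the coordinates of the circle of the generic point. -/
noncomputable def circleField (n d : ℕ) (a : ℝ) : IntermediateField ℂ (RatFunc ℂ) :=
  ratioField (S.triple (chRat n d a 0) (chRat n d a 1))

theorem chField_eq : chField n d a = ratioField ![1, chRat n d a 0, chRat n d a 1] := by
  have hX : algebraMap (Polynomial ℂ) (RatFunc ℂ) (Polynomial.X ^ (n + d)) ≠ 0 :=
    algebraMap_ratFunc_ne_zero (pow_ne_zero _ Polynomial.X_ne_zero)
  rw [chField, ← ratioField_smul (P := ![1, chRat n d a 0, chRat n d a 1]) hX]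
  congr 1
  ext i : 1
  fin_cases i
  · simp [toRat, chTriple]
  · exact (mul_div_cancel₀ _ hX).symm
  · exact (mul_div_cancel₀ _ hX).symm

theorem chRat_mem_chField (i : Fin 2) : chRat n d a i ∈ chField n d a := by
  rw [chField_eq]
  have h1 := div_mem_ratioField' (P := ![1, chRat n d a 0, chRat n d a 1]) 1 0
  have h2 := div_mem_ratioField' (P := ![1, chRat n d a 0, chRat n d a 1]) 2 0
  fin_cases i
  · simpa using h1
  · simpa using h2

theorem chField_le {E : IntermediateField ℂ (RatFunc ℂ)} (h : ∀ i, chRat n d a i ∈ E) :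
    chField n d a ≤ E := by
  rw [chField_eq]
  have hP : ∀ i, (![1, chRat n d a 0, chRat n d a 1] : Fin 3 → RatFunc ℂ) i ∈ E := by
    intro i
    fin_cases i
    · exact one_mem E
    · exact h 0
    · exact h 1
  refine adjoin_le_iff.2 ?_
  rintro x ⟨b, c, rfl⟩
  exact div_mem (sum_mem fun i _ => E.smul_mem (hP i)) (sum_mem fun i _ => E.smul_mem (hP i))

theorem circleField_le : circleField S n d a ≤ chField n d a := by
  have hx := chRat_mem_chField (n := n) (d := d) (a := a) 0
  have hy := chRat_mem_chField (n := n) (d := d) (a := a) 1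
  set L := chField n d a
  have hc : ∀ c : ℂ, algebraMap ℂ (RatFunc ℂ) c ∈ L := fun c => L.algebraMap_mem c
  have hP : ∀ i, S.triple (chRat n d a 0) (chRat n d a 1) i ∈ L := by
    intro i
    fin_cases i
    · exact add_mem (add_mem (pow_mem hx 2) (pow_mem hy 2)) (mul_mem (one_mem _)
        (add_mem (add_mem (mul_mem (hc _) hx) (mul_mem (hc _) hy)) (mul_mem (hc _) (one_mem _))))
    · exact add_mem (add_mem (mul_mem (hc _) hx) (mul_mem (hc _) hy)) (mul_mem (hc _) (one_mem _))
    · exact add_mem (add_mem (mul_mem (hc _) hx) (mul_mem (hc _) hy)) (mul_mem (hc _) (one_mem _))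
  refine adjoin_le_iff.2 ?_
  rintro x ⟨b, c, rfl⟩
  exact div_mem (sum_mem fun i _ => L.smul_mem (hP i)) (sum_mem fun i _ => L.smul_mem (hP i))

/-- The curve is determined by its circles: a general circle carries a single point. -/
def CircleInjective (n d : ℕ) (a : ℝ) : Prop := ∀ i, chRat n d a i ∈ circleField S n d a

theorem exists_quadratic_chRat (hn : 0 < n) (hd : 0 < d) (hne : n ≠ d) :
    ∃ (θ : RatFunc ℂ) (u v : Fin 2 → circleField S n d a) (b c : circleField S n d a),
      (∀ i, chRat n d a i = u i + θ * v i) ∧ v ≠ 0 ∧ θ ^ 2 + b * θ + c = 0 ∧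
      (∀ i, ![S.conjX (chRat n d a 0) (chRat n d a 1) / S.normalSq (chRat n d a 0) (chRat n d a 1),
        S.conjY (chRat n d a 0) (chRat n d a 1) / S.normalSq (chRat n d a 0) (chRat n d a 1)] i =
        u i + (-b - θ) * v i) ∧
      S.chord (chRat n d a 0) (chRat n d a 1) / S.normalSq (chRat n d a 0) (chRat n d a 1) *
        S.eta 1 (chRat n d a 0) (chRat n d a 1) = b + 2 * θ := by
  have h1 := div_mem_ratioField' (P := S.triple (chRat n d a 0) (chRat n d a 1)) 1 2
  have h2 := div_mem_ratioField' (P := S.triple (chRat n d a 0) (chRat n d a 1)) 0 2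
  obtain ⟨θ, u, v, b, c, hx, hy, hv, hq, hcx, hcy, hch⟩ := S.exists_quadratic
    (E := circleField S n d a) (eta_chRat_ne_zero S hn hd hne) (normalSq_chRat_ne_zero S hn hd hne)
    h1 h2
  refine ⟨θ, u, v, b, c, ?_, hv, hq, ?_, hch⟩
  · intro i
    fin_cases i
    exacts [hx, hy]
  · intro i
    fin_cases i
    exacts [hcx, hcy]

open Classical in
-- The field of the curve is generated over that of its circles by the root `θ` of a quadratic, so
-- it has relative degree 1 or 2.
theorem finrank_circleField (hn : 0 < n) (hd : 0 < d) (hne : n ≠ d) :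
    finrank (circleField S n d a) (RatFunc ℂ) =
      (if CircleInjective S n d a then 1 else 2) * finrank (chField n d a) (RatFunc ℂ) := by
  rw [← relfinrank_mul_finrank_top (circleField_le S)]
  congr 1
  split_ifs with h
  · exact relfinrank_eq_one_iff.2 (chField_le h)
  · obtain ⟨θ, u, v, b, c, hx, hv, hq, -⟩ := exists_quadratic_chRat (a := a) S hn hd hne
    have hθ : θ ∉ circleField S n d a := by
      intro hθ
      apply h
      intro i
      rw [hx]
      exact add_mem (u i).2 (mul_mem hθ (v i).2)
    rw [relfinrank_eq_finrank_of_le (circleField_le S), ← finrank_adjoin_of_quadratic hq hθ]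
    obtain ⟨i, hi⟩ := Function.ne_iff.1 hv
    have hi' : ((v i : circleField S n d a) : RatFunc ℂ) ≠ 0 := fun h0 => hi (Subtype.ext h0)
    have hθL : θ ∈ chField n d a := by
      have : θ = (chRat n d a i - u i) / v i := by
        rw [hx i]
        field_simp
        ring
      rw [this]
      exact div_mem (sub_mem (chRat_mem_chField i) (circleField_le S (u i).2))
        (circleField_le S (v i).2)
    have heq : extendScalars (circleField_le S) = (circleField S n d a)⟮θ⟯ := by
      refine le_antisymm ?_ ?_
      · intro z hz
        have hz' : z ∈ chField n d a := hz
        have hle : chField n d a ≤ (circleField S n d a)⟮θ⟯.restrictScalars ℂ := by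
          refine chField_le fun i => ?_
          rw [hx]
          exact add_mem ((circleField S n d a)⟮θ⟯.algebraMap_mem (u i))
            (mul_mem (mem_adjoin_simple_self _ θ) ((circleField S n d a)⟮θ⟯.algebraMap_mem (v i)))
        exact hle hz'
      · exact adjoin_simple_le_iff.2 hθL
    rw [heq]

end Generic

/-! ### From the generic point to the points with given parameters -/

section Points

variable {n d : ℕ} {a : ℝ} (S : CirclePlane)

/-- The second point of the circle through a point of the plane. -/
noncomputable def CirclePlane.conj {B : Type*} [Field B] [Algebra ℂ B] (P : Fin 2 → B) : Fin 2 → B :=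
  ![S.conjX (P 0) (P 1) / S.normalSq (P 0) (P 1), S.conjY (P 0) (P 1) / S.normalSq (P 0) (P 1)]

theorem eval_chPoint_eq_zero_of_aeval (hd : 0 < d) {f : MvPolynomial (Fin 2) ℂ}
    (hf : aeval (chRat n d a) f = 0) {t : ℂ} (ht : t ≠ 0) : eval (chPoint n d a t) f = 0 :=
  eval_chPoint_eq_zero hd ((mem_vanishingIdeal_CH_iff hd f).2 hf) ht

/-- One and the same `H` serves over all fields, which carries statements about the second point of
a circle from the generic point to individual parameters. -/
theorem exists_clear_conj (f : MvPolynomial (Fin 2) ℂ) :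
    ∃ H : MvPolynomial (Fin 2) ℂ, ∀ (L : Type) [Field L] [Algebra ℂ L] (P : Fin 2 → L),
      S.normalSq (P 0) (P 1) ≠ 0 → (aeval P H = 0 ↔ aeval (S.conj P) f = 0) := by
  obtain ⟨H, k, hH⟩ := exists_clear_denominators f
    ![S.conjX (X 0 : MvPolynomial (Fin 2) ℂ) (X 1), S.conjY (X 0) (X 1)]
    (S.normalSq (X 0 : MvPolynomial (Fin 2) ℂ) (X 1))
  refine ⟨H, fun L _ _ P hP => ?_⟩
  have h1 := hH L (aeval P) (by rwa [S.map_normalSq, aeval_X, aeval_X])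
  rw [S.map_normalSq, aeval_X, aeval_X] at h1
  rw [h1, mul_eq_zero, or_iff_right (pow_ne_zero _ hP)]
  have h2 : (fun i => (aeval P) ((![S.conjX (X 0 : MvPolynomial (Fin 2) ℂ) (X 1),
      S.conjY (X 0) (X 1)] : Fin 2 → MvPolynomial (Fin 2) ℂ) i) / S.normalSq (P 0) (P 1)) =
      S.conj P := by
    ext i
    fin_cases i
    · simp [CirclePlane.conj, S.map_conjX]
    · simp [CirclePlane.conj, S.map_conjY]
  rw [h2]

/-- If a general circle carries two points of the curve, the second one satisfies the same algebraic
equations as the first. -/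
theorem aeval_conj_eq_zero_iff (hn : 0 < n) (hd : 0 < d) (hne : n ≠ d)
    (h : ¬ CircleInjective S n d a) (f : MvPolynomial (Fin 2) ℂ) :
    aeval (S.conj (chRat n d a)) f = 0 ↔ aeval (chRat n d a) f = 0 := by
  obtain ⟨θ, u, v, b, c, hx, hv, hq, hc, -⟩ := exists_quadratic_chRat (a := a) S hn hd hne
  have hθ : θ ∉ circleField S n d a := by
    intro hθ
    apply h
    intro i
    rw [hx]
    exact add_mem (u i).2 (mul_mem hθ (v i).2)
  have hθ' : -(b : RatFunc ℂ) - θ ∉ circleField S n d a := by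
    intro h'
    apply hθ
    have := sub_mem (neg_mem b.2) h'
    simpa using this
  have h1 : chRat n d a = fun i => (u i : RatFunc ℂ) + θ * v i := funext hx
  have h2 : S.conj (chRat n d a) = fun i => (u i : RatFunc ℂ) + (-b - θ) * v i := funext hc
  rw [h1] at *
  rw [h2]
  constructor
  · intro hf
    have := aeval_conj_eq_zero (b := b) (c := c) (by linear_combination hq) hθ' u v hf
    simpa using this
  · exact aeval_conj_eq_zero hq hθ u v

/-- A vanishing chord means a double root `θ = -b / 2`, which lies in the field of the circle. -/
theorem chord_chRat_ne_zero (hn : 0 < n) (hd : 0 < d) (hne : n ≠ d)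
    (h : ¬ CircleInjective S n d a) : S.chord (chRat n d a 0) (chRat n d a 1) ≠ 0 := by
  obtain ⟨θ, u, v, b, c, hx, hv, hq, hc, hch⟩ := exists_quadratic_chRat (a := a) S hn hd hne
  intro h0
  apply h
  intro i
  rw [h0, zero_div, zero_mul] at hch
  have hθ : θ = -(algebraMap ℂ (RatFunc ℂ) 2)⁻¹ * b := by
    have : (algebraMap ℂ (RatFunc ℂ) 2) ≠ 0 := by simp
    have h2 : (algebraMap ℂ (RatFunc ℂ) 2) = 2 := map_ofNat _ 2
    field_simp
    rw [h2]
    linear_combination -hch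
  rw [hx, hθ]
  exact add_mem (u i).2 (mul_mem (mul_mem (neg_mem (inv_mem (IntermediateField.algebraMap_mem _ _))) b.2) (v i).2)

theorem finite_conj_zeros (hn : 0 < n) (hd : 0 < d) (hne : n ≠ d)
    (h : ¬ CircleInjective S n d a) {f : MvPolynomial (Fin 2) ℂ} (hf : aeval (chRat n d a) f ≠ 0) :
    {t | t ≠ 0 ∧ S.normalSq (chPoint n d a t 0) (chPoint n d a t 1) ≠ 0 ∧
      eval (S.conj (chPoint n d a t)) f = 0}.Finite := by
  obtain ⟨H, hH⟩ := exists_clear_conj S f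
  have h1 : aeval (chRat n d a) H ≠ 0 := by
    rw [Ne, hH _ _ (normalSq_chRat_ne_zero S hn hd hne), aeval_conj_eq_zero_iff S hn hd hne h]
    exact hf
  refine (finite_chPoint_zeros h1).subset ?_
  rintro t ⟨ht, htN, htf⟩
  refine ⟨ht, ?_⟩
  rw [← aeval_eq_eval] at htf ⊢
  exact (hH ℂ _ htN).2 htf

theorem finite_normalSq_zeros (hn : 0 < n) (hd : 0 < d) (hne : n ≠ d) :
    {t | t ≠ 0 ∧ S.normalSq (chPoint n d a t 0) (chPoint n d a t 1) = 0}.Finite := by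
  have := finite_chPoint_zeros (n := n) (d := d) (a := a)
    (h := S.normalSq (X 0 : MvPolynomial (Fin 2) ℂ) (X 1))
    (by rw [S.map_normalSq, aeval_X, aeval_X]; exact normalSq_chRat_ne_zero S hn hd hne)
  refine this.subset ?_
  rintro t ⟨ht, h⟩
  refine ⟨ht, ?_⟩
  rw [← aeval_eq_eval, S.map_normalSq, aeval_X, aeval_X]
  exact h

/-- If the curve is not determined by its circles, then a general point of the curve has a partner
on its circle. -/
theorem exists_partner (hn : 0 < n) (hd : 0 < d) (hne : n ≠ d) (h : ¬ CircleInjective S n d a) :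
    ∃ bad : Set ℂ, bad.Finite ∧ ∀ t, ‖t‖ = 1 → t ∉ bad → ∀ Q : E2, complexify Q = chPoint n d a t →
      S.normalSq (Q 0 : ℂ) (Q 1) ≠ 0 ∧ ∃ Q' ∈ CH n d a, Q' ≠ Q ∧
        complexify Q' = S.conj (complexify Q) ∧ S.eta 1 (Q' 0 : ℂ) (Q' 1) ≠ 0 := by
  -- A nonzero first coordinate of the second point guarantees that it is not the pole, the only
  -- real point of the closure that may fail to be on the curve.
  have hX0 : aeval (chRat n d a) (X 0 : MvPolynomial (Fin 2) ℂ) ≠ 0 := by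
    rw [aeval_X]
    simpa using affine_chRat_ne_zero (a := a) hn hd hne (u := 1) (v := 0) (w := 0) (by simp)
  have hη : aeval (chRat n d a) (S.eta 1 (X 0 : MvPolynomial (Fin 2) ℂ) (X 1)) ≠ 0 := by
    rw [S.map_eta, map_one, aeval_X, aeval_X]
    exact eta_chRat_ne_zero S hn hd hne
  have hch : aeval (chRat n d a) (S.chord (X 0 : MvPolynomial (Fin 2) ℂ) (X 1)) ≠ 0 := by
    rw [S.map_chord, aeval_X, aeval_X]
    exact chord_chRat_ne_zero S hn hd hne h
  refine ⟨_, ((finite_normalSq_zeros (a := a) S hn hd hne).union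
    (finite_conj_zeros S hn hd hne h hX0)).union
    ((finite_conj_zeros S hn hd hne h hη).union (finite_chPoint_zeros hch)), ?_⟩
  intro t ht hbad Q hQ
  have ht0 : t ≠ 0 := by
    rintro rfl
    simp at ht
  have hQ0 : chPoint n d a t 0 = Q 0 := by rw [← hQ]; rfl
  have hQ1 : chPoint n d a t 1 = Q 1 := by rw [← hQ]; rfl
  simp only [Set.mem_union, Set.mem_ofPred_eq, not_or, not_and, ht0, ne_eq, not_false_eq_true,
    true_imp_iff] at hbad
  obtain ⟨⟨hN, hb1⟩, hb2, hb3⟩ := hbad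
  have hb1 := hb1 hN
  have hb2 := hb2 hN
  rw [← aeval_eq_eval, S.map_chord, aeval_X, aeval_X, hQ0, hQ1] at hb3
  rw [← hQ] at hb1 hb2
  rw [← aeval_eq_eval, S.map_eta, map_one, aeval_X, aeval_X] at hb2
  rw [← aeval_eq_eval, aeval_X] at hb1
  rw [hQ0, hQ1] at hN
  refine ⟨hN, ?_⟩
  obtain ⟨x', y', hx', hy'⟩ := S.conj_real (Q 0) (Q 1)
  have hconj : complexify !₂[x', y'] = S.conj (complexify Q) := by
    ext i
    fin_cases i
    · exact hx'.symm
    · exact hy'.symm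
  refine ⟨!₂[x', y'], mem_CH_of_mem_algCurve hn hd ?_ ?_, ?_, hconj, ?_⟩
  · intro f hf
    obtain ⟨H, hH⟩ := exists_clear_conj S f
    rw [hconj, ← hH ℂ (complexify Q) hN, hQ, aeval_eq_eval]
    refine eval_chPoint_eq_zero_of_aeval hd ?_ ht0
    rw [hH _ _ (normalSq_chRat_ne_zero S hn hd hne), aeval_conj_eq_zero_iff S hn hd hne h]
    exact (mem_vanishingIdeal_CH_iff hd f).1 hf
  · intro h0
    apply hb1
    rw [← hconj, h0]
    simp [complexify]
  · intro h0
    have e0 : (x' : ℂ) = Q 0 := by rw [← h0]; simp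
    have e1 : (y' : ℂ) = Q 1 := by rw [← h0]; simp
    rw [e0, CirclePlane.conjX, div_eq_iff hN] at hx'
    rw [e1, CirclePlane.conjY, div_eq_iff hN] at hy'
    apply hN
    rw [CirclePlane.normalSq]
    have h2 : S.normalY (Q 0 : ℂ) (Q 1) = 0 := by
      have : S.chord (Q 0 : ℂ) (Q 1) * S.normalY (Q 0 : ℂ) (Q 1) = 0 := by linear_combination hx'
      exact (mul_eq_zero.1 this).resolve_left hb3
    have h3 : S.normalX (Q 0 : ℂ) (Q 1) = 0 := by
      have : S.chord (Q 0 : ℂ) (Q 1) * S.normalX (Q 0 : ℂ) (Q 1) = 0 := by linear_combination -hy'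
      exact (mul_eq_zero.1 this).resolve_left hb3
    rw [h2, h3]
    ring
  · rw [← hconj] at hb2
    exact hb2

/-- If the curve is determined by its circles, then a general point of the curve is determined by
its circle. -/
theorem exists_finite_of_circleInjective (hn : 0 < n) (hd : 0 < d) (hne : n ≠ d)
    (h : CircleInjective S n d a) :
    ∃ bad : Set ℂ, bad.Finite ∧ ∀ t τ l : ℂ, t ≠ 0 → τ ≠ 0 → l ≠ 0 → t ∉ bad →
      S.triple (chPoint n d a τ 0) (chPoint n d a τ 1) =
        l • S.triple (chPoint n d a t 0) (chPoint n d a t 1) →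
      chPoint n d a τ = chPoint n d a t := by
  have hη := eta_chRat_ne_zero (a := a) S hn hd hne
  have key : ∀ i, ∃ bad : Set ℂ, bad.Finite ∧ ∀ t τ l : ℂ, t ≠ 0 → τ ≠ 0 → l ≠ 0 → t ∉ bad →
      S.triple (chPoint n d a τ 0) (chPoint n d a τ 1) =
        l • S.triple (chPoint n d a t 0) (chPoint n d a t 1) →
      chPoint n d a τ i = chPoint n d a t i := by
    intro i
    have hi := h i
    have hi0 : chRat n d a i ≠ 0 := by
      fin_cases i
      · simpa using affine_chRat_ne_zero (a := a) hn hd hne (u := 1) (v := 0) (w := 0) (by simp)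
      · simpa using affine_chRat_ne_zero (a := a) hn hd hne (u := 0) (v := 1) (w := 0) (by simp)
    have hrange : circleField S n d a = adjoin ℂ (Set.range
        ![S.xi 1 (chRat n d a 0) (chRat n d a 1) / S.eta 1 (chRat n d a 0) (chRat n d a 1),
          S.kappa 1 (chRat n d a 0) (chRat n d a 1) / S.eta 1 (chRat n d a 0) (chRat n d a 1)]) := by
      rw [circleField, ratioField_eq (P := S.triple (chRat n d a 0) (chRat n d a 1)) hη,
        Matrix.range_cons, Matrix.range_cons, Matrix.range_empty, Set.union_empty]
      rfl
    -- The coordinate is a quotient `r / s` of polynomials in `ξ / η` and `κ / η`. Cleared of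
    -- denominators, this identity specialises to all parameters except those where `η` or `s`
    -- vanishes, and there the circle determines the point.
    rw [hrange, mem_adjoin_range_iff] at hi
    obtain ⟨r, s, hrs⟩ := hi
    set N : Fin 2 → MvPolynomial (Fin 2) ℂ := ![S.xi 1 (X 0) (X 1), S.kappa 1 (X 0) (X 1)] with hN
    set M : MvPolynomial (Fin 2) ℂ := S.eta 1 (X 0) (X 1) with hM
    have hspec : ∀ (L : Type) [Field L] [Algebra ℂ L] (P : Fin 2 → L),
        aeval P M = S.eta 1 (P 0) (P 1) ∧ (fun i => aeval P (N i) / aeval P M) =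
          ![S.xi 1 (P 0) (P 1) / S.eta 1 (P 0) (P 1),
            S.kappa 1 (P 0) (P 1) / S.eta 1 (P 0) (P 1)] := by
      intro L _ _ P
      have h1 : aeval P M = S.eta 1 (P 0) (P 1) := by
        rw [hM, S.map_eta, map_one, aeval_X, aeval_X]
      refine ⟨h1, ?_⟩
      rw [h1]
      ext i
      fin_cases i
      · simp [hN, S.map_xi]
      · simp [hN, S.map_kappa]
    obtain ⟨Hr, kr, hHr⟩ := exists_clear_denominators r N M
    obtain ⟨Hs, ks, hHs⟩ := exists_clear_denominators s N M
    have hs0 : aeval ![S.xi 1 (chRat n d a 0) (chRat n d a 1) / S.eta 1 (chRat n d a 0) (chRat n d a 1),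
          S.kappa 1 (chRat n d a 0) (chRat n d a 1) / S.eta 1 (chRat n d a 0) (chRat n d a 1)] s ≠ 0 := by
      intro h0
      rw [h0, div_zero] at hrs
      exact hi0 hrs
    have hMK := (hspec _ (chRat n d a)).1
    have hr1 := hHr _ (aeval (chRat n d a)) (by rwa [hMK])
    have hs1 := hHs _ (aeval (chRat n d a)) (by rwa [hMK])
    rw [(hspec _ (chRat n d a)).2] at hr1 hs1
    have hrel : aeval (chRat n d a) (X i * Hs * M ^ kr - Hr * M ^ ks) = 0 := by
      rw [map_sub, map_mul, map_mul, map_mul, map_pow, map_pow, aeval_X, hr1, hs1, hrs]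
      field_simp
      ring
    have hHs0 : aeval (chRat n d a) Hs ≠ 0 := by
      rw [hs1, hMK]
      exact mul_ne_zero (pow_ne_zero _ hη) hs0
    have hM0 : aeval (chRat n d a) M ≠ 0 := by rwa [hMK]
    refine ⟨_, (finite_chPoint_zeros hHs0).union (finite_chPoint_zeros hM0), ?_⟩
    intro t τ l ht hτ hl hbad hl'
    simp only [Set.mem_union, Set.mem_ofPred_eq, not_or, not_and, ht, ne_eq, not_false_eq_true,
      true_imp_iff] at hbad
    obtain ⟨hb1, hb2⟩ := hbad
    have hval : ∀ t : ℂ, t ≠ 0 → S.eta 1 (chPoint n d a t 0) (chPoint n d a t 1) ≠ 0 →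
        chPoint n d a t i * aeval ![S.xi 1 (chPoint n d a t 0) (chPoint n d a t 1) /
          S.eta 1 (chPoint n d a t 0) (chPoint n d a t 1),
          S.kappa 1 (chPoint n d a t 0) (chPoint n d a t 1) /
          S.eta 1 (chPoint n d a t 0) (chPoint n d a t 1)] s =
        aeval ![S.xi 1 (chPoint n d a t 0) (chPoint n d a t 1) /
          S.eta 1 (chPoint n d a t 0) (chPoint n d a t 1),
          S.kappa 1 (chPoint n d a t 0) (chPoint n d a t 1) /
          S.eta 1 (chPoint n d a t 0) (chPoint n d a t 1)] r := by
      intro t ht hη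
      have h1 := eval_chPoint_eq_zero_of_aeval hd hrel ht
      have hMt := (hspec _ (chPoint n d a t)).1
      have hr2 := hHr _ (aeval (chPoint n d a t)) (by rwa [hMt])
      have hs2 := hHs _ (aeval (chPoint n d a t)) (by rwa [hMt])
      rw [(hspec _ (chPoint n d a t)).2, hMt] at hr2 hs2
      rw [← aeval_eq_eval, map_sub, map_mul, map_mul, map_mul, map_pow, map_pow, aeval_X, hr2, hs2,
        hMt] at h1
      refine mul_left_cancel₀ (mul_ne_zero (pow_ne_zero kr hη) (pow_ne_zero ks hη)) ?_
      linear_combination h1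
    rw [← aeval_eq_eval] at hb1 hb2
    have hMt := (hspec _ (chPoint n d a t)).1
    have hηt : S.eta 1 (chPoint n d a t 0) (chPoint n d a t 1) ≠ 0 := by rwa [← hMt]
    have e0 : S.kappa 1 (chPoint n d a τ 0) (chPoint n d a τ 1) =
      l * S.kappa 1 (chPoint n d a t 0) (chPoint n d a t 1) := congrFun hl' 0
    have e1 : S.xi 1 (chPoint n d a τ 0) (chPoint n d a τ 1) =
      l * S.xi 1 (chPoint n d a t 0) (chPoint n d a t 1) := congrFun hl' 1
    have e2 : S.eta 1 (chPoint n d a τ 0) (chPoint n d a τ 1) =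
      l * S.eta 1 (chPoint n d a t 0) (chPoint n d a t 1) := congrFun hl' 2
    have hvt := hval t ht hηt
    have hvτ := hval τ hτ (by rw [e2]; exact mul_ne_zero hl hηt)
    rw [e0, e1, e2, mul_div_mul_left _ _ hl, mul_div_mul_left _ _ hl, ← hvt] at hvτ
    refine mul_right_cancel₀ ?_ hvτ
    have hs2 := hHs _ (aeval (chPoint n d a t)) (by rwa [hMt])
    rw [(hspec _ (chPoint n d a t)).2, hMt] at hs2
    intro h0
    rw [h0, mul_zero] at hs2
    exact hb1 hs2
  obtain ⟨bad₀, hf₀, h₀⟩ := key 0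
  obtain ⟨bad₁, hf₁, h₁⟩ := key 1
  refine ⟨bad₀ ∪ bad₁, hf₀.union hf₁, fun t τ l ht hτ hl hb hl' => ?_⟩
  rw [Set.mem_union, not_or] at hb
  ext i
  fin_cases i
  · exact h₀ t τ l ht hτ hl hb.1 hl'
  · exact h₁ t τ l ht hτ hl hb.2 hl'

end Points

/-! ### The points of a curve on the circles of the congruence -/

theorem eq_of_mem_congruence {q : ℝ} {c : Set E3} (hc : c ∈ congruence q) {Y : E3} (hY : Y ∈ c)
    (hYz : Y ∉ zAxis) :
    c = {Z | ∃ s : ℝ, Z 0 = s * Y 0 ∧ Z 1 = s * Y 1 ∧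
      s ^ 2 * (Y 0 ^ 2 + Y 1 ^ 2) + Z 2 ^ 2 - q = s * (Y 0 ^ 2 + Y 1 ^ 2 + Y 2 ^ 2 - q)} := by
  obtain ⟨v₀, v₁, k, hv, rfl⟩ := hc
  obtain ⟨u, h0, h1, h2⟩ := hY
  have hu : u ≠ 0 := by
    rintro rfl
    exact hYz ⟨by simpa using h0, by simpa using h1⟩
  have hW : Y 0 ^ 2 + Y 1 ^ 2 = u ^ 2 := by rw [h0, h1]; linear_combination u ^ 2 * hv
  ext Z
  constructor
  · rintro ⟨u', h0', h1', h2'⟩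
    refine ⟨u' / u, ?_, ?_, ?_⟩
    · rw [h0', h0]; field_simp
    · rw [h1', h1]; field_simp
    · rw [hW]
      field_simp
      linear_combination u * h2' - u' * h2
  · rintro ⟨s, h0', h1', h2'⟩
    refine ⟨s * u, ?_, ?_, ?_⟩
    · rw [h0', h0]; ring
    · rw [h1', h1]; ring
    · rw [hW] at h2'
      linear_combination h2' + s * h2

theorem exists_smul_circleCoords_iff {q : ℝ} {Y Z : E3} :
    (∃ s : ℝ, Z 0 = s * Y 0 ∧ Z 1 = s * Y 1 ∧
      s ^ 2 * (Y 0 ^ 2 + Y 1 ^ 2) + Z 2 ^ 2 - q = s * (Y 0 ^ 2 + Y 1 ^ 2 + Y 2 ^ 2 - q)) ↔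
    ∃ s : ℝ, circleCoords q Z = (s : ℂ) • circleCoords q Y := by
  refine exists_congr fun s => ?_
  constructor
  · rintro ⟨h0, h1, h2⟩
    ext i
    fin_cases i
    · simp only [circleCoords, Fin.zero_eta, Matrix.cons_val_zero, Pi.smul_apply, smul_eq_mul]
      norm_cast
      rw [h0, h1]
      linear_combination h2
    · simp [circleCoords, h0]
    · simp [circleCoords, h1]
  · intro h
    have h0 : ((Z 0 ^ 2 + Z 1 ^ 2 + Z 2 ^ 2 - q : ℝ) : ℂ) =
      s * ((Y 0 ^ 2 + Y 1 ^ 2 + Y 2 ^ 2 - q : ℝ) : ℂ) := congrFun h 0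
    have h1 : ((Z 0 : ℝ) : ℂ) = s * (Y 0 : ℝ) := congrFun h 1
    have h2 : ((Z 1 : ℝ) : ℂ) = s * (Y 1 : ℝ) := congrFun h 2
    norm_cast at h0 h1 h2
    refine ⟨h1, h2, ?_⟩
    rw [← h0, h1, h2]
    ring

theorem complexify_injective : Function.Injective complexify := by
  intro Q Q' h
  ext i
  have := congrFun h i
  simp only [complexify] at this
  exact_mod_cast this

section Multiplicity

variable {n d : ℕ} {a q : ℝ} {S : CirclePlane} {ι : E2 →ᵃⁱ[ℝ] E3}

theorem notMem_zAxis_iff (hS : ∀ Q : E2, circleCoords q (ι Q) = S.triple (Q 0 : ℂ) (Q 1)) (Q : E2) :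
    ι Q ∈ zAxis ↔ S.xi 1 (Q 0 : ℂ) (Q 1) = 0 ∧ S.eta 1 (Q 0 : ℂ) (Q 1) = 0 := by
  have h1 : ((ι Q 0 : ℝ) : ℂ) = S.xi 1 (Q 0 : ℂ) (Q 1) := congrFun (hS Q) 1
  have h2 : ((ι Q 1 : ℝ) : ℂ) = S.eta 1 (Q 0 : ℂ) (Q 1) := congrFun (hS Q) 2
  rw [← h1, ← h2, Complex.ofReal_eq_zero, Complex.ofReal_eq_zero]
  rfl

/-- An exceptional circle passes through a point with an exceptional parameter; that point lies off
the axis and so determines the circle, whence there are finitely many. -/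
theorem isCircleMultiplicity_of_finite (hd : 0 < d)
    (hS : ∀ Q : E2, circleCoords q (ι Q) = S.triple (Q 0 : ℂ) (Q 1)) {bad : Set ℂ}
    (hbad : bad.Finite) {δ : ℕ}
    (h : ∀ t, ‖t‖ = 1 → t ∉ bad → ∀ Q ∈ CH n d a, complexify Q = chPoint n d a t → ι Q ∉ zAxis →
      {Q' | Q' ∈ CH n d a ∧ ι Q' ∉ zAxis ∧ ∃ s : ℝ, S.triple (Q' 0 : ℂ) (Q' 1) =
        (s : ℂ) • S.triple (Q 0 : ℂ) (Q 1)}.ncard = δ) :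
    IsCircleMultiplicity q (ι '' CH n d a) δ := by
  have hsub : {c ∈ circleSystem q (ι '' CH n d a) | (c ∩ (ι '' CH n d a \ zAxis)).ncard ≠ δ} ⊆
      ⋃ t ∈ bad, {c | c ∈ congruence q ∧ ∃ Q : E2, complexify Q = chPoint n d a t ∧ ι Q ∈ c ∧
        ι Q ∉ zAxis} := by
    rintro c ⟨⟨hc, Y, hYc, ⟨Q, hQ, rfl⟩, hYz⟩, hcard⟩
    obtain ⟨t, ht, hQt⟩ := (mem_CH_iff hd Q).1 hQ
    rw [Set.mem_iUnion₂]
    refine ⟨t, ?_, hc, Q, hQt, hYc, hYz⟩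
    by_contra htb
    apply hcard
    rw [← h t ht htb Q hQ hQt hYz, ← Set.ncard_image_of_injective _ ι.injective]
    congr 1
    have hc' := eq_of_mem_congruence hc hYc hYz
    ext Z
    constructor
    · rintro ⟨hZc, ⟨Q', hQ', rfl⟩, hZz⟩
      rw [hc'] at hZc
      refine ⟨Q', ⟨hQ', hZz, ?_⟩, rfl⟩
      rw [← hS, ← hS]
      exact exists_smul_circleCoords_iff.1 hZc
    · rintro ⟨Q', ⟨hQ', hZz, hs⟩, rfl⟩
      refine ⟨?_, ⟨Q', hQ', rfl⟩, hZz⟩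
      rw [hc']
      rw [← hS, ← hS] at hs
      exact exists_smul_circleCoords_iff.2 hs
  refine (hbad.biUnion fun t _ => Set.Subsingleton.finite ?_).subset hsub
  rintro c ⟨hc, Q, hQ, hQc, hQz⟩ c' ⟨hc', Q', hQ', hQc', -⟩
  have : Q = Q' := complexify_injective (hQ.trans hQ'.symm)
  subst this
  rw [eq_of_mem_congruence hc hQc hQz, eq_of_mem_congruence hc' hQc' hQz]

theorem ne_zero_of_triple_eq (hS : ∀ Q : E2, circleCoords q (ι Q) = S.triple (Q 0 : ℂ) (Q 1))
    {Q Q' : E2} {s : ℂ} (hz : ι Q' ∉ zAxis)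
    (hs : S.triple (Q' 0 : ℂ) (Q' 1) = s • S.triple (Q 0 : ℂ) (Q 1)) : s ≠ 0 := by
  rintro rfl
  rw [zero_smul] at hs
  exact hz ((notMem_zAxis_iff hS Q').2 ⟨congrFun hs 1, congrFun hs 2⟩)

open Classical in
-- The points on a general circle are the given one and, in the quadratic case, its partner, which
-- is again a real point of the curve off the axis.
theorem isCircleMultiplicity (hn : 0 < n) (hd : 0 < d) (hne : n ≠ d)
    (hS : ∀ Q : E2, circleCoords q (ι Q) = S.triple (Q 0 : ℂ) (Q 1)) :
    IsCircleMultiplicity q (ι '' CH n d a) (if CircleInjective S n d a then 1 else 2) := by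
  have hne0 : ∀ t : ℂ, ‖t‖ = 1 → t ≠ 0 := by
    rintro t ht rfl
    simp at ht
  split_ifs with h
  · obtain ⟨bad, hbad, hb⟩ := exists_finite_of_circleInjective S hn hd hne h
    refine isCircleMultiplicity_of_finite hd hS hbad fun t ht htb Q hQ hQt hQz => ?_
    rw [Set.ncard_eq_one]
    refine ⟨Q, Set.eq_singleton_iff_unique_mem.2 ⟨⟨hQ, hQz, 1, by simp⟩, ?_⟩⟩
    rintro Q' ⟨hQ', hQz', s, hs⟩
    obtain ⟨τ, hτ, hQτ⟩ := (mem_CH_iff hd Q').1 hQ'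
    have h1 : ∀ (Q : E2) (t : ℂ), complexify Q = chPoint n d a t →
        S.triple (Q 0 : ℂ) (Q 1) = S.triple (chPoint n d a t 0) (chPoint n d a t 1) := by
      intro Q t h
      rw [← h]
      rfl
    have := hb t τ s (hne0 t ht) (hne0 τ hτ) (ne_zero_of_triple_eq hS hQz' hs) htb
      (by rw [← h1 Q t hQt, ← h1 Q' τ hQτ, hs])
    exact complexify_injective (by rw [hQτ, hQt, this])
  · obtain ⟨bad, hbad, hb⟩ := exists_partner (a := a) S hn hd hne h
    refine isCircleMultiplicity_of_finite hd hS hbad fun t ht htb Q hQ hQt hQz => ?_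
    obtain ⟨hN, Q', hQ', hQQ', hconj, hη⟩ := hb t ht htb Q hQt
    rw [Set.ncard_eq_two]
    have hc0 : ((Q' 0 : ℝ) : ℂ) = S.conjX (Q 0 : ℂ) (Q 1) / S.normalSq (Q 0 : ℂ) (Q 1) :=
      congrFun hconj 0
    have hc1 : ((Q' 1 : ℝ) : ℂ) = S.conjY (Q 0 : ℂ) (Q 1) / S.normalSq (Q 0 : ℂ) (Q 1) :=
      congrFun hconj 1
    have hQz' : ι Q' ∉ zAxis := fun hz => hη ((notMem_zAxis_iff hS Q').1 hz).2
    refine ⟨Q, Q', hQQ'.symm, Set.Subset.antisymm ?_ ?_⟩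
    · rintro Q'' ⟨hQ'', -, s, hs⟩
      rcases S.eq_or_eq_conj hN hs with ⟨h1, h2⟩ | ⟨h1, h2⟩
      · left
        apply complexify_injective
        ext i; fin_cases i
        exacts [h1, h2]
      · right
        apply complexify_injective
        rw [← hc0] at h1
        rw [← hc1] at h2
        ext i; fin_cases i
        exacts [h1, h2]
    · rintro Q'' (rfl | rfl)
      · exact ⟨hQ, hQz, 1, by simp⟩
      · refine ⟨hQ', hQz', ?_⟩
        have h1 := S.triple_conj hN
        rw [← hc0, ← hc1] at h1
        have hξ : ((ι Q'' 1 : ℝ) : ℂ) = S.eta 1 (Q'' 0 : ℂ) (Q'' 1) := congrFun (hS Q'') 2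
        have hξ' : ((ι Q 1 : ℝ) : ℂ) = S.eta 1 (Q 0 : ℂ) (Q 1) := congrFun (hS Q) 2
        have h2 : S.eta 1 (Q'' 0 : ℂ) (Q'' 1) = _ * S.eta 1 (Q 0 : ℂ) (Q 1) := congrFun h1 2
        rw [← hξ, ← hξ'] at h2
        have h3 : ((ι Q 1 : ℝ) : ℂ) ≠ 0 := by
          intro h0
          rw [h0, mul_zero] at h2
          rw [← hξ, h2] at hη
          exact hη rfl
        -- The factor of proportionality is a priori complex; as a quotient of two real values of
        -- `η` it is real.
        refine ⟨ι Q'' 1 / ι Q 1, ?_⟩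
        rw [h1]
        congr 1
        rw [Complex.ofReal_div, h2, mul_div_cancel_right₀ _ h3]

end Multiplicity

/-! ### Curves meeting the axis -/

section Axis

variable {n d : ℕ} {a : ℝ} (S : CirclePlane)

/-- If the axis meets the plane in `Z`, the partner of a point is obtained by an inversion with
centre `Z`. -/
theorem exists_inversion_partner (hn : 0 < n) (hd : 0 < d) (hne : n ≠ d)
    (h : ¬ CircleInjective S n d a) {Z : E2} (hξ : S.xi 1 (Z 0 : ℂ) (Z 1) = 0)
    (hη : S.eta 1 (Z 0 : ℂ) (Z 1) = 0) :
    ∃ bad : Set ℂ, bad.Finite ∧ S.kappa 1 (Z 0 : ℂ) (Z 1) ≠ 0 ∧ ∀ t, ‖t‖ = 1 → t ∉ bad →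
      ∃ τ l : ℂ, ‖τ‖ = 1 ∧ (∀ i, chPoint n d a τ i - Z i = l * (chPoint n d a t i - Z i)) ∧
        l * ((chPoint n d a t 0 - Z 0) ^ 2 + (chPoint n d a t 1 - Z 1) ^ 2) =
          S.kappa 1 (Z 0 : ℂ) (Z 1) := by
  obtain ⟨bad, hbad, hb⟩ := exists_partner (a := a) S hn hd hne h
  have hΔ : (S.a₀ * S.b₁ - S.a₁ * S.b₀ : ℂ) ≠ 0 := by
    obtain ⟨-, -, -, -, -, -, hΔ⟩ := S.exists_real_zero hξ hη
    exact_mod_cast hΔ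
  have key : ∀ t, ‖t‖ = 1 → t ∉ bad →
      ∃ τ l : ℂ, ‖τ‖ = 1 ∧ (∀ i, chPoint n d a τ i - Z i = l * (chPoint n d a t i - Z i)) ∧
        l * ((chPoint n d a t 0 - Z 0) ^ 2 + (chPoint n d a t 1 - Z 1) ^ 2) =
          S.kappa 1 (Z 0 : ℂ) (Z 1) ∧ S.kappa 1 (Z 0 : ℂ) (Z 1) ≠ 0 := by
    intro t ht htb
    obtain ⟨Q, hQ, hQt⟩ := exists_real_chPoint (n := n) (a := a) hd ht
    obtain ⟨hN, Q', hQ', hQQ', hconj, hη'⟩ := hb t ht htb Q hQt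
    obtain ⟨τ, hτ, hQτ⟩ := (mem_CH_iff hd Q').1 hQ'
    have hc0 : ((Q' 0 : ℝ) : ℂ) = S.conjX (Q 0 : ℂ) (Q 1) / S.normalSq (Q 0 : ℂ) (Q 1) :=
      congrFun hconj 0
    have hc1 : ((Q' 1 : ℝ) : ℂ) = S.conjY (Q 0 : ℂ) (Q 1) / S.normalSq (Q 0 : ℂ) (Q 1) :=
      congrFun hconj 1
    have h1 := S.triple_conj hN
    rw [← hc0, ← hc1] at h1
    generalize 1 + S.chord (Q 0 : ℂ) (Q 1) / S.normalSq (Q 0 : ℂ) (Q 1) *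
      algebraMap ℂ ℂ (S.a₁ * S.b₀ - S.a₀ * S.b₁) = l at h1
    have e0 : S.kappa 1 (Q' 0 : ℂ) (Q' 1) = l * S.kappa 1 (Q 0 : ℂ) (Q 1) := congrFun h1 0
    have e1 : S.xi 1 (Q' 0 : ℂ) (Q' 1) = l * S.xi 1 (Q 0 : ℂ) (Q 1) := congrFun h1 1
    have e2 : S.eta 1 (Q' 0 : ℂ) (Q' 1) = l * S.eta 1 (Q 0 : ℂ) (Q 1) := congrFun h1 2
    simp only [CirclePlane.xi, CirclePlane.eta, CirclePlane.kappa, Algebra.algebraMap_self,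
      RingHom.id_apply, mul_one, one_mul] at e0 e1 e2 hξ hη hη' ⊢
    have hx : (Q' 0 - Z 0 : ℂ) = l * (Q 0 - Z 0) := by
      refine sub_eq_zero.1 ((mul_eq_zero.1 (?_ : (S.a₀ * S.b₁ - S.a₁ * S.b₀ : ℂ) * _ = 0)).resolve_left hΔ)
      linear_combination S.b₁ * (e1 - (1 - l) * hξ) - S.a₁ * (e2 - (1 - l) * hη)
    have hy : (Q' 1 - Z 1 : ℂ) = l * (Q 1 - Z 1) := by
      refine sub_eq_zero.1 ((mul_eq_zero.1 (?_ : (S.a₀ * S.b₁ - S.a₁ * S.b₀ : ℂ) * _ = 0)).resolve_left hΔ)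
      linear_combination S.a₀ * (e2 - (1 - l) * hη) - S.b₀ * (e1 - (1 - l) * hξ)
    have hl1 : l ≠ 1 := by
      rintro rfl
      apply hQQ'
      apply complexify_injective
      ext i
      fin_cases i
      · simpa [complexify] using hx
      · simpa [complexify] using hy
    -- This is the power of `Z` with respect to the circle, the same for all circles. It comes from
    -- expanding `κ` at `Z` and cancelling `l - 1`.
    have hC : l * ((Q 0 - Z 0 : ℂ) ^ 2 + (Q 1 - Z 1) ^ 2) =
        Z 0 ^ 2 + Z 1 ^ 2 + (S.c₀ * Z 0 + S.c₁ * Z 1 + S.c₂) := by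
      refine sub_eq_zero.1 ((mul_eq_zero.1 (?_ : (l - 1) * _ = 0)).resolve_left (sub_ne_zero.2 hl1))
      have hx' : (Q' 0 : ℂ) = Z 0 + l * (Q 0 - Z 0) := by linear_combination hx
      have hy' : (Q' 1 : ℂ) = Z 1 + l * (Q 1 - Z 1) := by linear_combination hy
      rw [hx', hy'] at e0
      linear_combination e0
    have hl0 : l ≠ 0 := by
      rintro rfl
      apply hη'
      rw [e2]
      ring
    have hP : ∀ i, chPoint n d a t i = Q i := fun i => by rw [← hQt]; rfl
    have hP' : ∀ i, chPoint n d a τ i = Q' i := fun i => by rw [← hQτ]; rfl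
    refine ⟨τ, l, hτ, ?_, ?_, ?_⟩
    · intro i
      rw [hP, hP']
      fin_cases i
      exacts [hx, hy]
    · rw [hP, hP]
      exact hC
    · rw [← hC]
      refine mul_ne_zero hl0 ?_
      intro h0
      have h0' : (Q 0 - Z 0) ^ 2 + (Q 1 - Z 1) ^ 2 = 0 := by
        rw [← Complex.ofReal_eq_zero]
        push_cast
        exact h0
      have hx0 : Q 0 - Z 0 = 0 := by nlinarith [sq_nonneg (Q 0 - Z 0), sq_nonneg (Q 1 - Z 1)]
      have hy0 : Q 1 - Z 1 = 0 := by nlinarith [sq_nonneg (Q 0 - Z 0), sq_nonneg (Q 1 - Z 1)]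
      apply hη'
      have hx0' : (Q 0 : ℂ) = Z 0 := by exact_mod_cast sub_eq_zero.1 hx0
      have hy0' : (Q 1 : ℂ) = Z 1 := by exact_mod_cast sub_eq_zero.1 hy0
      rw [e2, hx0', hy0', hη, mul_zero]
  obtain ⟨t, ht, htb⟩ := (infinite_unit_circle.sdiff hbad).nonempty
  obtain ⟨-, -, -, -, -, hC⟩ := key t ht htb
  refine ⟨bad, hbad, hC, fun t ht htb => ?_⟩
  obtain ⟨τ, l, h1, h2, h3, -⟩ := key t ht htb
  exact ⟨τ, l, h1, h2, h3⟩

/-- Inversion in the pole preserves `(x + i y) / (x - i y) = t^(2d)`, so the partner of `t` is `ζ t`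
for a `2d`-th root of unity `ζ`, and the squared radii at `t` and `ζ t` have the nonzero constant
product `C²`. One `ζ` works identically in `t`, and a complex zero of the radius contradicts it. -/
theorem circleInjective_of_origin (hn : 0 < n) (hd : 0 < d) (hne : n ≠ d)
    (hξ : S.xi 1 (0 : ℂ) 0 = 0) (hη : S.eta 1 (0 : ℂ) 0 = 0) : CircleInjective S n d a := by
  by_contra h
  obtain ⟨bad, hbad, hC, hb⟩ := exists_inversion_partner S hn hd hne h (Z := 0)
    (by simpa using hξ) (by simpa using hη)
  set C := S.kappa 1 (((0 : E2) 0 : ℝ) : ℂ) ((0 : E2) 1 : ℝ) with hCdef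
  have hsq : ∀ t : ℂ, t ≠ 0 → (chPoint n d a t 0 ^ 2 + chPoint n d a t 1 ^ 2) * (4 * t ^ (2 * n)) =
      (chRadius n a).eval t ^ 2 := by
    intro t ht
    obtain ⟨h1, h2⟩ := chPoint_isotropic (n := n) (d := d) (a := a) ht
    have h3 : chPoint n d a t 0 ^ 2 + chPoint n d a t 1 ^ 2 =
        (chPoint n d a t 0 + Complex.I * chPoint n d a t 1) *
        (chPoint n d a t 0 - Complex.I * chPoint n d a t 1) := by
      linear_combination chPoint n d a t 1 ^ 2 * Complex.I_sq
    rw [h3, h1, h2]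
    field_simp
    ring
  set P : ℂ → Polynomial ℂ := fun ζ =>
    ((chRadius n a).comp (Polynomial.C ζ * Polynomial.X)) ^ 2 * chRadius n a ^ 2 -
      Polynomial.C (16 * C ^ 2 * ζ ^ (2 * n)) * Polynomial.X ^ (4 * n) with hP
  -- The root `ζ` may depend on `t`; the product over all of them vanishes at infinitely many `t`,
  -- so some factor is zero.
  have hprod : ∏ ζ ∈ Polynomial.nthRootsFinset (2 * d) (1 : ℂ), P ζ = 0 := by
    refine Polynomial.eq_zero_of_infinite_isRoot _ ((infinite_unit_circle.sdiff hbad).mono ?_)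
    rintro t ⟨ht, htb⟩
    rw [Set.mem_ofPred_eq] at ht
    have ht0 : t ≠ 0 := by
      rintro rfl
      simp at ht
    obtain ⟨τ, l, hτ, hl, hlC⟩ := hb t ht htb
    have hτ0 : τ ≠ 0 := by
      rintro rfl
      simp at hτ
    simp only [PiLp.zero_apply, Complex.ofReal_zero, sub_zero] at hl hlC
    have hN : chPoint n d a τ 0 ^ 2 + chPoint n d a τ 1 ^ 2 = l * C := by
      rw [hl, hl, ← hlC]
      ring
    have hl0 : l ≠ 0 := by
      rintro rfl
      rw [zero_mul] at hlC
      exact hC hlC.symm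
    obtain ⟨h1, h2⟩ := chPoint_isotropic (n := n) (d := d) (a := a) ht0
    obtain ⟨h1', h2'⟩ := chPoint_isotropic (n := n) (d := d) (a := a) hτ0
    rw [← h2] at h1
    rw [← h2'] at h1'
    have hwb : chPoint n d a τ 0 - Complex.I * chPoint n d a τ 1 ≠ 0 := by
      intro h0
      apply mul_ne_zero hl0 hC
      rw [← hN]
      linear_combination (chPoint n d a τ 0 + Complex.I * chPoint n d a τ 1) * h0 +
        chPoint n d a τ 1 ^ 2 * Complex.I_sq
    have hpow : τ ^ (2 * d) = t ^ (2 * d) := by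
      refine mul_right_cancel₀ hwb ?_
      rw [← h1', hl, hl]
      linear_combination l * h1
    have hroot : (τ / t) ^ (2 * d) = 1 := by
      rw [div_pow, hpow, div_self (pow_ne_zero _ ht0)]
    rw [Set.mem_ofPred_eq, Polynomial.IsRoot, Polynomial.eval_prod]
    refine Finset.prod_eq_zero ((Polynomial.mem_nthRootsFinset (by omega) _).2 hroot) ?_
    have e1 : τ / t * t = τ := div_mul_cancel₀ _ ht0
    simp only [hP, Polynomial.eval_sub, Polynomial.eval_mul, Polynomial.eval_pow,
      Polynomial.eval_comp, Polynomial.eval_C, Polynomial.eval_X, e1]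
    have e2 : (τ / t) ^ (2 * n) * t ^ (4 * n) = τ ^ (2 * n) * t ^ (2 * n) := by
      rw [show 4 * n = 2 * n + 2 * n by ring, pow_add, ← mul_assoc, ← mul_pow, e1]
    rw [← hsq t ht0, ← hsq τ hτ0, hN]
    linear_combination 16 * τ ^ (2 * n) * t ^ (2 * n) * C * hlC - 16 * C ^ 2 * e2
  obtain ⟨ζ, hζ, hPζ⟩ := Finset.prod_eq_zero_iff.1 hprod
  rw [Polynomial.mem_nthRootsFinset (by omega)] at hζ
  have hdeg : (chRadius n a).degree ≠ 0 := by
    have : (chRadius n a).coeff (2 * n) = 1 := by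
      rw [chRadius, Polynomial.coeff_add, Polynomial.coeff_add, Polynomial.coeff_C_mul_X_pow,
        Polynomial.coeff_X_pow, Polynomial.coeff_one]
      simp [hn.ne', show 2 * n ≠ n by omega]
    intro h0
    rw [Polynomial.coeff_eq_zero_of_degree_lt (by rw [h0]; exact_mod_cast (by omega : 0 < 2 * n))]
      at this
    exact zero_ne_one this
  obtain ⟨t₀, ht₀⟩ := IsAlgClosed.exists_root _ hdeg
  have ht₀' : t₀ ≠ 0 := by
    rintro rfl
    simp [chRadius, hn.ne'] at ht₀
  have := congrArg (Polynomial.eval t₀) hPζ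
  simp only [hP, Polynomial.eval_sub, Polynomial.eval_mul, Polynomial.eval_pow, ht₀.eq_zero,
    Polynomial.eval_C, Polynomial.eval_X, Polynomial.eval_zero] at this
  have hζ0 : ζ ≠ 0 := by
    rintro rfl
    rw [zero_pow (by omega)] at hζ
    exact zero_ne_one hζ
  simp [hC, hζ0, ht₀'] at this

/-- An inversion sends points near its centre to points far away, but the curve passes through the
centre and is bounded. -/
theorem circleInjective_of_mem (hn : 0 < n) (hd : 0 < d) (hne : n ≠ d) {Z : E2} (hZ : Z ∈ CH n d a)
    (hξ : S.xi 1 (Z 0 : ℂ) (Z 1) = 0) (hη : S.eta 1 (Z 0 : ℂ) (Z 1) = 0) :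
    CircleInjective S n d a := by
  by_contra h
  obtain ⟨bad, hbad, hC, hb⟩ := exists_inversion_partner S hn hd hne h hξ hη
  obtain ⟨t₀, ht₀, hZt⟩ := (mem_CH_iff hd Z).1 hZ
  set N : ℂ → ℂ := fun t => (chPoint n d a t 0 - Z 0) ^ 2 + (chPoint n d a t 1 - Z 1) ^ 2 with hN
  have hcont : ∀ t : ℂ, ‖t‖ = 1 → ContinuousAt N t := by
    intro t ht
    have ht0 : t ≠ 0 := by
      rintro rfl
      simp at ht
    have h0 : ContinuousAt (fun t => chPoint n d a t 0) t :=
      (Polynomial.continuous (chX n d a)).continuousAt.div (continuous_pow (n + d)).continuousAt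
        (pow_ne_zero _ ht0)
    have h1 : ContinuousAt (fun t => chPoint n d a t 1) t :=
      (Polynomial.continuous (chY n d a)).continuousAt.div (continuous_pow (n + d)).continuousAt
        (pow_ne_zero _ ht0)
    exact ((h0.sub continuousAt_const).pow 2).add ((h1.sub continuousAt_const).pow 2)
  obtain ⟨b, hbound⟩ := (isCompact_sphere (0 : ℂ) 1).exists_bound_of_continuousOn (f := N)
    fun t ht => (hcont t (by simpa using ht)).continuousWithinAt
  have hN0 : N t₀ = 0 := by
    have h0 : chPoint n d a t₀ 0 = Z 0 := by rw [← hZt]; rfl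
    have h1 : chPoint n d a t₀ 1 = Z 1 := by rw [← hZt]; rfl
    simp [hN, h0, h1]
  -- The unit circle has no isolated points, so admissible parameters occur arbitrarily near `t₀`
  -- even after removing the exceptional ones.
  have hacc : AccPt t₀ (Filter.principal (Metric.sphere (0 : ℂ) 1)) := by
    refine IsPreconnected.preperfect_of_nontrivial ?_ (isPreconnected_sphere ?_ 0 1) t₀
      (by simpa using ht₀)
    · exact ⟨1, by simp, -1, by simp, by norm_num⟩
    · rw [Complex.rank_real_complex]
      exact_mod_cast one_lt_two
  rw [accPt_iff_frequently_nhdsNE] at hacc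
  have hbad' : ∀ᶠ t in nhdsWithin t₀ {t₀}ᶜ, t ∉ bad := by
    have : ∀ᶠ t in nhds t₀, t ∉ bad \ {t₀} :=
      (hbad.subset Set.sdiff_subset).isClosed.isOpen_compl.mem_nhds (by simp)
    filter_upwards [this.filter_mono nhdsWithin_le_nhds, self_mem_nhdsWithin] with t h1 h2 h3
    exact h1 ⟨h3, h2⟩
  have hsmall : ∀ᶠ t in nhdsWithin t₀ {t₀}ᶜ, b * ‖N t‖ < ‖S.kappa 1 (Z 0 : ℂ) (Z 1) ^ 2‖ := by
    have h1 : ContinuousAt (fun t => b * ‖N t‖) t₀ := continuousAt_const.mul (hcont t₀ ht₀).norm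
    refine (h1.eventually_lt continuousAt_const ?_).filter_mono nhdsWithin_le_nhds
    rw [hN0, norm_zero, mul_zero]
    exact norm_pos_iff.2 (pow_ne_zero _ hC)
  obtain ⟨t, ht, htb, hts⟩ := (hacc.and_eventually (hbad'.and hsmall)).exists
  obtain ⟨τ, l, hτ, hl, hlC⟩ := hb t (by simpa using ht) htb
  have h1 : N τ * N t = S.kappa 1 (Z 0 : ℂ) (Z 1) ^ 2 := by
    simp only [hN]
    rw [hl, hl, ← hlC]
    ring
  rw [← h1, norm_mul] at hts
  exact absurd hts (not_lt.2 (mul_le_mul_of_nonneg_right (hbound τ (by simpa using hτ))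
    (norm_nonneg _)))

end Axis

/-! ### The polynomial coordinates of the circles -/

section Affine

variable {n d : ℕ} {a : ℝ}

/-- The affine function `u x + v y + w` on the cyclic-harmonic curve, times `t ^ (n + d)`. -/
noncomputable def chAffine (n d : ℕ) (a : ℝ) (u v w : ℂ) : Polynomial ℂ :=
  Polynomial.C u * chX n d a + Polynomial.C v * chY n d a + Polynomial.C w * Polynomial.X ^ (n + d)

theorem natDegree_chRadius_le : (chRadius n a).natDegree ≤ 2 * n := by
  rw [chRadius]
  refine Polynomial.natDegree_add_le_of_degree_le (Polynomial.natDegree_add_le_of_degree_le ?_ ?_) ?_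
  · simp
  · exact (Polynomial.natDegree_C_mul_X_pow_le _ _).trans (by omega)
  · simp

theorem coeff_chRadius (hn : 0 < n) : (chRadius n a).coeff (2 * n) = 1 := by
  rw [chRadius, Polynomial.coeff_add, Polynomial.coeff_add, Polynomial.coeff_C_mul_X_pow,
    Polynomial.coeff_X_pow, Polynomial.coeff_one]
  simp [hn.ne', show 2 * n ≠ n by omega]

theorem natDegree_chRadius (hn : 0 < n) : (chRadius n a).natDegree = 2 * n :=
  Polynomial.natDegree_eq_of_le_of_coeff_ne_zero natDegree_chRadius_le
    (by rw [coeff_chRadius hn]; exact one_ne_zero)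

theorem natDegree_coeff_mul_chRadius (hn : 0 < n) (hd : 0 < d) (b c : ℂ) :
    (Polynomial.C b * (Polynomial.X ^ (2 * d) + Polynomial.C c) * chRadius n a).natDegree ≤
      2 * (n + d) ∧
    (Polynomial.C b * (Polynomial.X ^ (2 * d) + Polynomial.C c) * chRadius n a).coeff
      (2 * (n + d)) = b := by
  have h1 : (Polynomial.C b * (Polynomial.X ^ (2 * d) + Polynomial.C c)).natDegree ≤ 2 * d :=
    (Polynomial.natDegree_C_mul_le _ _).trans
      (Polynomial.natDegree_add_le_of_degree_le (by simp) (by simp))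
  rw [show 2 * (n + d) = 2 * d + 2 * n by ring]
  refine ⟨Polynomial.natDegree_mul_le_of_le h1 natDegree_chRadius_le, ?_⟩
  rw [Polynomial.coeff_mul_add_eq_of_natDegree_le h1 natDegree_chRadius_le, coeff_chRadius hn]
  simp [Polynomial.coeff_C, hd.ne']

theorem natDegree_chX_le (hn : 0 < n) (hd : 0 < d) : (chX n d a).natDegree ≤ 2 * (n + d) := by
  simpa [chX] using (natDegree_coeff_mul_chRadius (a := a) hn hd (1 / 4) 1).1

theorem natDegree_chY_le (hn : 0 < n) (hd : 0 < d) : (chY n d a).natDegree ≤ 2 * (n + d) := by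
  simpa [chY, sub_eq_add_neg] using (natDegree_coeff_mul_chRadius (a := a) hn hd (-Complex.I / 4) (-1)).1

theorem coeff_chX (hn : 0 < n) (hd : 0 < d) : (chX n d a).coeff (2 * (n + d)) = 1 / 4 := by
  simpa [chX] using (natDegree_coeff_mul_chRadius (a := a) hn hd (1 / 4) 1).2

theorem coeff_chY (hn : 0 < n) (hd : 0 < d) : (chY n d a).coeff (2 * (n + d)) = -Complex.I / 4 := by
  simpa [chY, sub_eq_add_neg] using (natDegree_coeff_mul_chRadius (a := a) hn hd (-Complex.I / 4) (-1)).2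

theorem natDegree_chAffine_le (hn : 0 < n) (hd : 0 < d) (u v w : ℂ) :
    (chAffine n d a u v w).natDegree ≤ 2 * (n + d) := by
  refine Polynomial.natDegree_add_le_of_degree_le (Polynomial.natDegree_add_le_of_degree_le ?_ ?_) ?_
  · exact (Polynomial.natDegree_C_mul_le _ _).trans (natDegree_chX_le hn hd)
  · exact (Polynomial.natDegree_C_mul_le _ _).trans (natDegree_chY_le hn hd)
  · exact (Polynomial.natDegree_C_mul_X_pow_le _ _).trans (by omega)

theorem coeff_chAffine (hn : 0 < n) (hd : 0 < d) (u v w : ℂ) :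
    (chAffine n d a u v w).coeff (2 * (n + d)) = (u - Complex.I * v) / 4 := by
  rw [chAffine, Polynomial.coeff_add, Polynomial.coeff_add, Polynomial.coeff_C_mul,
    Polynomial.coeff_C_mul, coeff_chX hn hd, coeff_chY hn hd, Polynomial.coeff_C_mul_X_pow,
    if_neg (by omega)]
  ring

theorem eval_zero_chAffine (hn : 0 < n) (hd : 0 < d) (u v w : ℂ) :
    (chAffine n d a u v w).eval 0 = (u + Complex.I * v) / 4 := by
  simp [chAffine, chX, chY, chRadius, hn.ne', hd.ne']
  ring

theorem chAffine_add (b c u v w u' v' w' : ℂ) :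
    Polynomial.C b * chAffine n d a u v w + Polynomial.C c * chAffine n d a u' v' w' =
      chAffine n d a (b * u + c * u') (b * v + c * v') (b * w + c * w') := by
  simp only [chAffine, Polynomial.C_add, Polynomial.C_mul]
  ring

theorem eval_chAffine {t : ℂ} (ht : t ≠ 0) (u v w : ℂ) : (chAffine n d a u v w).eval t =
    t ^ (n + d) * (u * chPoint n d a t 0 + v * chPoint n d a t 1 + w) := by
  simp only [chAffine, chPoint, Polynomial.eval_add, Polynomial.eval_mul, Polynomial.eval_C,
    Polynomial.eval_pow, Polynomial.eval_X, Matrix.cons_val_zero, Matrix.cons_val_one]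
  field_simp

theorem chAffine_ne_zero (hn : 0 < n) (hd : 0 < d) (hne : n ≠ d) {u v w : ℂ}
    (h : ¬ (u = 0 ∧ v = 0 ∧ w = 0)) : chAffine n d a u v w ≠ 0 := by
  intro h0
  refine h (linearIndependent_circles (a := a) hn hd hne (α := 0) ?_).2
  have : Polynomial.X ^ (n + d) * chAffine n d a u v w = 0 := by rw [h0, mul_zero]
  rw [← this, chAffine, Polynomial.C_0]
  ring

theorem sq_chX_add_sq_chY : chX n d a ^ 2 + chY n d a ^ 2 =
    Polynomial.C (1 / 4) * Polynomial.X ^ (2 * d) * chRadius n a ^ 2 := by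
  have h1 := chX_add_chY (n := n) (d := d) (a := a)
  have h2 := chX_sub_chY (n := n) (d := d) (a := a)
  have hI : (Polynomial.C Complex.I) ^ 2 = (-1 : Polynomial ℂ) := by
    rw [← Polynomial.C_pow, Complex.I_sq, Polynomial.C_neg, Polynomial.C_1]
  have hh : (Polynomial.C (1 / 4) : Polynomial ℂ) = Polynomial.C (1 / 2) * Polynomial.C (1 / 2) := by
    rw [← Polynomial.C_mul]; norm_num
  have h3 : chX n d a ^ 2 + chY n d a ^ 2 = (chX n d a + Polynomial.C Complex.I * chY n d a) *
      (chX n d a - Polynomial.C Complex.I * chY n d a) := by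
    linear_combination chY n d a ^ 2 * hI
  rw [h3, h1, h2, hh]
  ring

end Affine

section Polys

variable {n d : ℕ} {a : ℝ} (S : CirclePlane)

/-- The polynomial coordinates `(κ : ξ : η)` of the circles through the points of the curve. -/
noncomputable def circlePoly (n d : ℕ) (a : ℝ) : Fin 3 → Polynomial ℂ :=
  ![Polynomial.C (1 / 4) * Polynomial.X ^ (d - n) * chRadius n a ^ 2 +
      Polynomial.X ^ (n - d) * chAffine n d a S.c₀ S.c₁ S.c₂,
    Polynomial.X ^ (n - d) * chAffine n d a S.a₀ S.a₁ S.a₂,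
    Polynomial.X ^ (n - d) * chAffine n d a S.b₀ S.b₁ S.b₂]

/-- Since `x² + y²` is the square of the radius polynomial over `4 t^(2n)`, the common denominator
of the triple is `t^max(2n, n + d)`. The truncated exponents `d - n` and `n - d` express this in
both cases at once. -/
theorem X_pow_mul_circlePoly_zero : Polynomial.X ^ (n + d) * circlePoly S n d a 0 =
    Polynomial.X ^ (n - d) * S.kappa (Polynomial.X ^ (n + d)) (chX n d a) (chY n d a) := by
  rw [CirclePlane.kappa, sq_chX_add_sq_chY, mul_add, mul_add]
  change Polynomial.X ^ (n + d) * (Polynomial.C (1 / 4) * Polynomial.X ^ (d - n) * chRadius n a ^ 2 +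
      Polynomial.X ^ (n - d) * chAffine n d a S.c₀ S.c₁ S.c₂) = _
  have h : (Polynomial.X ^ (n + d) * Polynomial.X ^ (d - n) : Polynomial ℂ) =
      Polynomial.X ^ (n - d) * Polynomial.X ^ (2 * d) := by
    rw [← pow_add, ← pow_add]
    congr 1
    omega
  simp only [chAffine, Polynomial.C_eq_algebraMap]
  linear_combination (algebraMap ℂ (Polynomial ℂ) (1 / 4) * chRadius n a ^ 2) * h

theorem map_circlePoly {B : Type} [Field B] [Algebra ℂ B] (φ : Polynomial ℂ →ₐ[ℂ] B)
    (hφ : φ Polynomial.X ≠ 0) (i : Fin 3) : φ (circlePoly S n d a i) =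
      φ Polynomial.X ^ (n + d + (n - d)) *
        S.triple (φ (chX n d a) / φ Polynomial.X ^ (n + d)) (φ (chY n d a) / φ Polynomial.X ^ (n + d)) i := by
  have hT : φ Polynomial.X ^ (n + d) ≠ 0 := pow_ne_zero _ hφ
  have hC : ∀ c : ℂ, φ (Polynomial.C c) = algebraMap ℂ B c := fun c => φ.commutes c
  rw [pow_add]
  fin_cases i
  · apply mul_left_cancel₀ hT
    have := congrArg φ (X_pow_mul_circlePoly_zero (n := n) (d := d) (a := a) S)
    rw [map_mul, map_mul, S.map_kappa, map_pow, map_pow] at this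
    change _ * φ (circlePoly S n d a 0) = _
    rw [this]
    simp only [CirclePlane.triple, CirclePlane.kappa, Fin.zero_eta, Matrix.cons_val_zero]
    field_simp
  · change φ (Polynomial.X ^ (n - d) * chAffine n d a S.a₀ S.a₁ S.a₂) = _ *
      S.xi 1 (φ (chX n d a) / φ Polynomial.X ^ (n + d)) (φ (chY n d a) / φ Polynomial.X ^ (n + d))
    simp only [chAffine, map_mul, map_add, map_pow, hC, CirclePlane.xi]
    field_simp
  · change φ (Polynomial.X ^ (n - d) * chAffine n d a S.b₀ S.b₁ S.b₂) = _ *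
      S.eta 1 (φ (chX n d a) / φ Polynomial.X ^ (n + d)) (φ (chY n d a) / φ Polynomial.X ^ (n + d))
    simp only [chAffine, map_mul, map_add, map_pow, hC, CirclePlane.eta]
    field_simp

theorem toRat_circlePoly : toRat (circlePoly S n d a) = fun i =>
    algebraMap (Polynomial ℂ) (RatFunc ℂ) Polynomial.X ^ (n + d + (n - d)) *
      S.triple (chRat n d a 0) (chRat n d a 1) i := by
  ext i : 1
  have := map_circlePoly (n := n) (d := d) (a := a) S
    (IsScalarTower.toAlgHom ℂ (Polynomial ℂ) (RatFunc ℂ))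
    (algebraMap_ratFunc_ne_zero Polynomial.X_ne_zero) i
  simp only [IsScalarTower.coe_toAlgHom'] at this
  rw [toRat, this]
  simp [chRat]

theorem ratioField_circlePoly : ratioField (toRat (circlePoly S n d a)) = circleField S n d a := by
  rw [toRat_circlePoly, ratioField_smul, circleField]
  exact pow_ne_zero _ (algebraMap_ratFunc_ne_zero Polynomial.X_ne_zero)

theorem eval_circlePoly {t : ℂ} (ht : t ≠ 0) (i : Fin 3) : (circlePoly S n d a i).eval t =
    t ^ (n + d + (n - d)) * S.triple (chPoint n d a t 0) (chPoint n d a t 1) i := by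
  have := map_circlePoly (n := n) (d := d) (a := a) S (Polynomial.aeval t) (by simpa using ht) i
  simpa [chPoint] using this

theorem natDegree_circlePoly_le (hn : 0 < n) (hd : 0 < d) (i : Fin 3) :
    (circlePoly S n d a i).natDegree ≤ 2 * (n + d + (n - d)) := by
  have h : ∀ u v w, (Polynomial.X ^ (n - d) * chAffine n d a u v w).natDegree ≤
      2 * (n + d + (n - d)) := fun u v w =>
    (Polynomial.natDegree_mul_le_of_le (Polynomial.natDegree_X_pow_le _)
      (natDegree_chAffine_le hn hd u v w)).trans (by omega)
  fin_cases i
  · refine Polynomial.natDegree_add_le_of_degree_le ?_ (h _ _ _)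
    refine (Polynomial.natDegree_mul_le_of_le (Polynomial.natDegree_C_mul_X_pow_le _ _)
      (Polynomial.natDegree_pow_le_of_le 2 natDegree_chRadius_le)).trans ?_
    omega
  · exact h _ _ _
  · exact h _ _ _

/-- A real linear form vanishing on `(1, ±i)` is zero. The numbers here govern the leading and
constant coefficients of `ξ` and `η`. -/
theorem exists_ne_zero (s : ℂ) (hs : s = Complex.I ∨ s = -Complex.I) :
    (S.a₀ : ℂ) + s * S.a₁ ≠ 0 ∨ (S.b₀ : ℂ) + s * S.b₁ ≠ 0 := by
  by_contra! h
  obtain ⟨h1, h2⟩ := h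
  have r1 := congrArg Complex.re h1
  have i1 := congrArg Complex.im h1
  have r2 := congrArg Complex.re h2
  have i2 := congrArg Complex.im h2
  rcases hs with rfl | rfl <;> simp at r1 i1 r2 i2 <;> exact S.nonconstant ⟨r1, i1, r2, i2⟩

theorem exists_coeff_chAffine_ne_zero (hn : 0 < n) (hd : 0 < d) :
    (chAffine n d a S.a₀ S.a₁ S.a₂).coeff (2 * (n + d)) ≠ 0 ∨
      (chAffine n d a S.b₀ S.b₁ S.b₂).coeff (2 * (n + d)) ≠ 0 := by
  simp only [coeff_chAffine hn hd]
  refine (exists_ne_zero S (-Complex.I) (Or.inr rfl)).imp (fun h => ?_) fun h => ?_ <;>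
  · refine div_ne_zero ?_ (by norm_num)
    rwa [sub_eq_add_neg, ← neg_mul]

theorem exists_eval_zero_chAffine_ne_zero (hn : 0 < n) (hd : 0 < d) :
    (chAffine n d a S.a₀ S.a₁ S.a₂).eval 0 ≠ 0 ∨ (chAffine n d a S.b₀ S.b₁ S.b₂).eval 0 ≠ 0 := by
  simp only [eval_zero_chAffine hn hd]
  exact (exists_ne_zero S Complex.I (Or.inl rfl)).imp (fun h => div_ne_zero h (by norm_num))
    fun h => div_ne_zero h (by norm_num)

theorem max_natDegree_chAffine (hn : 0 < n) (hd : 0 < d) :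
    max (chAffine n d a S.a₀ S.a₁ S.a₂).natDegree (chAffine n d a S.b₀ S.b₁ S.b₂).natDegree =
      2 * (n + d) := by
  refine le_antisymm (max_le (natDegree_chAffine_le hn hd _ _ _) (natDegree_chAffine_le hn hd _ _ _)) ?_
  rcases exists_coeff_chAffine_ne_zero (a := a) S hn hd with h | h
  · exact le_max_of_le_left (Polynomial.le_natDegree_of_ne_zero h)
  · exact le_max_of_le_right (Polynomial.le_natDegree_of_ne_zero h)

/-- For `n < d` the degree is reached by `ξ` or `η`, for `d < n` by the squared radius in `κ`. -/
theorem exists_coeff_circlePoly_ne_zero (hn : 0 < n) (hd : 0 < d) (hne : n ≠ d) :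
    ∃ i, (circlePoly S n d a i).coeff (2 * (n + d + (n - d))) ≠ 0 := by
  rcases lt_or_gt_of_ne hne with h | h
  · have h0 : n - d = 0 := by omega
    rcases exists_coeff_chAffine_ne_zero (a := a) S hn hd with h1 | h1
    · exact ⟨1, by simpa [circlePoly, h0] using h1⟩
    · exact ⟨2, by simpa [circlePoly, h0] using h1⟩
  · refine ⟨0, ?_⟩
    have h0 : d - n = 0 := by omega
    have h1 : (Polynomial.X ^ (n - d) * chAffine n d a S.c₀ S.c₁ S.c₂).coeff
        (2 * (n + d + (n - d))) = 0 := by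
      refine Polynomial.coeff_eq_zero_of_natDegree_lt ?_
      refine lt_of_le_of_lt (Polynomial.natDegree_mul_le_of_le (Polynomial.natDegree_X_pow_le _)
        (natDegree_chAffine_le hn hd _ _ _)) ?_
      omega
    have h2 : (chRadius n a ^ 2).coeff (2 * (n + d + (n - d))) = 1 := by
      rw [show 2 * (n + d + (n - d)) = 2 * (2 * n) by omega,
        Polynomial.coeff_pow_of_natDegree_le natDegree_chRadius_le, coeff_chRadius hn, one_pow]
    change (Polynomial.C (1 / 4) * Polynomial.X ^ (d - n) * chRadius n a ^ 2 + _).coeff _ ≠ 0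
    rw [Polynomial.coeff_add, h1, h0, pow_zero, mul_one, Polynomial.coeff_C_mul, h2]
    norm_num

theorem exists_eval_zero_circlePoly_ne_zero (hn : 0 < n) (hd : 0 < d) (hne : n ≠ d) :
    ∃ i, (circlePoly S n d a i).eval 0 ≠ 0 := by
  rcases lt_or_gt_of_ne hne with h | h
  · have h0 : n - d = 0 := by omega
    rcases exists_eval_zero_chAffine_ne_zero (a := a) S hn hd with h1 | h1
    · exact ⟨1, by simpa [circlePoly, h0] using h1⟩
    · exact ⟨2, by simpa [circlePoly, h0] using h1⟩
  · refine ⟨0, ?_⟩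
    have h0 : d - n = 0 := by omega
    have h1 : n - d ≠ 0 := by omega
    simp [circlePoly, h0, h1, chRadius, hn.ne']

theorem circlePoly_independent (hn : 0 < n) (hd : 0 < d) (hne : n ≠ d) {c : Fin 3 → ℂ}
    (h : ∑ i, Polynomial.C (c i) * circlePoly S n d a i = 0) : c = 0 := by
  have hX : algebraMap (Polynomial ℂ) (RatFunc ℂ) Polynomial.X ^ (n + d + (n - d)) ≠ 0 :=
    pow_ne_zero _ (algebraMap_ratFunc_ne_zero Polynomial.X_ne_zero)
  have h1 := sum_smul_toRat (circlePoly S n d a) c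
  rw [h, map_zero, toRat_circlePoly, Fin.sum_univ_three] at h1
  simp only [← mul_smul_comm, ← mul_add] at h1
  have h2 := (mul_eq_zero.1 h1).resolve_left hX
  simp only [CirclePlane.triple, CirclePlane.kappa, CirclePlane.xi, CirclePlane.eta,
    Matrix.cons_val_zero, Matrix.cons_val_one, Matrix.cons_val, Algebra.smul_def, mul_one,
    one_mul] at h2
  obtain ⟨hα, hβ, hγ, hδ⟩ := chRat_independent (a := a) hn hd hne (α := c 0)
    (β := c 0 * S.c₀ + c 1 * S.a₀ + c 2 * S.b₀) (γ := c 0 * S.c₁ + c 1 * S.a₁ + c 2 * S.b₁)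
    (δ := c 0 * S.c₂ + c 1 * S.a₂ + c 2 * S.b₂) (by
      rw [← h2]
      simp only [map_add, map_mul]
      ring)
  simp only [hα, zero_mul, zero_add] at hβ hγ hδ
  obtain ⟨h1, h2⟩ := S.independent hβ hγ hδ
  ext i
  fin_cases i
  exacts [hα, h1, h2]

end Polys

/-! ### The circular surface of a cyclic-harmonic curve -/

theorem IsFormGenerator.of_smul {P : Fin 3 → RatFunc ℂ} {ρ : RatFunc ℂ} (hρ : ρ ≠ 0)
    {G : MvPolynomial (Fin 3) ℂ} {g : ℕ} (h : IsFormGenerator (fun i => ρ * P i) G g) :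
    IsFormGenerator P G g := by
  refine ⟨h.isHomogeneous, h.ne_zero, ?_, fun A k hA hAP => h.dvd A k hA ?_⟩
  · have := h.aeval_eq_zero
    rw [aeval_smul_of_isHomogeneous h.isHomogeneous] at this
    exact (mul_eq_zero.1 this).resolve_left (pow_ne_zero _ hρ)
  · rw [aeval_smul_of_isHomogeneous hA, hAP, mul_zero]

/-- Otherwise the cofactor is a form of smaller degree that still vanishes at `P`, although `G` must
divide it. -/
theorem IsFormGenerator.not_X_dvd {P : Fin 3 → RatFunc ℂ} {G : MvPolynomial (Fin 3) ℂ} {g : ℕ}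
    (h : IsFormGenerator P G g) (hP : P 0 ≠ 0) : ¬ X 0 ∣ G := by
  rintro ⟨B, rfl⟩
  have hB : B ≠ 0 := right_ne_zero_of_mul h.ne_zero
  have hBP : aeval P B = 0 := by
    have := h.aeval_eq_zero
    rw [map_mul, aeval_X] at this
    exact (mul_eq_zero.1 this).resolve_left hP
  have hBh : B.IsHomogeneous B.totalDegree := by
    have h1 := h.isHomogeneous
    have h2 : (X 0 * B).totalDegree = B.totalDegree + 1 := by
      rw [totalDegree_mul_of_isDomain (X_ne_zero _) hB, totalDegree_X, add_comm]
    intro m hm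
    have h3 := h1 (d := Finsupp.single 0 1 + m) (by rwa [coeff_X_mul])
    rw [h1.totalDegree h.ne_zero] at h2
    rw [map_add, Finsupp.weight_single, h2] at h3
    simp at h3
    rw [← add_comm 1] at h3
    exact Nat.add_left_cancel h3
  obtain ⟨A, hA⟩ := h.dvd B _ hBh hBP
  have h4 : B * 1 = B * (X 0 * A) := by
    rw [mul_one]
    conv_lhs => rw [hA]
    ring
  have h5 := mul_left_cancel₀ hB h4
  have h6 := congrArg (eval (0 : Fin 3 → ℂ)) h5
  simp at h6

section Surface

variable {n d : ℕ} {a q : ℝ} {S : CirclePlane} {ι : E2 →ᵃⁱ[ℝ] E3}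

/-- With `c = 2 q` this removes the circles of radius zero at all but finitely many parameters. -/
theorem kappa_add_chRat_ne_zero (hn : 0 < n) (hd : 0 < d) (hne : n ≠ d) (c : ℂ) :
    S.kappa 1 (chRat n d a 0) (chRat n d a 1) + algebraMap ℂ (RatFunc ℂ) c ≠ 0 := by
  intro h
  refine one_ne_zero (chRat_independent (a := a) hn hd hne (α := 1) (β := S.c₀) (γ := S.c₁)
    (δ := S.c₂ + c) ?_).1
  rw [← h]
  simp only [CirclePlane.kappa, map_one, map_add]
  ring

theorem isSurfaceEquation_circlePoly (hn : 0 < n) (hd : 0 < d) (hne : n ≠ d)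
    (hS : ∀ Q : E2, circleCoords q (ι Q) = S.triple (Q 0 : ℂ) (Q 1))
    {G : MvPolynomial (Fin 3) ℂ} {g e : ℕ}
    (hG : IsFormGenerator (toRat (circlePoly S n d a)) G g) (he : degreeOf 0 G = e) :
    IsSurfaceEquation (circularSurface q (ι '' CH n d a)) (surfaceForm q e G) := by
  have hpt : ∀ t : ℂ, t ≠ 0 → ∀ Q : E2, complexify Q = chPoint n d a t →
      ∀ i, (circlePoly S n d a i).eval t =
        t ^ (n + d + (n - d)) * circleCoords q (ι Q) i := by
    intro t ht Q hQ i
    rw [eval_circlePoly S ht, ← hQ, hS]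
    rfl
  have hη : aeval (chRat n d a) (S.eta 1 (X 0) (X 1) : MvPolynomial (Fin 2) ℂ) ≠ 0 := by
    rw [S.map_eta, map_one, aeval_X, aeval_X]
    exact eta_chRat_ne_zero S hn hd hne
  have hκ : aeval (chRat n d a) (S.kappa 1 (X 0) (X 1) + C (2 * q : ℂ) : MvPolynomial (Fin 2) ℂ) ≠ 0 := by
    rw [map_add, S.map_kappa, map_one, aeval_X, aeval_X, aeval_C]
    exact kappa_add_chRat_ne_zero hn hd hne _
  have hne0 : ∀ t : ℂ, ‖t‖ = 1 → t ≠ 0 := by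
    rintro t ht rfl
    simp at ht
  refine isSurfaceEquation_surfaceForm hG he ?_ (infinite_unit_circle.sdiff
    ((finite_chPoint_zeros hη).union (finite_chPoint_zeros hκ))) ?_
  · rintro _ ⟨Q, hQ, rfl⟩
    obtain ⟨t, ht, hQt⟩ := (mem_CH_iff hd Q).1 hQ
    exact ⟨t, _, pow_ne_zero _ (hne0 t ht), hpt t (hne0 t ht) Q hQt⟩
  · rintro t ⟨ht, hbad⟩
    have ht0 := hne0 t ht
    obtain ⟨Q, hQ, hQt⟩ := exists_real_chPoint (n := n) (a := a) hd ht
    have h0 : chPoint n d a t 0 = Q 0 := by rw [← hQt]; rfl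
    have h1 : chPoint n d a t 1 = Q 1 := by rw [← hQt]; rfl
    have hev : ∀ f : MvPolynomial (Fin 2) ℂ, eval (chPoint n d a t) f = aeval (chPoint n d a t) f :=
      fun f => by rw [aeval_eq_eval]
    refine ⟨ι Q, ⟨Q, hQ, rfl⟩, ?_, ?_, _, pow_ne_zero _ ht0, hpt t ht0 Q hQt⟩
    · intro hz
      refine hbad (Or.inl ⟨ht0, ?_⟩)
      rw [hev, S.map_eta, map_one, aeval_X, aeval_X, h0, h1]
      exact ((notMem_zAxis_iff hS Q).1 hz).2
    · intro hz
      refine hbad (Or.inr ⟨ht0, ?_⟩)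
      rw [hev, map_add, S.map_kappa, map_one, aeval_X, aeval_X, h0, h1, aeval_C]
      have h2 : S.kappa 1 (Q 0 : ℂ) (Q 1) = _ := (congrFun (hS Q) 0).symm
      rw [h2]
      change ((ι Q 0 ^ 2 + ι Q 1 ^ 2 + ι Q 2 ^ 2 - q : ℝ) : ℂ) + _ = 0
      rw [hz, Algebra.algebraMap_self, RingHom.id_apply]
      push_cast
      ring

theorem circlePoly_independent_pair (hn : 0 < n) (hd : 0 < d) (hne : n ≠ d) (b c : ℂ)
    (h : Polynomial.C b * circlePoly S n d a 1 + Polynomial.C c * circlePoly S n d a 2 = 0) :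
    b = 0 ∧ c = 0 := by
  have := circlePoly_independent S hn hd hne (a := a) (c := ![0, b, c])
    (by rw [Fin.sum_univ_three, ← h]; simp)
  exact ⟨congrFun this 1, congrFun this 2⟩

theorem exists_circlePoly_generator (hn : 0 < n) (hd : 0 < d) (hne : n ≠ d) :
    ∃ G g, IsFormGenerator (toRat (circlePoly S n d a)) G g := by
  have hlin := circlePoly_independent_pair (S := S) (a := a) hn hd hne
  refine exists_isFormGenerator ?_ (div_ne_C_of_linearIndependent hlin)
  refine algebraMap_ratFunc_ne_zero fun h => ?_
  exact one_ne_zero (hlin 0 1 (by rw [h]; simp)).2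

theorem circlePoly_zero_ne_zero (hn : 0 < n) (hd : 0 < d) (hne : n ≠ d) :
    circlePoly S n d a 0 ≠ 0 := by
  intro h
  have := circlePoly_independent S hn hd hne (a := a) (c := ![1, 0, 0])
    (by rw [Fin.sum_univ_three, h]; simp)
  exact one_ne_zero (congrFun this 0)

/-- The row of the surface of a cyclic-harmonic curve, in terms of the common factors of the
coordinates of its circles. -/
theorem exists_hasRow (hn : 0 < n) (hd : 0 < d) (hne : n ≠ d) {p : ℂ} (hp : p ^ 2 = q)
    {G : MvPolynomial (Fin 3) ℂ} {g e : ℕ}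
    (hG : IsFormGenerator (toRat (circlePoly S n d a)) G g) (he : degreeOf 0 G = e)
    {h r₁ r₂ : Polynomial ℂ} (hr : IsCoprime r₁ r₂)
    (h₁ : chAffine n d a S.a₀ S.a₁ S.a₂ = h * r₁) (h₂ : chAffine n d a S.b₀ S.b₁ S.b₂ = h * r₂)
    {k : Polynomial ℂ} {p' : Fin 3 → Polynomial ℂ} (hp' : ∀ i, circlePoly S n d a i = k * p' i)
    (hroot : ∀ t, ∃ i, (p' i).eval t ≠ 0) {δ c : ℕ}
    (hc : finrank (circleField S n d a) (RatFunc ℂ) = δ * c) :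
    ∃ E Γ : ℕ, E * c + h.natDegree = 2 * (n + d) ∧ Γ * c + k.natDegree = 2 * (n + d + (n - d)) ∧
      HasRow p (surfaceForm q e G ^ δ) (Γ + E) E (Γ - E) Γ := by
  have hlin := circlePoly_independent_pair (S := S) (a := a) hn hd hne
  have hk : k ≠ 0 := by
    rintro rfl
    exact circlePoly_zero_ne_zero (S := S) (a := a) hn hd hne (by rw [hp', zero_mul])
  have hk' := algebraMap_ratFunc_ne_zero hk
  have hkp : toRat (circlePoly S n d a) =
      fun i => algebraMap (Polynomial ℂ) (RatFunc ℂ) k * toRat p' i := by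
    ext i : 1
    rw [toRat, hp', map_mul, toRat]
  have hG' : IsFormGenerator (toRat p') G g := by
    rw [hkp] at hG
    exact hG.of_smul hk'
  have hfield : ratioField (toRat p') = circleField S n d a := by
    rw [← ratioField_circlePoly, hkp, ratioField_smul hk']
  have hE := degreeOf_mul_finrank_eq hG hlin hr (h := Polynomial.X ^ (n - d) * h)
    (by rw [mul_assoc, ← h₁]; rfl) (by rw [mul_assoc, ← h₂]; rfl)
  rw [ratioField_circlePoly, he, hc] at hE
  have hkD : ∀ i, (p' i).natDegree + k.natDegree ≤ 2 * (n + d + (n - d)) := by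
    intro i
    by_cases h0 : p' i = 0
    · obtain ⟨j, hj⟩ := hroot 0
      have hj0 : p' j ≠ 0 := by
        intro h
        simp [h] at hj
      have := natDegree_circlePoly_le (a := a) S hn hd j
      rw [hp', Polynomial.natDegree_mul hk hj0] at this
      rw [h0, Polynomial.natDegree_zero]
      omega
    · have := natDegree_circlePoly_le (a := a) S hn hd i
      rw [hp', Polynomial.natDegree_mul hk h0] at this
      omega
  have hΓ := degree_mul_finrank_eq hG' (D := 2 * (n + d + (n - d)) - k.natDegree) (by
    intro c hc
    refine circlePoly_independent S hn hd hne (a := a) ?_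
    have : ∑ i, Polynomial.C (c i) * circlePoly S n d a i = k * ∑ i, Polynomial.C (c i) * p' i := by
      rw [Finset.mul_sum]
      exact Finset.sum_congr rfl fun i _ => by rw [hp']; ring
    rw [this, hc, mul_zero]) hroot (fun i => by have := hkD i; omega) (by
    obtain ⟨i, hi⟩ := exists_coeff_circlePoly_ne_zero (a := a) S hn hd hne
    refine ⟨i, fun h0 => hi ?_⟩
    have h1 := hkD i
    rw [hp', show 2 * (n + d + (n - d)) = k.natDegree + (2 * (n + d + (n - d)) - k.natDegree) by omega,
      Polynomial.coeff_mul_add_eq_of_natDegree_le le_rfl (by omega), h0, mul_zero])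
  rw [hfield, hc] at hΓ
  -- The field degree contains the factor `δ`. Moving it to `e` and `g` gives the invariants of `F ^
  -- δ` and leaves only `c` in the degree formulas.
  refine ⟨e * δ, g * δ, ?_, ?_, ?_⟩
  · rw [mul_assoc, hE]
    have hr1 : r₁ ≠ 0 := by
      rintro rfl
      have := chAffine_ne_zero (a := a) hn hd hne (u := S.a₀) (v := S.a₁) (w := S.a₂) (by
        rintro ⟨h0, h1, h2⟩
        exact one_ne_zero (S.independent (b := 1) (c := 0) (by simp [h0]) (by simp [h1]) (by simp [h2])).1)
      exact this (by rw [h₁, mul_zero])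
    have hr2 : r₂ ≠ 0 ∧ h ≠ 0 := by
      rw [← mul_ne_zero_iff, mul_comm, ← h₂]
      refine chAffine_ne_zero (a := a) hn hd hne ?_
      rintro ⟨h0, h1, h2⟩
      exact one_ne_zero (S.independent (b := 0) (c := 1) (by simp [h0]) (by simp [h1]) (by simp [h2])).2
    have := max_natDegree_chAffine (a := a) S hn hd
    rw [h₁, h₂, Polynomial.natDegree_mul hr2.2 hr1, Polynomial.natDegree_mul hr2.2 hr2.1] at this
    omega
  · rw [mul_assoc, hΓ]
    obtain ⟨i, -⟩ := hroot 0
    have := hkD i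
    omega
  · rw [← surfaceForm_pow q he.le]
    have := hasRow_surfaceForm (G := G ^ δ) (g := g * δ) (e := e * δ) p q hp
      (hG.isHomogeneous.pow δ) (pow_ne_zero _ hG.ne_zero) (fun h => hG.not_X_dvd
        (algebraMap_ratFunc_ne_zero (circlePoly_zero_ne_zero hn hd hne)) (X_prime.dvd_of_dvd_pow h))
      (by rw [degreeOf_pow_eq _ _ _ hG.ne_zero, he, mul_comm])
    exact this

end Surface

/-! ### Points of the curve on the axis -/

theorem exists_homogenization (f : MvPolynomial (Fin 2) ℂ) :
    ∃ (A : MvPolynomial (Fin 3) ℂ) (k : ℕ), A.IsHomogeneous k ∧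
      ∀ (L : Type) [CommRing L] [Algebra ℂ L] (x y : L), aeval ![1, x, y] A = aeval ![x, y] f := by
  refine ⟨∑ i ∈ Finset.range (f.totalDegree + 1),
    X 0 ^ (f.totalDegree - i) * rename Fin.succ (homogeneousComponent i f), f.totalDegree,
    IsHomogeneous.sum _ _ _ fun i hi => ?_, fun L _ _ x y => ?_⟩
  · have h1 := (isHomogeneous_X_pow (R := ℂ) (0 : Fin 3) (f.totalDegree - i)).mul
      ((homogeneousComponent_isHomogeneous i f).rename_isHomogeneous (f := Fin.succ))
    rwa [Nat.sub_add_cancel (by simpa [Nat.lt_succ_iff] using hi)] at h1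
  · conv_rhs => rw [← sum_homogeneousComponent f, map_sum]
    rw [map_sum]
    refine Finset.sum_congr rfl fun i _ => ?_
    rw [map_mul, map_pow, aeval_X, aeval_rename]
    simp only [Matrix.cons_val_zero, one_pow, one_mul]
    congr 2

section Axis

variable {n d : ℕ} {a : ℝ}

theorem aeval_toRat_chAffine {A : MvPolynomial (Fin 3) ℂ} {k : ℕ} (hA : A.IsHomogeneous k) (x y : ℂ) :
    aeval (toRat ![Polynomial.X ^ (n + d), chAffine n d a 1 0 (-x), chAffine n d a 0 1 (-y)]) A = 0 ↔
      aeval ![1, chRat n d a 0 - algebraMap ℂ (RatFunc ℂ) x,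
        chRat n d a 1 - algebraMap ℂ (RatFunc ℂ) y] A = 0 := by
  have hX : algebraMap (Polynomial ℂ) (RatFunc ℂ) (Polynomial.X ^ (n + d)) ≠ 0 :=
    algebraMap_ratFunc_ne_zero (pow_ne_zero _ Polynomial.X_ne_zero)
  have h0 : algebraMap (Polynomial ℂ) (RatFunc ℂ) (Polynomial.X ^ (n + d)) * chRat n d a 0 =
    algebraMap (Polynomial ℂ) (RatFunc ℂ) (chX n d a) := mul_div_cancel₀ _ hX
  have h1 : algebraMap (Polynomial ℂ) (RatFunc ℂ) (Polynomial.X ^ (n + d)) * chRat n d a 1 =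
    algebraMap (Polynomial ℂ) (RatFunc ℂ) (chY n d a) := mul_div_cancel₀ _ hX
  have hC : ∀ c : ℂ, algebraMap (Polynomial ℂ) (RatFunc ℂ) (Polynomial.C c) =
      algebraMap ℂ (RatFunc ℂ) c := fun c =>
    (IsScalarTower.algebraMap_apply ℂ (Polynomial ℂ) (RatFunc ℂ) c).symm
  have : toRat ![Polynomial.X ^ (n + d), chAffine n d a 1 0 (-x), chAffine n d a 0 1 (-y)] =
      fun i => algebraMap (Polynomial ℂ) (RatFunc ℂ) (Polynomial.X ^ (n + d)) *
        ![1, chRat n d a 0 - algebraMap ℂ (RatFunc ℂ) x,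
          chRat n d a 1 - algebraMap ℂ (RatFunc ℂ) y] i := by
    ext i : 1
    fin_cases i
    · exact (mul_one _).symm
    · simp only [toRat, chAffine, Fin.mk_one, Matrix.cons_val_one, Matrix.cons_val_zero, map_add,
        map_mul, hC, ← h0, map_neg, map_zero, map_one]
      ring
    · simp only [toRat, chAffine, Fin.reduceFinMk, Matrix.cons_val, map_add,
        map_mul, hC, ← h1, map_neg, map_zero, map_one]
      ring
  rw [this, aeval_smul_of_isHomogeneous hA, mul_eq_zero, or_iff_right (pow_ne_zero _ hX)]

theorem ratioField_chAffine (x y : ℂ) : ratioField (toRat ![Polynomial.X ^ (n + d),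
    chAffine n d a 1 0 (-x), chAffine n d a 0 1 (-y)]) = chField n d a := by
  have key : ∀ (c : Fin 3 → ℂ) (p : Fin 3 → Polynomial ℂ) (r : Polynomial ℂ),
      r = ∑ i, Polynomial.C (c i) * p i →
      algebraMap (Polynomial ℂ) (RatFunc ℂ) r = ∑ i, c i • toRat p i := by
    intro c p r h
    rw [sum_smul_toRat, h]
  refine le_antisymm (ratioField_le ![![1, 0, 0], ![-x, 1, 0], ![-y, 0, 1]] fun i => key _ _ _ ?_)
    (ratioField_le ![![1, 0, 0], ![x, 1, 0], ![y, 0, 1]] fun i => key _ _ _ ?_)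
  · fin_cases i <;> simp [Fin.sum_univ_three, chTriple, chAffine] <;> ring
  · fin_cases i <;> simp [Fin.sum_univ_three, chTriple, chAffine]

/-- The multiplicity of a point of the curve is the number of the parameters of its branches. -/
theorem mul_finrank_chField_of_isFoldPoint (hn : 0 < n) (hd : 0 < d) (hne : n ≠ d) {j : ℕ} {D : E2}
    (hD : IsFoldPoint (CH n d a) j D) {h s₁ s₂ : Polynomial ℂ} (hs : IsCoprime s₁ s₂)
    (h₁ : chAffine n d a 1 0 (-D 0) = h * s₁) (h₂ : chAffine n d a 0 1 (-D 1) = h * s₂) :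
    j * finrank (chField n d a) (RatFunc ℂ) = h.natDegree := by
  set P : Fin 3 → Polynomial ℂ :=
    ![Polynomial.X ^ (n + d), chAffine n d a 1 0 (-D 0), chAffine n d a 0 1 (-D 1)] with hP
  have hlin3 : ∀ c : Fin 3 → ℂ, ∑ i, Polynomial.C (c i) * P i = 0 → c = 0 := by
    intro c hc
    have h0 : chAffine n d a (c 1) (c 2) (c 0 - c 1 * D 0 - c 2 * D 1) = 0 := by
      rw [← hc, Fin.sum_univ_three]
      simp [hP, chAffine]
      ring
    by_contra hc0
    refine chAffine_ne_zero hn hd hne ?_ h0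
    rintro ⟨e1, e2, e0⟩
    apply hc0
    rw [e1, e2] at e0
    ext i
    fin_cases i
    exacts [by simpa using e0, e1, e2]
  have hlin : ∀ b c : ℂ, Polynomial.C b * P 1 + Polynomial.C c * P 2 = 0 → b = 0 ∧ c = 0 := by
    intro b c h
    have := hlin3 ![0, b, c] (by rw [Fin.sum_univ_three, ← h]; simp)
    exact ⟨congrFun this 1, congrFun this 2⟩
  have hroot : ∀ t, ∃ i, (P i).eval t ≠ 0 := by
    intro t
    by_cases ht : t = 0
    · refine ⟨1, ?_⟩
      change (chAffine n d a 1 0 (-D 0)).eval t ≠ 0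
      rw [ht, eval_zero_chAffine hn hd]
      norm_num
    · exact ⟨0, by simp [hP, ht]⟩
  have hcoeff : (P 1).coeff (2 * (n + d)) ≠ 0 := by
    change (chAffine n d a 1 0 (-D 0)).coeff _ ≠ 0
    rw [coeff_chAffine hn hd]
    norm_num
  have hP2 : P 2 ≠ 0 := fun h0 => one_ne_zero (hlin 0 1 (by rw [h0]; simp)).2
  obtain ⟨G, g, hG⟩ := exists_isFormGenerator (P := toRat P) (algebraMap_ratFunc_ne_zero hP2)
    (div_ne_C_of_linearIndependent hlin)
  -- In coordinates centred at the point, `G` is the homogeneous equation of the curve. Its degree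
  -- `g` and its degree `e` in the homogenising variable differ by the multiplicity of the point,
  -- and the field degrees give `g c = 2(n + d)` and `e c = 2(n + d) - h.natDegree`.
  have hg := degree_mul_finrank_eq hG hlin3 hroot (D := 2 * (n + d)) (by
    intro i
    fin_cases i
    · exact (Polynomial.natDegree_X_pow_le _).trans (by omega)
    · exact natDegree_chAffine_le hn hd _ _ _
    · exact natDegree_chAffine_le hn hd _ _ _) ⟨1, hcoeff⟩
  have he := degreeOf_mul_finrank_eq hG hlin hs h₁ h₂
  rw [hP, ratioField_chAffine] at hg he
  have hP1 : P 1 ≠ 0 := fun h0 => by simp [h0] at hcoeff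
  have hdeg : max s₁.natDegree s₂.natDegree + h.natDegree = 2 * (n + d) := by
    have e1 : h * s₁ ≠ 0 := by rw [← h₁]; exact hP1
    have e2 : h * s₂ ≠ 0 := by rw [← h₂]; exact hP2
    have h3 : (h * s₁).natDegree = 2 * (n + d) := by
      rw [← h₁]
      exact Polynomial.natDegree_eq_of_le_of_coeff_ne_zero (natDegree_chAffine_le hn hd _ _ _) hcoeff
    have h4 : (h * s₂).natDegree ≤ 2 * (n + d) := by
      rw [← h₂]
      exact natDegree_chAffine_le hn hd _ _ _
    rw [Polynomial.natDegree_mul (left_ne_zero_of_mul e1) (right_ne_zero_of_mul e1)] at h3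
    rw [Polynomial.natDegree_mul (left_ne_zero_of_mul e2) (right_ne_zero_of_mul e2)] at h4
    omega
  set e := degreeOf 0 G with hedef
  have hle : e ≤ g := degreeOf_le_of_isHomogeneous hG.isHomogeneous
  -- the equation of the curve
  obtain ⟨-, f, hf, hfj⟩ := hD
  have hmem : ∀ r : MvPolynomial (Fin 2) ℂ, f ∣ r ↔ aeval (chRat n d a) r = 0 := by
    intro r
    rw [← mem_vanishingIdeal_CH_iff hd, hf, Ideal.mem_span_singleton]
  set f₀ : MvPolynomial (Fin 2) ℂ := aeval ![1, X 0 - C (D 0 : ℂ), X 1 - C (D 1 : ℂ)] G with hf₀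
  have h1 : f ∣ f₀ := by
    rw [hmem, hf₀, comp_aeval_apply, ← (aeval_toRat_chAffine hG.isHomogeneous _ _).1 hG.aeval_eq_zero]
    congr 2
    ext i : 1
    fin_cases i <;> simp
  have h2 : f₀ ∣ f := by
    obtain ⟨A, k, hA, hAf⟩ := exists_homogenization
      (aeval ![X 0 + C (D 0 : ℂ), X 1 + C (D 1 : ℂ)] f : MvPolynomial (Fin 2) ℂ)
    have h3 : G ∣ A := by
      refine hG.dvd A k hA ((aeval_toRat_chAffine hA _ _).2 ?_)
      rw [hAf, comp_aeval_apply, ← (hmem f).1 dvd_rfl]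
      congr 2
      ext i : 1
      fin_cases i <;> simp
    have h4 := map_dvd (aeval ![1, X 0 - C (D 0 : ℂ), X 1 - C (D 1 : ℂ)] :
      MvPolynomial (Fin 3) ℂ →ₐ[ℂ] MvPolynomial (Fin 2) ℂ) h3
    rw [hAf, comp_aeval_apply] at h4
    refine h4.trans (dvd_of_eq ?_)
    conv_rhs => rw [← aeval_X_left_apply f]
    congr 2
    ext i : 1
    fin_cases i <;> simp [MvPolynomial.algebraMap_eq]
  obtain ⟨u, hu⟩ := associated_of_dvd_dvd h2 h1
  obtain ⟨c, hc, huc⟩ := isUnit_iff_eq_C_of_isReduced.1 u.isUnit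
  have hord : ordAt f (complexify D) = g - e := by
    have hev : ∀ (v : Fin 2 → ℂ) (ε : ℂ), eval (fun i => complexify D i + ε * v i) f =
        ε ^ (g - e) * (Polynomial.C c * aeval ![Polynomial.X, Polynomial.C (v 0), Polynomial.C (v 1), 1]
          (coneForm e G)).eval ε := by
      intro v ε
      have h5 : eval (fun i => complexify D i + ε * v i) f₀ =
          aeval ![1, ε * v 0, ε * v 1] G := by
        rw [hf₀, ← aeval_eq_eval, comp_aeval_apply]
        congr 2
        ext i : 1
        fin_cases i <;> simp [complexify]
      rw [← hu, huc, map_mul, h5, eval_C, ← coneForm_one,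
        coneForm_smul_mid hG.isHomogeneous hedef.symm.le hle, Polynomial.eval_mul, Polynomial.eval_C,
        eval_aeval_coneForm]
      simp only [Polynomial.eval_X, Polynomial.eval_C, Polynomial.eval_one, mul_one]
      ring
    refine ordAt_eq (fun v => ⟨_, hev v⟩) ?_
    obtain ⟨x, y, hxy⟩ := coneForm_zero_left_ne_zero hG.ne_zero
    refine ⟨![x, y], _, ?_, hev _⟩
    rw [Polynomial.eval_mul, Polynomial.eval_C, eval_aeval_coneForm]
    refine mul_ne_zero hc.ne_zero ?_
    simpa using hxy
  rw [← hfj, hord, Nat.sub_mul, hg, he]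
  omega

variable {S : CirclePlane}

/-- At a point of the axis `ξ` and `η` are invertible linear combinations of the two centred
coordinates, so both pairs have the same common factor. -/
theorem exists_coprime_combination {x y : ℂ} (hξ : S.xi 1 x y = 0) (hη : S.eta 1 x y = 0)
    {h s₁ s₂ : Polynomial ℂ} (hs : IsCoprime s₁ s₂)
    (h₁ : chAffine n d a 1 0 (-x) = h * s₁) (h₂ : chAffine n d a 0 1 (-y) = h * s₂) :
    ∃ r₁ r₂, IsCoprime r₁ r₂ ∧ chAffine n d a S.a₀ S.a₁ S.a₂ = h * r₁ ∧
      chAffine n d a S.b₀ S.b₁ S.b₂ = h * r₂ := by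
  obtain ⟨-, -, -, -, -, -, hΔ⟩ := S.exists_real_zero hξ hη
  have hΔ' : (S.a₀ * S.b₁ - S.a₁ * S.b₀ : ℂ) ≠ 0 := by exact_mod_cast hΔ
  obtain ⟨u, v, huv⟩ := hs
  set Δ := (S.a₀ * S.b₁ - S.a₁ * S.b₀ : ℂ) with hΔdef
  have key : ∀ b c w : ℂ, b * x + c * y + w = 0 →
      chAffine n d a b c w = h * (Polynomial.C b * s₁ + Polynomial.C c * s₂) := by
    intro b c w hw
    rw [mul_add, mul_left_comm, ← h₁, mul_left_comm, ← h₂, chAffine_add]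
    congr 1
    · ring
    · ring
    · linear_combination hw
  refine ⟨_, _, ⟨Polynomial.C Δ⁻¹ * (u * Polynomial.C (S.b₁ : ℂ) - v * Polynomial.C (S.b₀ : ℂ)),
    Polynomial.C Δ⁻¹ * (v * Polynomial.C (S.a₀ : ℂ) - u * Polynomial.C (S.a₁ : ℂ)), ?_⟩,
    key _ _ _ (by simpa [CirclePlane.xi] using hξ), key _ _ _ (by simpa [CirclePlane.eta] using hη)⟩
  have hinv : Polynomial.C Δ⁻¹ * (Polynomial.C (S.a₀ : ℂ) * Polynomial.C (S.b₁ : ℂ) -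
      Polynomial.C (S.a₁ : ℂ) * Polynomial.C (S.b₀ : ℂ)) = 1 := by
    rw [← Polynomial.C_mul, ← Polynomial.C_mul, ← Polynomial.C_sub, ← hΔdef, ← Polynomial.C_mul,
      inv_mul_cancel₀ hΔ', Polynomial.C_1]
  linear_combination huv + (u * s₁ + v * s₂) * hinv

/-- The expansion of `κ` at a point where it vanishes has no constant term, so the common factor of
the centred coordinates divides it too. The quotients have no common root: away from `0` because of
`ξ` and `η`, at `0` by the choice of the denominators. -/
theorem exists_common_factor (hn : 0 < n) (hd : 0 < d) (hne : n ≠ d) {x y : ℂ}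
    (hξ : S.xi 1 x y = 0) (hη : S.eta 1 x y = 0) (hκ : S.kappa 1 x y = 0)
    {h s₁ s₂ : Polynomial ℂ} (hs : IsCoprime s₁ s₂)
    (h₁ : chAffine n d a 1 0 (-x) = h * s₁) (h₂ : chAffine n d a 0 1 (-y) = h * s₂) :
    ∃ p' : Fin 3 → Polynomial ℂ, (∀ i, circlePoly S n d a i = h * p' i) ∧
      ∀ t, ∃ i, (p' i).eval t ≠ 0 := by
  obtain ⟨r₁, r₂, hr, e₁, e₂⟩ := exists_coprime_combination hξ hη hs h₁ h₂
  have hX : IsCoprime h (Polynomial.X ^ (n + d)) := by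
    refine IsCoprime.pow_right ((Polynomial.irreducible_X.coprime_iff_not_dvd.2 ?_).symm)
    rw [Polynomial.X_dvd_iff, Polynomial.coeff_zero_eq_eval_zero]
    intro h0
    have h3 := exists_eval_zero_chAffine_ne_zero (a := a) S hn hd
    rw [e₁, e₂] at h3
    simp [h0] at h3
  have hdvd : h ∣ circlePoly S n d a 0 := by
    refine hX.dvd_of_dvd_mul_left ?_
    rw [X_pow_mul_circlePoly_zero]
    refine Dvd.dvd.mul_left ?_ _
    have h3 : S.kappa (Polynomial.X ^ (n + d)) (chX n d a) (chY n d a) =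
        chAffine n d a 1 0 (-x) ^ 2 + chAffine n d a 0 1 (-y) ^ 2 + Polynomial.X ^ (n + d) *
        (Polynomial.C (2 * x + S.c₀) * chAffine n d a 1 0 (-x) +
          Polynomial.C (2 * y + S.c₁) * chAffine n d a 0 1 (-y)) := by
      have h4 := congrArg (Polynomial.C (R := ℂ)) hκ
      simp only [CirclePlane.kappa, one_mul, mul_one, Algebra.algebraMap_self, RingHom.id_apply] at h4
      simp only [Polynomial.C_add, Polynomial.C_mul, Polynomial.C_pow, Polynomial.C_0] at h4
      simp only [CirclePlane.kappa, chAffine, ← Polynomial.C_eq_algebraMap, Polynomial.C_add,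
        Polynomial.C_mul, Polynomial.C_neg, Polynomial.C_0, Polynomial.C_1,
        show (2 : ℂ) = 1 + 1 by norm_num]
      linear_combination (Polynomial.X ^ (n + d)) ^ 2 * h4
    rw [h3, h₁, h₂]
    exact ⟨h * s₁ ^ 2 + h * s₂ ^ 2 + Polynomial.X ^ (n + d) * (Polynomial.C (2 * x + S.c₀) * s₁ +
      Polynomial.C (2 * y + S.c₁) * s₂), by ring⟩
  obtain ⟨r₀, hr₀⟩ := hdvd
  have hfac : ∀ i, circlePoly S n d a i = h *
      ![r₀, Polynomial.X ^ (n - d) * r₁, Polynomial.X ^ (n - d) * r₂] i := by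
    intro i
    fin_cases i
    · exact hr₀
    · change Polynomial.X ^ (n - d) * chAffine n d a S.a₀ S.a₁ S.a₂ = h * (Polynomial.X ^ (n - d) * r₁)
      rw [e₁]; ring
    · change Polynomial.X ^ (n - d) * chAffine n d a S.b₀ S.b₁ S.b₂ = h * (Polynomial.X ^ (n - d) * r₂)
      rw [e₂]; ring
  refine ⟨_, hfac, fun t => ?_⟩
  by_contra! hall
  by_cases ht : t = 0
  · subst ht
    obtain ⟨i, hi⟩ := exists_eval_zero_circlePoly_ne_zero (a := a) S hn hd hne
    rw [hfac, Polynomial.eval_mul, hall, mul_zero] at hi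
    exact hi rfl
  · obtain ⟨u, v, huv⟩ := hr
    have h5 := hall 1
    have h6 := hall 2
    simp [ht] at h5 h6
    have := congrArg (Polynomial.eval t) huv
    simp [h5, h6] at this

/-- At the pole the radius polynomial is the whole common factor because `t^(2d) + 1` and `t^(2d) -
1` are coprime. -/
theorem exists_origin_factor : ∃ s₁ s₂ : Polynomial ℂ, IsCoprime s₁ s₂ ∧
    chAffine n d a 1 0 (-0) = chRadius n a * s₁ ∧ chAffine n d a 0 1 (-0) = chRadius n a * s₂ := by
  refine ⟨Polynomial.C (1 / 4) * (Polynomial.X ^ (2 * d) + 1),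
    Polynomial.C (-Complex.I / 4) * (Polynomial.X ^ (2 * d) - 1),
    ⟨Polynomial.C 2, Polynomial.C (-2 * Complex.I), ?_⟩, ?_, ?_⟩
  · refine Polynomial.funext fun t => ?_
    simp only [Polynomial.eval_add, Polynomial.eval_mul, Polynomial.eval_sub,
      Polynomial.eval_pow, Polynomial.eval_X, Polynomial.eval_C, Polynomial.eval_one]
    linear_combination ((t ^ (2 * d) - 1) / 2) * Complex.I_sq
  · simp [chAffine, chX]; ring
  · simp [chAffine, chY]; ring

theorem exists_isCoprime_factor (p₁ p₂ : Polynomial ℂ) (h : p₁ ≠ 0) :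
    ∃ k s₁ s₂, IsCoprime s₁ s₂ ∧ p₁ = k * s₁ ∧ p₂ = k * s₂ := by
  classical
  let _ := EuclideanDomain.gcdMonoid (Polynomial ℂ)
  have h0 : GCDMonoid.gcd p₁ p₂ ≠ 0 := gcd_ne_zero_of_left h
  exact ⟨_, _, _, isCoprime_div_gcd_div_gcd_of_gcd_ne_zero h0,
    (EuclideanDomain.mul_div_cancel' h0 (gcd_dvd_left _ _)).symm,
    (EuclideanDomain.mul_div_cancel' h0 (gcd_dvd_right _ _)).symm⟩

/-- A common zero of `ξ` and `η` on the complexified curve is a real point. -/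
theorem exists_real_of_eval_chAffine (hn : 0 < n) (hd : 0 < d) {t : ℂ}
    (h1 : (chAffine n d a S.a₀ S.a₁ S.a₂).eval t = 0)
    (h2 : (chAffine n d a S.b₀ S.b₁ S.b₂).eval t = 0) :
    t ≠ 0 ∧ ∃ Z : E2, complexify Z = chPoint n d a t ∧ S.xi 1 (Z 0 : ℂ) (Z 1) = 0 ∧
      S.eta 1 (Z 0 : ℂ) (Z 1) = 0 := by
  have ht : t ≠ 0 := by
    rintro rfl
    have h3 := exists_eval_zero_chAffine_ne_zero (a := a) S hn hd
    simp [h1, h2] at h3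
  rw [eval_chAffine ht, mul_eq_zero, or_iff_right (pow_ne_zero _ ht)] at h1 h2
  have hξ : S.xi 1 (chPoint n d a t 0) (chPoint n d a t 1) = 0 := by
    simpa [CirclePlane.xi] using h1
  have hη : S.eta 1 (chPoint n d a t 0) (chPoint n d a t 1) = 0 := by
    simpa [CirclePlane.eta] using h2
  obtain ⟨x, y, hx, hy, -⟩ := S.exists_real_zero hξ hη
  refine ⟨ht, !₂[x, y], ?_, ?_, ?_⟩
  · ext i
    fin_cases i
    exacts [hx.symm, hy.symm]
  · rw [hx, hy] at hξ
    exact hξ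
  · rw [hx, hy] at hη
    exact hη

/-- Away from `t = 0` a common zero of `ξ` and `η` comes from a real point on the axis, and there
`κ` is nonzero by hypothesis. -/
theorem exists_eval_circlePoly_ne_zero (hn : 0 < n) (hd : 0 < d) (hne : n ≠ d)
    (h : ∀ (t : ℂ) (Z : E2), t ≠ 0 → complexify Z = chPoint n d a t → S.xi 1 (Z 0 : ℂ) (Z 1) = 0 →
      S.eta 1 (Z 0 : ℂ) (Z 1) = 0 → S.kappa 1 (Z 0 : ℂ) (Z 1) ≠ 0) (t : ℂ) :
    ∃ i, (circlePoly S n d a i).eval t ≠ 0 := by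
  by_cases ht : t = 0
  · rw [ht]
    exact exists_eval_zero_circlePoly_ne_zero S hn hd hne
  by_contra! hall
  have h1 := hall 1
  have h2 := hall 2
  change (Polynomial.X ^ (n - d) * chAffine n d a S.a₀ S.a₁ S.a₂).eval t = 0 at h1
  change (Polynomial.X ^ (n - d) * chAffine n d a S.b₀ S.b₁ S.b₂).eval t = 0 at h2
  simp [ht] at h1 h2
  obtain ⟨-, Z, hZ, hξ, hη⟩ := exists_real_of_eval_chAffine hn hd h1 h2
  have h0 := hall 0
  rw [eval_circlePoly S ht, mul_eq_zero, or_iff_right (pow_ne_zero _ ht), ← hZ] at h0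
  exact h t Z ht hZ hξ hη h0

theorem eq_of_xi_eta_eq_zero {Z Z' : E2} (hξ : S.xi 1 (Z 0 : ℂ) (Z 1) = 0)
    (hη : S.eta 1 (Z 0 : ℂ) (Z 1) = 0) (hξ' : S.xi 1 (Z' 0 : ℂ) (Z' 1) = 0)
    (hη' : S.eta 1 (Z' 0 : ℂ) (Z' 1) = 0) : Z = Z' := by
  obtain ⟨x, y, hx, hy, h1, h2, hΔ⟩ := S.exists_real_zero hξ hη
  obtain ⟨x', y', hx', hy', h1', h2', -⟩ := S.exists_real_zero hξ' hη'
  have e0 : x - x' = 0 := by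
    refine (mul_eq_zero.1 (?_ : (S.a₀ * S.b₁ - S.a₁ * S.b₀) * (x - x') = 0)).resolve_left hΔ
    linear_combination S.b₁ * (h1 - h1') - S.a₁ * (h2 - h2')
  have e1 : y - y' = 0 := by
    refine (mul_eq_zero.1 (?_ : (S.a₀ * S.b₁ - S.a₁ * S.b₀) * (y - y') = 0)).resolve_left hΔ
    linear_combination S.a₀ * (h2 - h2') - S.b₀ * (h1 - h1')
  rw [sub_eq_zero] at e0 e1
  rw [← e0, ← hx] at hx'
  rw [← e1, ← hy] at hy'
  ext i
  fin_cases i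
  · exact_mod_cast hx'.symm
  · exact_mod_cast hy'.symm

end Axis

/-! ### The positions of the curve relative to the axis -/

section Types

variable {n d : ℕ} {a q : ℝ} {S : CirclePlane} {ι : E2 →ᵃⁱ[ℝ] E3} {p : ℂ}

theorem HasRow.congr {F : MvPolynomial (Fin 4) ℂ} {o c x t o' c' x' t' : ℤ}
    (h : HasRow p F o c x t) (ho : o = o') (hc : c = c') (hx : x = x') (ht : t = t') :
    HasRow p F o' c' x' t' := by
  subst ho hc hx ht
  exact h

/-- On the axis `κ` equals `z² - q = (z - p)(z + p)`. -/
theorem isDirectingPoint_iff (hp : p ^ 2 = q)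
    (hS : ∀ Q : E2, circleCoords q (ι Q) = S.triple (Q 0 : ℂ) (Q 1)) (Q : E2) :
    IsDirectingPoint p (ι Q) ↔ ι Q ∈ zAxis ∧ S.kappa 1 (Q 0 : ℂ) (Q 1) = 0 := by
  have h0 : S.kappa 1 (Q 0 : ℂ) (Q 1) = ((ι Q 0 ^ 2 + ι Q 1 ^ 2 + ι Q 2 ^ 2 - q : ℝ) : ℂ) :=
    (congrFun (hS Q) 0).symm
  have hz : ι Q ∈ zAxis ↔ (ι Q 0 : ℂ) = 0 ∧ (ι Q 1 : ℂ) = 0 := by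
    rw [Complex.ofReal_eq_zero, Complex.ofReal_eq_zero]
    rfl
  have hw : ∀ w : ℂ, homog (ι Q) = axisPoint w ↔
      (ι Q 0 : ℂ) = 0 ∧ (ι Q 1 : ℂ) = 0 ∧ (ι Q 2 : ℂ) = w := by
    intro w
    constructor
    · intro h
      exact ⟨congrFun h 1, congrFun h 2, congrFun h 3⟩
    · rintro ⟨h1, h2, h3⟩
      rw [homog, h1, h2, h3, axisPoint]
  rw [IsDirectingPoint, hw, hw, hz, h0]
  push_cast
  constructor
  · rintro (⟨h1, h2, h3⟩ | ⟨h1, h2, h3⟩) <;>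
    · refine ⟨⟨h1, h2⟩, ?_⟩
      rw [h1, h2, h3, ← hp]
      ring
  · rintro ⟨⟨h1, h2⟩, h3⟩
    have h4 : ((ι Q 2 : ℂ) - p) * (ι Q 2 + p) = 0 := by
      rw [h1, h2, ← hp] at h3
      linear_combination h3
    rcases mul_eq_zero.1 h4 with h | h
    · exact Or.inl ⟨h1, h2, sub_eq_zero.1 h⟩
    · exact Or.inr ⟨h1, h2, eq_neg_of_add_eq_zero_left h⟩

theorem mem_algCurve_of_isFoldPoint {C : Set E2} {j : ℕ} {D : E2} (h : IsFoldPoint C j D) :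
    D ∈ algCurve C := by
  obtain ⟨hj, f, hf, hord⟩ := h
  have h0 : eval (complexify D) f = 0 := by
    by_contra hne
    have : ordAt f (complexify D) ≤ 0 := by
      refine Nat.sInf_le ?_
      rw [Set.mem_ofPred_eq, homogeneousComponent_zero]
      intro h
      apply hne
      rw [C_eq_zero] at h
      have h1 := eval_translate f (complexify D) 0
      simp only [Pi.zero_apply, add_zero] at h1
      rw [← constantCoeff_eq, ← eval_zero, h1] at h
      exact h
    omega
  intro g hg
  have hg' : g ∈ Ideal.span {f} := hf ▸ hg
  obtain ⟨r, rfl⟩ := Ideal.mem_span_singleton.1 hg'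
  rw [map_mul, aeval_eq_eval, h0, zero_mul]

section Row

variable {G : MvPolynomial (Fin 3) ℂ} {g δ c : ℕ}

theorem exists_hasRow_of_kappa_eq_zero (hn : 0 < n) (hd : 0 < d) (hne : n ≠ d) (hp : p ^ 2 = q)
    (hG : IsFormGenerator (toRat (circlePoly S n d a)) G g)
    (hc : finrank (circleField S n d a) (RatFunc ℂ) = δ * c) {x y : ℂ}
    (hξ : S.xi 1 x y = 0) (hη : S.eta 1 x y = 0) (hκ : S.kappa 1 x y = 0)
    {h s₁ s₂ : Polynomial ℂ} (hs : IsCoprime s₁ s₂)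
    (h₁ : chAffine n d a 1 0 (-x) = h * s₁) (h₂ : chAffine n d a 0 1 (-y) = h * s₂) :
    ∃ E Γ : ℕ, E * c + h.natDegree = 2 * (n + d) ∧ Γ * c + h.natDegree = 2 * (n + d + (n - d)) ∧
      HasRow p (surfaceForm q (degreeOf 0 G) G ^ δ) (Γ + E) E (Γ - E) Γ := by
  obtain ⟨r₁, r₂, hr, e₁, e₂⟩ := exists_coprime_combination hξ hη hs h₁ h₂
  obtain ⟨p', hp', hroot⟩ := exists_common_factor hn hd hne hξ hη hκ hs h₁ h₂
  exact exists_hasRow hn hd hne hp hG rfl hr e₁ e₂ hp' hroot hc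

theorem exists_hasRow_of_kappa_ne_zero (hn : 0 < n) (hd : 0 < d) (hne : n ≠ d) (hp : p ^ 2 = q)
    (hG : IsFormGenerator (toRat (circlePoly S n d a)) G g)
    (hc : finrank (circleField S n d a) (RatFunc ℂ) = δ * c) {Z : E2}
    (hξ : S.xi 1 (Z 0 : ℂ) (Z 1) = 0) (hη : S.eta 1 (Z 0 : ℂ) (Z 1) = 0)
    (hκ : S.kappa 1 (Z 0 : ℂ) (Z 1) ≠ 0) {h s₁ s₂ : Polynomial ℂ} (hs : IsCoprime s₁ s₂)
    (h₁ : chAffine n d a 1 0 (-Z 0) = h * s₁) (h₂ : chAffine n d a 0 1 (-Z 1) = h * s₂) :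
    ∃ E Γ : ℕ, E * c + h.natDegree = 2 * (n + d) ∧ Γ * c = 2 * (n + d + (n - d)) ∧
      HasRow p (surfaceForm q (degreeOf 0 G) G ^ δ) (Γ + E) E (Γ - E) Γ := by
  obtain ⟨r₁, r₂, hr, e₁, e₂⟩ := exists_coprime_combination hξ hη hs h₁ h₂
  obtain ⟨E, Γ, hE, hΓ, hrow⟩ := exists_hasRow hn hd hne hp hG rfl hr e₁ e₂
    (fun i => (one_mul (circlePoly S n d a i)).symm)
    (exists_eval_circlePoly_ne_zero hn hd hne fun t Z' _ _ hξ' hη' => by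
      rw [eq_of_xi_eta_eq_zero hξ' hη' hξ hη]
      exact hκ) hc
  exact ⟨E, Γ, hE, by simpa using hΓ, hrow⟩

theorem exists_hasRow_of_notMem_zAxis (hn : 0 < n) (hd : 0 < d) (hne : n ≠ d) (hp : p ^ 2 = q)
    (hS : ∀ Q : E2, circleCoords q (ι Q) = S.triple (Q 0 : ℂ) (Q 1))
    (hG : IsFormGenerator (toRat (circlePoly S n d a)) G g)
    (hc : finrank (circleField S n d a) (RatFunc ℂ) = δ * c)
    (hz : ∀ Q ∈ algCurve (CH n d a), ι Q ∉ zAxis) :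
    ∃ E Γ : ℕ, E * c = 2 * (n + d) ∧ Γ * c = 2 * (n + d + (n - d)) ∧
      HasRow p (surfaceForm q (degreeOf 0 G) G ^ δ) (Γ + E) E (Γ - E) Γ := by
  have hno : ∀ (t : ℂ) (Z : E2), t ≠ 0 → complexify Z = chPoint n d a t →
      S.xi 1 (Z 0 : ℂ) (Z 1) = 0 → S.eta 1 (Z 0 : ℂ) (Z 1) = 0 → False := by
    intro t Z ht hZ hξ hη
    refine hz Z (fun f hf => ?_) ((notMem_zAxis_iff hS Z).2 ⟨hξ, hη⟩)
    rw [aeval_eq_eval, hZ]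
    exact eval_chPoint_eq_zero hd hf ht
  have hne0 : chAffine n d a S.a₀ S.a₁ S.a₂ ≠ 0 := by
    refine chAffine_ne_zero hn hd hne ?_
    rintro ⟨h0, h1, h2⟩
    exact one_ne_zero (S.independent (b := 1) (c := 0) (by simp [h0]) (by simp [h1])
      (by simp [h2])).1
  obtain ⟨k, r₁, r₂, hr, e₁, e₂⟩ := exists_isCoprime_factor _ (chAffine n d a S.b₀ S.b₁ S.b₂) hne0
  -- A root of the common factor would be the parameter of a real point of the closure on the axis.
  have hk : k.natDegree = 0 := by
    by_contra hk
    obtain ⟨t, ht⟩ := IsAlgClosed.exists_root k fun h => hk (Polynomial.natDegree_eq_of_degree_eq_some h)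
    obtain ⟨ht0, Z, hZ, hξ, hη⟩ := exists_real_of_eval_chAffine (S := S) (a := a) (t := t) hn hd
      (by rw [e₁, Polynomial.eval_mul, ht.eq_zero, zero_mul])
      (by rw [e₂, Polynomial.eval_mul, ht.eq_zero, zero_mul])
    exact hno t Z ht0 hZ hξ hη
  obtain ⟨E, Γ, hE, hΓ, hrow⟩ := exists_hasRow hn hd hne hp hG rfl hr e₁ e₂
    (fun i => (one_mul (circlePoly S n d a i)).symm)
    (exists_eval_circlePoly_ne_zero hn hd hne fun t Z' ht hZ hξ hη => (hno t Z' ht hZ hξ hη).elim) hc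
  exact ⟨E, Γ, by simpa [hk] using hE, by simpa using hΓ, hrow⟩

end Row

end Types

/-! ### The table of orders and multiplicities -/

theorem theorem2 (n d : ℕ) (hn : 0 < n) (hd : 0 < d) (hnd : n.Coprime d) (hne : n ≠ d)
    (a : ℝ) (ha : 0 ≤ a) (p : ℂ) (q : ℝ) (hp : p ^ 2 = (q : ℂ))
    (ι : E2 →ᵃⁱ[ℝ] E3) (hι : ¬ zAxis ⊆ Set.range ι) :
    ∃ (F : MvPolynomial (Fin 4) ℂ) (δ : ℕ),
      IsSurfaceEquation (circularSurface q (ι '' CH n d a)) F ∧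
      IsCircleMultiplicity q (ι '' CH n d a) δ ∧
      -- Type 1: the origin `O` of the curve is `P₁` or `P₂`
      (IsDirectingPoint p (ι 0) →
        δ = 1 ∧
        ((a = 0 ∧ Odd (n * d)) →
          (d < n → HasRow p F (n + d) d (n - d) n) ∧
          (n < d → HasRow p F (2 * d) d 0 d)) ∧
        (¬ (a = 0 ∧ Odd (n * d)) →
          (d < n → HasRow p F (2 * (n + d)) (2 * d) (2 * (n - d)) (2 * n)) ∧
          (n < d → HasRow p F (4 * d) (2 * d) 0 (2 * d)))) ∧
      -- Type 2: `O` lies on the axis and is different from `P₁`, `P₂`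
      (ι 0 ∈ zAxis → ¬ IsDirectingPoint p (ι 0) →
        δ = 1 ∧
        ((a = 0 ∧ Odd (n * d)) →
          (d < n → HasRow p F (2 * n + d) d (2 * n - d) (2 * n)) ∧
          (n < d → HasRow p F (n + 2 * d) d n (n + d))) ∧
        (¬ (a = 0 ∧ Odd (n * d)) →
          (d < n → HasRow p F (2 * (2 * n + d)) (2 * d) (2 * (2 * n - d)) (4 * n)) ∧
          (n < d → HasRow p F (2 * (n + 2 * d)) (2 * d) (2 * n) (2 * (n + d))))) ∧
      -- Type 3: another real `j`-fold point `D` of the curve is `P₁` or `P₂`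
      (∀ (j : ℕ) (D : E2), D ≠ 0 → IsFoldPoint (CH n d a) j D → IsDirectingPoint p (ι D) →
        δ = 1 ∧
        ((a = 0 ∧ Odd (n * d)) →
          (d < n → HasRow p F (3 * n + d - 2 * j) (n + d - j) (n - d) (2 * n - j)) ∧
          (n < d → HasRow p F (2 * (n + d) - 2 * j) (n + d - j) 0 (n + d - j))) ∧
        (¬ (a = 0 ∧ Odd (n * d)) →
          (d < n → HasRow p F (2 * (3 * n + d) - 2 * j) (2 * (n + d) - j) (2 * (n - d))
            (4 * n - j)) ∧
          (n < d → HasRow p F (4 * (n + d) - 2 * j) (2 * (n + d) - j) 0 (2 * (n + d) - j)))) ∧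
      -- Type 4: such a point `D` lies on the axis and is different from `P₁`, `P₂`
      (∀ (j : ℕ) (D : E2), D ≠ 0 → IsFoldPoint (CH n d a) j D → ι D ∈ zAxis →
          ¬ IsDirectingPoint p (ι D) →
        δ = 1 ∧
        ((a = 0 ∧ Odd (n * d)) →
          (d < n → HasRow p F (3 * n + d - j) (n + d - j) (n - d + j) (2 * n)) ∧
          (n < d → HasRow p F (2 * (n + d) - j) (n + d - j) j (n + d))) ∧
        (¬ (a = 0 ∧ Odd (n * d)) →
          (d < n → HasRow p F (2 * (3 * n + d) - j) (2 * (n + d) - j) (2 * (n - d) + j)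
            (4 * n)) ∧
          (n < d → HasRow p F (4 * (n + d) - j) (2 * (n + d) - j) j (2 * (n + d))))) ∧
      -- Type 5: the curve does not meet the axis; a general circle of the system carries `δ`
      -- points of the curve and is counted `δ` times
      ((∀ Q ∈ algCurve (CH n d a), ι Q ∉ zAxis) →
        ((a = 0 ∧ Odd (n * d)) →
          (d < n → HasRow p (F ^ δ) (3 * n + d) (n + d) (n - d) (2 * n)) ∧
          (n < d → HasRow p (F ^ δ) (2 * (n + d)) (n + d) 0 (n + d))) ∧
        (¬ (a = 0 ∧ Odd (n * d)) →
          (d < n → HasRow p (F ^ δ) (2 * (3 * n + d)) (2 * (n + d)) (2 * (n - d)) (4 * n)) ∧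
          (n < d → HasRow p (F ^ δ) (4 * (n + d)) (2 * (n + d)) 0 (2 * (n + d))))) := by
  classical
  obtain ⟨S, hS⟩ := exists_circlePlane q ι hι
  obtain ⟨G, g, hG⟩ := exists_circlePoly_generator (S := S) (a := a) hn hd hne
  set δ := if CircleInjective S n d a then 1 else 2 with hδ
  set c := finrank (chField n d a) (RatFunc ℂ) with hcdef
  have hc : finrank (circleField S n d a) (RatFunc ℂ) = δ * c := finrank_circleField S hn hd hne
  have hcA : (a = 0 ∧ Odd (n * d)) → c = 2 := fun h => by
    rw [hcdef, finrank_chField hn hd hnd, if_pos h]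
  have hcB : ¬ (a = 0 ∧ Odd (n * d)) → c = 1 := fun h => by
    rw [hcdef, finrank_chField hn hd hnd, if_neg h]
  have hδ1 : CircleInjective S n d a → δ = 1 := fun h => if_pos h
  have hz := notMem_zAxis_iff hS
  have hdir := isDirectingPoint_iff hp hS
  have hz0 : ι 0 ∈ zAxis → S.xi 1 (0 : ℂ) 0 = 0 ∧ S.eta 1 (0 : ℂ) 0 = 0 := by
    intro h
    simpa using (hz 0).1 h
  obtain ⟨o₁, o₂, ho, eo₁, eo₂⟩ := exists_origin_factor (n := n) (d := d) (a := a)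
  -- Types 3 and 4 share this: a real point of the closure other than the pole lies on the curve
  -- itself, so `δ = 1`, and its common factor has degree `j c`. They differ only in whether the
  -- factor also divides `κ`.
  have hfold : ∀ (j : ℕ) (D : E2), D ≠ 0 → IsFoldPoint (CH n d a) j D → ι D ∈ zAxis →
      δ = 1 ∧ ∃ h s₁ s₂ : Polynomial ℂ, IsCoprime s₁ s₂ ∧ chAffine n d a 1 0 (-D 0) = h * s₁ ∧
        chAffine n d a 0 1 (-D 1) = h * s₂ ∧ h.natDegree = j * c := by
    intro j D hD0 hD hDz
    have hDC := mem_CH_of_mem_algCurve hn hd (mem_algCurve_of_isFoldPoint hD) hD0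
    obtain ⟨h, s₁, s₂, hs, e₁, e₂⟩ := exists_isCoprime_factor (chAffine n d a 1 0 (-D 0))
      (chAffine n d a 0 1 (-D 1)) (chAffine_ne_zero hn hd hne (by simp))
    exact ⟨hδ1 (circleInjective_of_mem S hn hd hne hDC ((hz D).1 hDz).1 ((hz D).1 hDz).2),
      h, s₁, s₂, hs, e₁, e₂, (mul_finrank_chField_of_isFoldPoint hn hd hne hD hs e₁ e₂).symm⟩
  refine ⟨surfaceForm q (degreeOf 0 G) G, δ, isSurfaceEquation_circlePoly hn hd hne hS hG rfl,
    isCircleMultiplicity hn hd hne hS, ?_, ?_, ?_, ?_, ?_⟩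
  · intro h0
    obtain ⟨h1, h2⟩ := (hdir 0).1 h0
    obtain ⟨hξ, hη⟩ := hz0 h1
    have h3 := hδ1 (circleInjective_of_origin S hn hd hne hξ hη)
    obtain ⟨E, Γ, hE, hΓ, hrow⟩ := exists_hasRow_of_kappa_eq_zero hn hd hne hp hG hc hξ hη
      (by simpa using h2) ho eo₁ eo₂
    rw [natDegree_chRadius hn] at hE hΓ
    rw [h3, pow_one] at hrow
    refine ⟨h3, fun hA => ?_, fun hB => ?_⟩
    · rw [hcA hA] at hE hΓ
      exact ⟨fun h => hrow.congr (by omega) (by omega) (by omega) (by omega),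
        fun h => hrow.congr (by omega) (by omega) (by omega) (by omega)⟩
    · rw [hcB hB] at hE hΓ
      exact ⟨fun h => hrow.congr (by omega) (by omega) (by omega) (by omega),
        fun h => hrow.congr (by omega) (by omega) (by omega) (by omega)⟩
  · intro h1 h0
    obtain ⟨hξ, hη⟩ := hz0 h1
    have h2 : S.kappa 1 (((0 : E2) 0 : ℝ) : ℂ) ((0 : E2) 1 : ℝ) ≠ 0 := fun h => h0 ((hdir 0).2 ⟨h1, h⟩)
    have h3 := hδ1 (circleInjective_of_origin S hn hd hne hξ hη)
    obtain ⟨E, Γ, hE, hΓ, hrow⟩ := exists_hasRow_of_kappa_ne_zero (Z := 0) hn hd hne hp hG hc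
      ((hz 0).1 h1).1 ((hz 0).1 h1).2 h2 ho (by simpa using eo₁) (by simpa using eo₂)
    rw [natDegree_chRadius hn] at hE
    rw [h3, pow_one] at hrow
    refine ⟨h3, fun hA => ?_, fun hB => ?_⟩
    · rw [hcA hA] at hE hΓ
      exact ⟨fun h => hrow.congr (by omega) (by omega) (by omega) (by omega),
        fun h => hrow.congr (by omega) (by omega) (by omega) (by omega)⟩
    · rw [hcB hB] at hE hΓ
      exact ⟨fun h => hrow.congr (by omega) (by omega) (by omega) (by omega),
        fun h => hrow.congr (by omega) (by omega) (by omega) (by omega)⟩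
  · intro j D hD0 hD hDp
    obtain ⟨h1, h2⟩ := (hdir D).1 hDp
    obtain ⟨h3, h, s₁, s₂, hs, e₁, e₂, hj⟩ := hfold j D hD0 hD h1
    obtain ⟨E, Γ, hE, hΓ, hrow⟩ := exists_hasRow_of_kappa_eq_zero hn hd hne hp hG hc
      ((hz D).1 h1).1 ((hz D).1 h1).2 h2 hs e₁ e₂
    rw [hj] at hE hΓ
    rw [h3, pow_one] at hrow
    refine ⟨h3, fun hA => ?_, fun hB => ?_⟩
    · rw [hcA hA] at hE hΓ
      exact ⟨fun h => hrow.congr (by omega) (by omega) (by omega) (by omega),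
        fun h => hrow.congr (by omega) (by omega) (by omega) (by omega)⟩
    · rw [hcB hB] at hE hΓ
      exact ⟨fun h => hrow.congr (by omega) (by omega) (by omega) (by omega),
        fun h => hrow.congr (by omega) (by omega) (by omega) (by omega)⟩
  · intro j D hD0 hD h1 hDp
    have h2 : S.kappa 1 (D 0 : ℂ) (D 1) ≠ 0 := fun h => hDp ((hdir D).2 ⟨h1, h⟩)
    obtain ⟨h3, h, s₁, s₂, hs, e₁, e₂, hj⟩ := hfold j D hD0 hD h1
    obtain ⟨E, Γ, hE, hΓ, hrow⟩ := exists_hasRow_of_kappa_ne_zero hn hd hne hp hG hc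
      ((hz D).1 h1).1 ((hz D).1 h1).2 h2 hs e₁ e₂
    rw [hj] at hE
    rw [h3, pow_one] at hrow
    refine ⟨h3, fun hA => ?_, fun hB => ?_⟩
    · rw [hcA hA] at hE hΓ
      exact ⟨fun h => hrow.congr (by omega) (by omega) (by omega) (by omega),
        fun h => hrow.congr (by omega) (by omega) (by omega) (by omega)⟩
    · rw [hcB hB] at hE hΓ
      exact ⟨fun h => hrow.congr (by omega) (by omega) (by omega) (by omega),
        fun h => hrow.congr (by omega) (by omega) (by omega) (by omega)⟩
  · intro hoff
    obtain ⟨E, Γ, hE, hΓ, hrow⟩ := exists_hasRow_of_notMem_zAxis hn hd hne hp hS hG hc hoff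
    refine ⟨fun hA => ?_, fun hB => ?_⟩
    · rw [hcA hA] at hE hΓ
      exact ⟨fun h => hrow.congr (by omega) (by omega) (by omega) (by omega),
        fun h => hrow.congr (by omega) (by omega) (by omega) (by omega)⟩
    · rw [hcB hB] at hE hΓ
      exact ⟨fun h => hrow.congr (by omega) (by omega) (by omega) (by omega),
        fun h => hrow.congr (by omega) (by omega) (by omega) (by omega)⟩
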